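/- **Notation.** Let $n\ge 1$. For $f\in\mathcal S(\mathbb R^n)$ put $\widehat f(\xi)=\int e^{-ix\cdot\xi}f(x)\,dx$ and $\check f(x)=(2\pi)^{-n}\int e^{ix\cdot\xi}f(\xi)\,d\xi$. A *Littlewood–Paley partition of unity* on $\mathbb R^d$ is a family $\{\psi_k\}_{k\ge0}$ with $\psi_0=\phi$ and $\psi_k=\psi(\cdot/2^k)$ for $k\ge1$, where $\psi=\phi-\phi(2\,\cdot)$ and $\phi\in\mathcal S(\mathbb R^d)$ satisfies $\phi=1$ on $\{|\xi|\le1\}$ and $\operatorname{supp}\phi\subset\{|\xi|\le2\}$. Let $\{\psi_k\}$ and $\{\Psi_j\}$ be such partitions on $\mathbb R^n$ and on $(\mathbb R^n)^2$, respectively. For $\sigma=\sigma(x,\xi,\eta)\in L^\infty((\mathbb R^n)^3)$, $\boldsymbol k=(k_0,k_1,k_2)\in\mathbb N_0^3$ and $j\in\mathbb N_0$ let $$\Delta_{\boldsymbol k}\sigma=\psi_{k_0}(D_x)\psi_{k_1}(D_\xi)\psi_{k_2}(D_\eta)\sigma=(\check\psi_{k_0}\otimes\check\psi_{k_1}\otimes\check\psi_{k_2})*\sigma,$$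 $$\sigma_j^\rho(x,\xi,\eta)=\sigma(2^{-j\rho}x,2^{j\rho}\xi,2^{j\rho}\eta)\,\Psi_j(2^{j\rho}\xi,2^{j\rho}\eta).$$ With $\|F\|_{L^2_{ul}(\mathbb R^{d})}=\sup_{\nu\in\mathbb Z^{d}}\big(\int_{[-1/2,1/2)^{d}}|F(x+\nu)|^2dx\big)^{1/2}$ and $\boldsymbol s=(s_0,s_1,s_2)\in[0,\infty)^3$, the class $BS^m_{\rho,\rho}(\boldsymbol s;\mathbb R^n)$ consists of all $\sigma\in L^\infty((\mathbb R^n)^3)$ such that $$\|\sigma\|_{BS^m_{\rho,\rho}(\boldsymbol s;\mathbb R^n)}=\sup_{j\in\mathbb N_0}\ \sum_{\boldsymbol k\in\mathbb N_0^3}2^{-jm+k_0s_0+k_1s_1+k_2s_2}\,\|\Delta_{\boldsymbol k}[\sigma_j^\rho]\|_{L^2_{ul}((\mathbb R^n)^3)}<\infty .$$ For $f,g\in\mathcal S(\mathbb R^n)$ let $$T_\sigma(f,g)(x)=\frac1{(2\pi)^{2n}}\int_{(\mathbb R^n)^2}e^{ix\cdot(\xi+\eta)}\sigma(x,\xi,\eta)\widehat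 f(\xi)\widehat g(\eta)\,d\xi\,d\eta .$$ **Theorem.** Let $0\le\rho<1$, $m=-(1-\rho)n/2$, and let $s_0,s_1,s_2\ge n/2$. If $\sigma\in BS^m_{\rho,\rho}(\boldsymbol s;\mathbb R^n)$ (with respect to any choice of the two Littlewood–Paley partitions of unity), then $T_\sigma$ is bounded from $L^2(\mathbb R^n)\times L^2(\mathbb R^n)$ to $L^1(\mathbb R^n)$: there is a constant $C$ such that $$\|T_\sigma(f,g)\|_{L^1}\le C\,\|f\|_{L^2}\|g\|_{L^2}\qquad\text{for all } f,g\in\mathcal S(\mathbb R^n).$$ -/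

import Mathlib

open MeasureTheory
open scoped ENNReal NNReal SchwartzMap

noncomputable section

/-- Euclidean space `ℝⁿ`, with its Euclidean norm, inner product and Lebesgue measure. -/
abbrev Rn (n : ℕ) : Type := EuclideanSpace ℝ (Fin n)

/-- `(ℝⁿ)²` with the Euclidean norm of `ℝ²ⁿ`. -/
abbrev Rn2 (n : ℕ) : Type := WithLp 2 (Rn n × Rn n)

/-- The phase space `(ℝⁿ)³ ∋ (x, ξ, η)`, with the product (Lebesgue) measure. -/
abbrev Phase (n : ℕ) : Type := Rn n × Rn n × Rn n

/-- The Fourier transform `f̂(ξ) = ∫ e^{-i x·ξ} f(x) dx`. -/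
def fourierHat {n : ℕ} (f : Rn n → ℂ) (ξ : Rn n) : ℂ :=
  ∫ x : Rn n, Complex.exp (-(Complex.I * ((inner ℝ x ξ : ℝ) : ℂ))) * f x

/-- The inverse Fourier transform `(2π)⁻ⁿ ∫ e^{i x·ξ} m(ξ) dξ`. -/
def fourierCheck {n : ℕ} (m : Rn n → ℂ) (x : Rn n) : ℂ :=
  (1 / (2 * (Real.pi : ℂ)) ^ n) *
    ∫ ξ : Rn n, Complex.exp (Complex.I * ((inner ℝ x ξ : ℝ) : ℂ)) * m ξ

/-- The bilinear pseudo-differential operator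
`T_σ(f,g)(x) = (2π)^{-2n} ∫∫ e^{i x·(ξ+η)} σ(x,ξ,η) f̂(ξ) ĝ(η) dξ dη`. -/
def bilinearPDO {n : ℕ} (σ : Phase n → ℂ) (f g : 𝓢(Rn n, ℂ)) (x : Rn n) : ℂ :=
  (1 / (2 * (Real.pi : ℂ)) ^ (2 * n)) *
    ∫ p : Rn n × Rn n,
      Complex.exp (Complex.I * ((inner ℝ x (p.1 + p.2) : ℝ) : ℂ)) * σ (x, p.1, p.2) *
        fourierHat f p.1 * fourierHat g p.2

/-- A bilinear operator on Schwartz functions is bounded from `L^p × L^q` to `L^r`. -/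
def BoundedLpLqLr {n : ℕ} (T : 𝓢(Rn n, ℂ) → 𝓢(Rn n, ℂ) → Rn n → ℂ) (p q r : ℝ≥0∞) : Prop :=
  ∃ C : ℝ≥0, ∀ f g : 𝓢(Rn n, ℂ),
    MemLp (T f g) r volume ∧
      eLpNorm (T f g) r volume ≤ C * eLpNorm f p volume * eLpNorm g q volume

/-- `φ` generates a Littlewood–Paley partition of unity: `φ = 1` on `|ξ| ≤ 1` and
`supp φ ⊆ {|ξ| ≤ 2}`. -/
structure IsLPGenerator {V : Type*} [NormedAddCommGroup V] [NormedSpace ℝ V]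
    (φ : 𝓢(V, ℂ)) : Prop where
  eq_one : ∀ ξ : V, ‖ξ‖ ≤ 1 → φ ξ = 1
  supp : tsupport φ ⊆ Metric.closedBall 0 2

/-- The Littlewood–Paley partition of unity generated by `φ`: `ψ₀ = φ` and
`ψ_k = ψ(· / 2^k)` for `k ≥ 1`, where `ψ = φ - φ(2 ·)`. -/
def lpPiece {V : Type*} [NormedAddCommGroup V] [NormedSpace ℝ V]
    (φ : 𝓢(V, ℂ)) (k : ℕ) (ξ : V) : ℂ :=
  if k = 0 then φ ξ
  else φ (((2 : ℝ) ^ k)⁻¹ • ξ) - φ ((2 : ℝ) • ((2 : ℝ) ^ k)⁻¹ • ξ)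

/-- `Δ_k F = ψ_{k₀}(D_x) ψ_{k₁}(D_ξ) ψ_{k₂}(D_η) F`, i.e. the convolution of `F` with the tensor
product of the inverse Fourier transforms of `ψ_{k₀}`, `ψ_{k₁}`, `ψ_{k₂}`. -/
def deltaBlock {n : ℕ} (φ : 𝓢(Rn n, ℂ)) (k : ℕ × ℕ × ℕ) (F : Phase n → ℂ) (X : Phase n) : ℂ :=
  ∫ Y : Phase n,
    fourierCheck (lpPiece φ k.1) Y.1 * fourierCheck (lpPiece φ k.2.1) Y.2.1 *
      fourierCheck (lpPiece φ k.2.2) Y.2.2 * F (X - Y)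

/-- `σ_j^ρ(x,ξ,η) = σ(2^{-jρ}x, 2^{jρ}ξ, 2^{jρ}η) Ψ_j(2^{jρ}ξ, 2^{jρ}η)`, where `Ψ_j` is the
Littlewood–Paley partition of unity of `(ℝⁿ)²` generated by `Φ`. -/
def rescaledPiece {n : ℕ} (Φ : 𝓢(Rn2 n, ℂ)) (ρ : ℝ) (j : ℕ) (σ : Phase n → ℂ)
    (X : Phase n) : ℂ :=
  σ ((2 : ℝ) ^ (-(j * ρ)) • X.1, (2 : ℝ) ^ (j * ρ) • X.2.1, (2 : ℝ) ^ (j * ρ) • X.2.2) *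
    lpPiece Φ j
      (WithLp.toLp 2 ((2 : ℝ) ^ (j * ρ) • X.2.1, (2 : ℝ) ^ (j * ρ) • X.2.2))

/-- The unit cube `[-1/2, 1/2)ⁿ`. -/
def unitCube (n : ℕ) : Set (Rn n) := {x | ∀ i, x i ∈ Set.Ico (-1 / 2 : ℝ) (1 / 2)}

/-- The integer point of `ℝⁿ` with coordinates `ν`. -/
def latticePoint {n : ℕ} (ν : Fin n → ℤ) : Rn n := WithLp.toLp 2 fun i => (ν i : ℝ)

/-- The uniformly local `L²` norm on `(ℝⁿ)³ = ℝ³ⁿ`: the supremum over `ν ∈ ℤ³ⁿ` of the `L²` norms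
of `F(· + ν)` over the unit cube of `ℝ³ⁿ`. -/
def normL2ul {n : ℕ} (F : Phase n → ℂ) : ℝ≥0∞ :=
  ⨆ ν : (Fin n → ℤ) × (Fin n → ℤ) × (Fin n → ℤ),
    (∫⁻ X in unitCube n ×ˢ unitCube n ×ˢ unitCube n,
      ‖F (X + (latticePoint ν.1, latticePoint ν.2.1, latticePoint ν.2.2))‖ₑ ^ 2) ^ (1 / 2 : ℝ)

/-- The norm of `BS^m_{ρ,ρ}(s; ℝⁿ)`, formed with the Littlewood–Paley partitions of unity generated
by `φ` on `ℝⁿ` and by `Φ` on `(ℝⁿ)²`: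
`sup_j ∑_k 2^{-jm + k·s} ‖Δ_k[σ_j^ρ]‖_{L²_ul}`. -/
def normBS {n : ℕ} (φ : 𝓢(Rn n, ℂ)) (Φ : 𝓢(Rn2 n, ℂ)) (ρ m s₀ s₁ s₂ : ℝ)
    (σ : Phase n → ℂ) : ℝ≥0∞ :=
  ⨆ j : ℕ, ∑' k : ℕ × ℕ × ℕ,
    ENNReal.ofReal ((2 : ℝ) ^ (-(j * m) + (k.1 * s₀ + k.2.1 * s₁ + k.2.2 * s₂))) *
      normL2ul (deltaBlock φ k (rescaledPiece Φ ρ j σ))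

/-- `σ ∈ BS^m_{ρ,ρ}(s; ℝⁿ)`: `σ ∈ L^∞((ℝⁿ)³)` and its norm is finite. -/
def MemBS {n : ℕ} (φ : 𝓢(Rn n, ℂ)) (Φ : 𝓢(Rn2 n, ℂ)) (ρ m s₀ s₁ s₂ : ℝ)
    (σ : Phase n → ℂ) : Prop :=
  MemLp σ ∞ volume ∧ normBS φ Φ ρ m s₀ s₁ s₂ σ < ∞

end

/-!
Write `σ_j` for the part of the symbol at the dyadic frequency `2 ^ j`. A dilation by `2 ^ (jρ)`
turns `σ_j` into `σ_j^ρ`, which is the sum of its blocks `Δ_k[σ_j^ρ]`.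

For a single block `F`, the `L¹` norm of the output over a unit cube is a trilinear form in `f̂`,
`ĝ` and a bounded test function `U` supported in that cube. Since `F` is band-limited at scales
`2 ^ k₁`, `2 ^ k₂` in the frequency variables, `f` and `g` may be localized to neighbourhoods of the
cube of these sizes; since it is band-limited at scale `2 ^ k₀` in space, only the Fourier transform
of `U` times a kernel of that scale enters. As `U` lives on a unit cube, this transform is
essentially constant at unit scale, so averaging over unit cubes of phase space and the
Cauchy–Schwarz inequality leave only the `L²_ul` norm of `F`. Summed over all cubes, the widths of
the kernel and of the localizations produce the factors `2 ^ (k_i n / 2)`. The Cauchy–Schwarz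
inequality may be weighted on the frequency side by any pair of moderate weights whose inverses have
bounded convolution.

At scale `j` at least one of the two frequencies lies in the annulus `|ξ| ∼ 2 ^ j`, the other one
only in a ball of radius `∼ 2 ^ j`. In the rescaled variables this ball has radius
`N = 2 ^ (j(1 - ρ))`. A weight that behaves like `√((1 + |ξ|) / N)` on it makes the weighted
energies over the balls summable in `j`, while the integral of its inverse over the ball, of order
`N ^ n`, costs a factor `N ^ (n / 2)`, which is what `2 ^ (jm)` cancels. The annular energies are
summable as they stand, so a last Cauchy–Schwarz inequality sums the dyadic pieces, and Fatou's
lemma passes to `σ = ∑ σ_j`.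
-/

noncomputable section

variable {n : ℕ}

section Scaling

variable {E : Type*} [NormedAddCommGroup E] [NormedSpace ℝ E] [MeasurableSpace E] [BorelSpace E]
  [FiniteDimensional ℝ E] (μ : Measure E) [μ.IsAddHaarMeasure]

lemma lintegral_comp_smul {f : E → ℝ≥0∞} (hf : Measurable f) {R : ℝ} (hR : R ≠ 0) :
    ∫⁻ x, f (R • x) ∂μ = ENNReal.ofReal |(R ^ Module.finrank ℝ E)⁻¹| * ∫⁻ x, f x ∂μ := by
  rw [← lintegral_map (f := f) (g := fun x => R • x) hf (by fun_prop),
    Measure.map_addHaar_smul μ hR, lintegral_smul_measure, smul_eq_mul]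

lemma lintegral_one_add_norm_pow_inv_lt_top {K : ℕ} (hK : Module.finrank ℝ E < K) :
    ∫⁻ x : E, ENNReal.ofReal (((1 + ‖x‖) ^ K)⁻¹) ∂μ < ∞ := by
  refine lt_of_le_of_lt (lintegral_mono fun x => ?_)
    (finite_integral_one_add_norm (μ := μ) (r := (K : ℝ)) (by exact_mod_cast hK))
  rw [Real.rpow_neg (by positivity), Real.rpow_natCast]

end Scaling

section SqrtAndCauchySchwarz

lemma rpow_half_sq (x : ℝ≥0∞) : (x ^ (1 / 2 : ℝ)) ^ 2 = x := by
  rw [← ENNReal.rpow_natCast, ← ENNReal.rpow_mul]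
  norm_num

lemma sq_rpow_half (x : ℝ≥0∞) : (x ^ 2) ^ (1 / 2 : ℝ) = x := by
  rw [← ENNReal.rpow_natCast, ← ENNReal.rpow_mul]
  norm_num

lemma lintegral_mul_le_sqrt {α : Type*} [MeasurableSpace α] {μ : Measure α} {f g : α → ℝ≥0∞}
    (hf : AEMeasurable f μ) (hg : AEMeasurable g μ) :
    ∫⁻ a, f a * g a ∂μ ≤ (∫⁻ a, f a ^ 2 ∂μ) ^ (1 / 2 : ℝ) * (∫⁻ a, g a ^ 2 ∂μ) ^ (1 / 2 : ℝ) := by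
  simpa using ENNReal.lintegral_mul_le_Lp_mul_Lq μ Real.HolderConjugate.two_two hf hg

end SqrtAndCauchySchwarz

section DyadicDilate

variable {E : Type*} [NormedAddCommGroup E] [NormedSpace ℝ E]

/-- The dilate `u(2^{-k} ·)` of a Schwartz function. -/
def dyadicDilate (k : ℕ) (u : 𝓢(E, ℂ)) : 𝓢(E, ℂ) :=
  SchwartzMap.compCLMOfContinuousLinearEquiv ℂ
    (ContinuousLinearEquiv.smulLeft (Units.mk0 (((2 : ℝ) ^ k)⁻¹) (by positivity)) : E ≃L[ℝ] E) u

lemma dyadicDilate_apply (k : ℕ) (u : 𝓢(E, ℂ)) (x : E) :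
    dyadicDilate k u x = u (((2 : ℝ) ^ k)⁻¹ • x) := rfl

lemma exists_norm_schwartz_le (u : 𝓢(E, ℂ)) (K : ℕ) :
    ∃ C : ℝ, 0 ≤ C ∧ ∀ x, ‖u x‖ ≤ C * ((1 + ‖x‖) ^ K)⁻¹ := by
  have h := fun x => SchwartzMap.one_add_le_sup_seminorm_apply (𝕜 := ℂ) (m := (K, 0)) (k := K)
    (n := 0) le_rfl le_rfl u x
  simp only [norm_iteratedFDeriv_zero] at h
  refine ⟨2 ^ K * ((Finset.Iic (K, 0)).sup fun m => SchwartzMap.seminorm ℂ m.1 m.2) u,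
    by positivity, fun x => ?_⟩
  rw [← div_eq_mul_inv, le_div_iff₀ (by positivity), mul_comm]
  exact h x

lemma lintegral_schwartz_sq_mul_pow_lt_top [MeasurableSpace E] [BorelSpace E]
    [FiniteDimensional ℝ E] (μ : Measure E) [μ.IsAddHaarMeasure] (u : 𝓢(E, ℂ)) (K : ℕ) :
    ∫⁻ s, ‖u s‖ₑ ^ 2 * ENNReal.ofReal ((1 + ‖s‖) ^ K) ∂μ < ∞ := by
  set d := Module.finrank ℝ E
  obtain ⟨C, _, hC⟩ := exists_norm_schwartz_le u (K + d + 1)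
  have hle (s : E) : ‖u s‖ₑ ^ 2 * ENNReal.ofReal ((1 + ‖s‖) ^ K) ≤
      ENNReal.ofReal (C ^ 2) * ENNReal.ofReal (((1 + ‖s‖) ^ (d + 1))⁻¹) := by
    rw [← ofReal_norm, ← ENNReal.ofReal_pow (norm_nonneg _),
      ← ENNReal.ofReal_mul (by positivity), ← ENNReal.ofReal_mul (by positivity)]
    refine ENNReal.ofReal_le_ofReal ?_
    calc ‖u s‖ ^ 2 * (1 + ‖s‖) ^ K
        ≤ (C * ((1 + ‖s‖) ^ (K + d + 1))⁻¹) ^ 2 * (1 + ‖s‖) ^ K := by gcongr; exact hC s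
      _ = C ^ 2 * (((1 + ‖s‖) ^ (d + 1))⁻¹ * ((1 + ‖s‖) ^ (K + d + 1))⁻¹) := by
          field_simp
          ring
      _ ≤ C ^ 2 * (((1 + ‖s‖) ^ (d + 1))⁻¹ * 1) := by
          gcongr
          exact inv_le_one_of_one_le₀ (one_le_pow₀ (le_add_of_nonneg_right (norm_nonneg s)))
      _ = C ^ 2 * ((1 + ‖s‖) ^ (d + 1))⁻¹ := by rw [mul_one]
  refine lt_of_le_of_lt (lintegral_mono hle) ?_
  rw [lintegral_const_mul' _ _ ENNReal.ofReal_ne_top]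
  exact ENNReal.mul_lt_top ENNReal.ofReal_lt_top
    (lintegral_one_add_norm_pow_inv_lt_top μ (Nat.lt_succ_self d))

end DyadicDilate

section SchwartzCheck

open scoped FourierTransform

/-- The inverse Fourier transform `fourierCheck u` of a Schwartz function, as a Schwartz
function. -/
def schwartzCheck (u : 𝓢(Rn n, ℂ)) : 𝓢(Rn n, ℂ) :=
  ((1 / (2 * (Real.pi : ℂ)) ^ n) : ℂ) •
    SchwartzMap.compCLMOfContinuousLinearEquiv ℂ
      (ContinuousLinearEquiv.smulLeft (Units.mk0 ((2 * Real.pi)⁻¹) (by positivity)) :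
        Rn n ≃L[ℝ] Rn n) (𝓕⁻ u)

lemma schwartzCheck_eq_fourierInv (u : 𝓢(Rn n, ℂ)) (x : Rn n) :
    schwartzCheck u x = (1 / (2 * (Real.pi : ℂ)) ^ n) * (𝓕⁻ u) ((2 * Real.pi)⁻¹ • x) := rfl

lemma schwartzCheck_eq_integral (u : 𝓢(Rn n, ℂ)) (x : Rn n) :
    schwartzCheck u x =
      (1 / (2 * (Real.pi : ℂ)) ^ n) * ∫ ξ, Circle.exp (inner ℝ x ξ) * u ξ := by
  have hpi : (Real.pi : ℂ) ≠ 0 := by exact_mod_cast Real.pi_ne_zero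
  rw [schwartzCheck_eq_fourierInv, SchwartzMap.fourierInv_coe, Real.fourierInv_eq']
  congr 1
  refine integral_congr_ae (.of_forall fun ξ => ?_)
  simp only [smul_eq_mul, inner_smul_right, Circle.coe_exp, real_inner_comm ξ x]
  push_cast
  field_simp

lemma schwartzCheck_apply (u : 𝓢(Rn n, ℂ)) (x : Rn n) : schwartzCheck u x = fourierCheck u x := by
  simp only [schwartzCheck_eq_integral, fourierCheck, Circle.coe_exp, mul_comm]

lemma integral_exp_mul_schwartzCheck (u : 𝓢(Rn n, ℂ)) (t : Rn n) :
    ∫ s, Circle.exp (-inner ℝ s t) * schwartzCheck u s = u t := by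
  have hscaled : ∫ s, Circle.exp (-inner ℝ ((2 * Real.pi) • s) t) *
      schwartzCheck u ((2 * Real.pi) • s) = (1 / (2 * (Real.pi : ℂ)) ^ n) * u t := by
    have hinv : (𝓕 (𝓕⁻ u) : 𝓢(Rn n, ℂ)) t = u t := by
      rw [FourierTransform.fourier_fourierInv_eq]
    rw [SchwartzMap.fourier_coe, Real.fourier_eq'] at hinv
    rw [← hinv, ← integral_const_mul]
    refine integral_congr_ae (.of_forall fun s => ?_)
    simp only [schwartzCheck_eq_fourierInv, smul_smul, smul_eq_mul, Circle.coe_exp,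
      inv_mul_cancel₀ Real.two_pi_pos.ne', one_smul, real_inner_smul_left, neg_mul]
    rw [mul_left_comm]
  have hcov := Measure.integral_comp_smul volume
    (fun s : Rn n => Circle.exp (-inner ℝ s t) * schwartzCheck u s) (2 * Real.pi)
  rw [hscaled, abs_of_pos (by positivity), Complex.real_smul, finrank_euclideanSpace_fin] at hcov
  have hne : (2 * (Real.pi : ℂ)) ^ n ≠ 0 :=
    pow_ne_zero _ (by exact_mod_cast Real.two_pi_pos.ne')
  rw [Complex.ofReal_inv, Complex.ofReal_pow, Complex.ofReal_mul, Complex.ofReal_ofNat,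
    one_div] at hcov
  exact (mul_left_cancel₀ (inv_ne_zero hne) hcov).symm

lemma schwartzCheck_reproducing_modulated (u v : 𝓢(Rn n, ℂ)) (q x : Rn n)
    (h : ∀ ξ, v (ξ + q) * u ξ = u ξ) :
    ∫ s, Circle.exp (-inner ℝ q s) * schwartzCheck v s * schwartzCheck u (x - s) =
      schwartzCheck u x := by
  set c : ℂ := 1 / (2 * (Real.pi : ℂ)) ^ n
  have hint : Integrable (Function.uncurry fun (s ξ : Rn n) =>
      (schwartzCheck v s * u ξ) *
        (Circle.exp (-inner ℝ q s) * Circle.exp (inner ℝ (x - s) ξ) : ℂ))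
      ((volume : Measure (Rn n)).prod volume) := by
    refine ((schwartzCheck v).integrable.mul_prod u.integrable).mul_bdd (c := 1) ?_ ?_
    · exact Continuous.aestronglyMeasurable (by fun_prop)
    · exact .of_forall fun p => by simp
  have hphase (s ξ : Rn n) : (Circle.exp (-inner ℝ q s) * Circle.exp (inner ℝ (x - s) ξ) : ℂ) =
      Circle.exp (inner ℝ x ξ) * Circle.exp (-inner ℝ s (ξ + q)) := by
    rw [← Circle.coe_mul, ← Circle.coe_mul, ← Circle.exp_add, ← Circle.exp_add, inner_sub_left,
      inner_add_right, real_inner_comm q s]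
    congr 2
    ring
  calc ∫ s, Circle.exp (-inner ℝ q s) * schwartzCheck v s * schwartzCheck u (x - s)
      = ∫ s, c * ∫ ξ, (schwartzCheck v s * u ξ) *
          (Circle.exp (-inner ℝ q s) * Circle.exp (inner ℝ (x - s) ξ)) := by
        refine integral_congr_ae (.of_forall fun s => ?_)
        simp only [schwartzCheck_eq_integral u]
        rw [← mul_assoc, mul_comm _ c, mul_assoc, ← integral_const_mul]
        congr 1
        exact integral_congr_ae (.of_forall fun ξ => by ring)
    _ = c * ∫ ξ, ∫ s, (schwartzCheck v s * u ξ) *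
          (Circle.exp (-inner ℝ q s) * Circle.exp (inner ℝ (x - s) ξ)) := by
        rw [integral_const_mul, integral_integral_swap hint]
    _ = c * ∫ ξ, Circle.exp (inner ℝ x ξ) * (v (ξ + q) * u ξ) := by
        congr 1
        refine integral_congr_ae (.of_forall fun ξ => ?_)
        simp only [hphase]
        rw [← integral_exp_mul_schwartzCheck v, mul_comm (∫ s, _), ← mul_assoc,
          ← integral_const_mul]
        exact integral_congr_ae (.of_forall fun s => by ring)
    _ = schwartzCheck u x := by simp only [h, schwartzCheck_eq_integral, c]

lemma schwartzCheck_reproducing (u v : 𝓢(Rn n, ℂ)) (x : Rn n) (h : ∀ ξ, v ξ * u ξ = u ξ) :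
    ∫ s, schwartzCheck v s * schwartzCheck u (x - s) = schwartzCheck u x := by
  simpa using schwartzCheck_reproducing_modulated u v 0 x (by simpa using h)

lemma schwartzCheck_dyadicDilate (k : ℕ) (u : 𝓢(Rn n, ℂ)) (x : Rn n) :
    schwartzCheck (dyadicDilate k u) x =
      ((2 : ℂ) ^ k) ^ n * schwartzCheck u ((2 : ℝ) ^ k • x) := by
  have hcov := Measure.integral_comp_smul volume
    (fun ξ => Circle.exp (inner ℝ x ((2 : ℝ) ^ k • ξ)) * u ξ) ((2 : ℝ) ^ k)⁻¹
  rw [abs_of_pos (by positivity), finrank_euclideanSpace_fin] at hcov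
  simp only [smul_inv_smul₀ (pow_ne_zero k (two_ne_zero (α := ℝ)))] at hcov
  simp only [schwartzCheck_eq_integral, dyadicDilate_apply, hcov, real_inner_smul_left,
    real_inner_smul_right, Complex.real_smul]
  push_cast
  rw [inv_pow, inv_inv]
  ring

lemma lintegral_schwartzCheck_dyadicDilate_sq_mul_pow_le (u : 𝓢(Rn n, ℂ)) (k K : ℕ) :
    ∫⁻ s, ‖schwartzCheck (dyadicDilate k u) s‖ₑ ^ 2 * ENNReal.ofReal ((1 + ‖s‖) ^ K) ≤
      ENNReal.ofReal (((2 : ℝ) ^ k) ^ n) *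
        ∫⁻ s, ‖schwartzCheck u s‖ₑ ^ 2 * ENNReal.ofReal ((1 + ‖s‖) ^ K) := by
  set g : Rn n → ℝ≥0∞ := fun s => ‖schwartzCheck u s‖ₑ ^ 2 * ENNReal.ofReal ((1 + ‖s‖) ^ K)
  have hg : Measurable g := by
    have := (schwartzCheck u).continuous.measurable
    fun_prop
  have hpos : (0 : ℝ) < (2 : ℝ) ^ k := by positivity
  have hle (s : Rn n) :
      ‖schwartzCheck (dyadicDilate k u) s‖ₑ ^ 2 * ENNReal.ofReal ((1 + ‖s‖) ^ K) ≤
        ENNReal.ofReal ((((2 : ℝ) ^ k) ^ n) ^ 2) * g ((2 : ℝ) ^ k • s) := by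
    have hfactor : ‖((2 : ℂ) ^ k) ^ n‖ₑ = ENNReal.ofReal (((2 : ℝ) ^ k) ^ n) := by
      rw [← ofReal_norm, norm_pow, norm_pow, Complex.norm_ofNat]
    rw [schwartzCheck_dyadicDilate, enorm_mul, mul_pow, hfactor,
      ← ENNReal.ofReal_pow (by positivity), mul_assoc]
    change _ ≤ _ * (_ * ENNReal.ofReal ((1 + ‖(2 : ℝ) ^ k • s‖) ^ K))
    gcongr
    rw [norm_smul, Real.norm_of_nonneg hpos.le]
    exact le_mul_of_one_le_left (norm_nonneg _) (one_le_pow₀ one_le_two)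
  refine (lintegral_mono hle).trans (le_of_eq ?_)
  rw [lintegral_const_mul' _ _ ENNReal.ofReal_ne_top, lintegral_comp_smul volume hg hpos.ne',
    finrank_euclideanSpace_fin, ← mul_assoc, ← ENNReal.ofReal_mul (by positivity),
    abs_of_pos (by positivity)]
  congr 2
  field_simp

end SchwartzCheck

section Plancherel

open scoped FourierTransform

variable {E : Type*} [NormedAddCommGroup E] [InnerProductSpace ℝ E] [FiniteDimensional ℝ E]
  [MeasurableSpace E] [BorelSpace E] {u : E → ℂ}

lemma fourier_ae_eq_fourier_toLp (hu : Integrable u) (hu2 : MemLp u 2) :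
    𝓕 u =ᵐ[volume] (𝓕 (hu2.toLp u) : Lp ℂ 2 (volume : Measure E)) := by
  set U := hu2.toLp u
  have hcont : Continuous (𝓕 u) :=
    VectorFourier.fourierIntegral_continuous Real.continuous_fourierChar
      (innerSL ℝ).continuous₂ hu
  refine ae_eq_of_integral_contDiff_smul_eq hcont.locallyIntegrable
    ((Lp.memLp _).locallyIntegrable (by norm_num)) fun g hg hgc => ?_
  have hgc' : HasCompactSupport (fun x => (g x : ℂ)) :=
    hgc.comp_left (g := Complex.ofReal) Complex.ofReal_zero
  set G : 𝓢(E, ℂ) := hgc'.toSchwartzMap (Complex.ofRealCLM.contDiff.comp hg)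
  have hG (x : E) (z : ℂ) : g x • z = G x • z := (Complex.real_smul (x := g x)).trans rfl
  have hdual := congrArg (fun T => T G) (Lp.fourier_toTemperedDistribution_eq U)
  simp only [TemperedDistribution.fourier_apply, Lp.toTemperedDistribution_apply] at hdual
  have hflip := VectorFourier.integral_fourierIntegral_smul_eq_flip (L := innerₗ E)
    (f := (G : E → ℂ)) (g := u) (μ := volume) (ν := volume) Real.continuous_fourierChar
    (innerSL ℝ).continuous₂ G.integrable hu
  rw [flip_innerₗ] at hflip
  calc ∫ x, g x • 𝓕 u x = ∫ x, (𝓕 G) x • u x := by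
        simp only [hG, SchwartzMap.fourier_coe]
        exact hflip.symm
    _ = ∫ x, (𝓕 G) x • U x := by
        refine integral_congr_ae ?_
        filter_upwards [hu2.coeFn_toLp] with x hx
        rw [hx]
    _ = ∫ x, g x • (𝓕 U : Lp ℂ 2 (volume : Measure E)) x := by simp only [hG, hdual]

lemma eLpNorm_two_eq_lintegral_rpow_half {α : Type*} [MeasurableSpace α] {μ : Measure α}
    (f : α → ℂ) : eLpNorm f 2 μ = (∫⁻ x, ‖f x‖ₑ ^ 2 ∂μ) ^ (1 / 2 : ℝ) := by
  simp [eLpNorm_eq_lintegral_rpow_enorm_toReal]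

lemma lintegral_enorm_fourier_sq (hu : Integrable u) (hu2 : MemLp u 2) :
    ∫⁻ ξ, ‖𝓕 u ξ‖ₑ ^ 2 = ∫⁻ x, ‖u x‖ₑ ^ 2 := by
  have hnorm : eLpNorm (𝓕 u) 2 = eLpNorm u 2 := by
    rw [eLpNorm_congr_ae (fourier_ae_eq_fourier_toLp hu hu2), ← eLpNorm_congr_ae hu2.coeFn_toLp]
    have := Lp.norm_fourier_eq (hu2.toLp u)
    simp only [Lp.norm_def] at this
    exact (ENNReal.toReal_eq_toReal_iff' (Lp.eLpNorm_ne_top _) (Lp.eLpNorm_ne_top _)).1 this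
  rw [eLpNorm_two_eq_lintegral_rpow_half, eLpNorm_two_eq_lintegral_rpow_half] at hnorm
  exact ENNReal.rpow_left_injective (by norm_num) hnorm

/-- The oscillatory integral `∫ e^{i x·ζ} u(x) dx`, i.e. the Fourier transform of `u` without
normalization and with the positive sign in the phase. -/
def oscIntegral (u : E → ℂ) (ζ : E) : ℂ := ∫ x, Circle.exp (inner ℝ x ζ) * u x

lemma continuous_oscIntegral (hu : Integrable u) : Continuous (oscIntegral u) := by
  refine continuous_of_dominated (bound := fun s => ‖u s‖) (fun p => ?_) (fun p => ?_) hu.norm ?_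
  · exact (Continuous.aestronglyMeasurable (by fun_prop)).mul hu.aestronglyMeasurable
  · exact .of_forall fun s => by simp
  · exact .of_forall fun s => by fun_prop

lemma lintegral_enorm_oscIntegral_sq (hu : Integrable u) (hu2 : MemLp u 2) :
    ∫⁻ ζ, ‖oscIntegral u ζ‖ₑ ^ 2 =
      ENNReal.ofReal ((2 * Real.pi) ^ Module.finrank ℝ E) * ∫⁻ x, ‖u x‖ₑ ^ 2 := by
  rw [← lintegral_enorm_fourier_sq hu hu2]
  have hg : Measurable fun ζ => ‖oscIntegral u ζ‖ₑ ^ 2 := by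
    have := (continuous_oscIntegral hu).measurable
    fun_prop
  have hscale (ξ : E) : ‖oscIntegral u ((-(2 * Real.pi)) • ξ)‖ₑ ^ 2 = ‖𝓕 u ξ‖ₑ ^ 2 := by
    simp only [oscIntegral, Real.fourier_eq', Circle.coe_exp, smul_eq_mul, real_inner_smul_right,
      neg_mul]
  have hcov := lintegral_comp_smul volume hg (neg_ne_zero.2 Real.two_pi_pos.ne')
  simp only [hscale] at hcov
  rw [hcov, ← mul_assoc, ← ENNReal.ofReal_mul (by positivity), abs_inv, abs_pow, abs_neg,
    abs_of_pos (by positivity), mul_inv_cancel₀ (by positivity), ENNReal.ofReal_one, one_mul]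

end Plancherel

section UnitCube

lemma measurableSet_unitCube : MeasurableSet (unitCube n) := by
  simp only [unitCube, Set.ofPred_forall]
  exact .iInter fun i => measurableSet_Ico.preimage (f := fun x : Rn n => x i) (by fun_prop)

lemma volume_unitCube : volume (unitCube n) = 1 := by
  have hpre : unitCube n = (MeasurableEquiv.toLp 2 (Fin n → ℝ)).symm ⁻¹'
      (Set.univ.pi fun _ => Set.Ico (-1 / 2 : ℝ) (1 / 2)) := by
    ext x
    simp [unitCube]
  rw [hpre, (EuclideanSpace.volume_preserving_symm_measurableEquiv_toLp (Fin n)).measure_preimage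
    (MeasurableSet.univ_pi fun _ => measurableSet_Ico).nullMeasurableSet, Real.volume_pi_Ico]
  norm_num

lemma norm_le_of_mem_unitCube {x : Rn n} (hx : x ∈ unitCube n) : ‖x‖ ≤ n := by
  have hsq : ‖x‖ ^ 2 ≤ (n : ℝ) ^ 2 := by
    rw [EuclideanSpace.norm_sq_eq]
    calc ∑ i, ‖x i‖ ^ 2 ≤ ∑ _i : Fin n, (1 : ℝ) := by
          refine Finset.sum_le_sum fun i _ => ?_
          rw [Real.norm_eq_abs, sq_abs]
          nlinarith [(hx i).1, (hx i).2]
      _ = n := by simp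
      _ ≤ (n : ℝ) ^ 2 := by exact_mod_cast Nat.le_self_pow two_ne_zero n
  exact abs_le_of_sq_le_sq' hsq (Nat.cast_nonneg n) |>.2

/-- The unit cube of the phase space. -/
abbrev phaseCube (n : ℕ) : Set (Phase n) := unitCube n ×ˢ unitCube n ×ˢ unitCube n

instance isAddHaarMeasure_volume_Rn_prod : (volume : Measure (Rn n × Rn n)).IsAddHaarMeasure :=
  inferInstanceAs (((volume : Measure (Rn n)).prod (volume : Measure (Rn n))).IsAddHaarMeasure)

instance isAddHaarMeasure_volume_phase : (volume : Measure (Phase n)).IsAddHaarMeasure :=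
  Measure.prod.instIsAddHaarMeasure (volume : Measure (Rn n))
    ((volume : Measure (Rn n)).prod (volume : Measure (Rn n)))

end UnitCube

section Weights

/-- A measurable weight with values in `(0, ∞)`. -/
structure IsWeight {α : Type*} [MeasurableSpace α] (w : α → ℝ≥0∞) : Prop where
  measurable : Measurable w
  ne_zero : ∀ x, w x ≠ 0
  ne_top : ∀ x, w x ≠ ∞

lemma lintegral_sqrt_le_of_isWeight {α : Type*} [MeasurableSpace α] {μ : Measure α}
    {f w : α → ℝ≥0∞} (hf : Measurable f) (hw : IsWeight w) :
    ∫⁻ x, f x ^ (1 / 2 : ℝ) ∂μ ≤ ((∫⁻ x, (w x)⁻¹ ∂μ) * ∫⁻ x, f x * w x ∂μ) ^ (1 / 2 : ℝ) := by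
  have hwm := hw.measurable
  calc ∫⁻ x, f x ^ (1 / 2 : ℝ) ∂μ
      = ∫⁻ x, ((w x)⁻¹) ^ (1 / 2 : ℝ) * (f x * w x) ^ (1 / 2 : ℝ) ∂μ := by
        refine lintegral_congr fun x => ?_
        rw [← ENNReal.mul_rpow_of_nonneg _ _ (by norm_num : (0 : ℝ) ≤ 1 / 2), mul_left_comm,
          ENNReal.inv_mul_cancel (hw.ne_zero x) (hw.ne_top x), mul_one]
    _ ≤ (∫⁻ x, (w x)⁻¹ ∂μ) ^ (1 / 2 : ℝ) * (∫⁻ x, f x * w x ∂μ) ^ (1 / 2 : ℝ) := by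
        refine (lintegral_mul_le_sqrt (by fun_prop) (by fun_prop)).trans_eq ?_
        simp only [rpow_half_sq]
    _ = _ := (ENNReal.mul_rpow_of_nonneg _ _ (by norm_num)).symm

end Weights

section TrilinearEstimate

variable {G : Type*} [AddCommGroup G] [MeasurableSpace G] [MeasurableAdd₂ G] {μ : Measure G}
  [SFinite μ]

lemma measurable_setLIntegral_translate {Q : Set G} {H : Type*} [MeasurableSpace H]
    {f : G → H → ℝ≥0∞} (hf : Measurable (Function.uncurry f)) :
    Measurable fun p : G × H => ∫⁻ x in Q, f (p.1 + x) p.2 ∂μ :=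
  Measurable.lintegral_prod_right' (f := fun q : (G × H) × G => f (q.1.1 + q.2) q.1.2)
    (hf.comp (f := fun q : (G × H) × G => (q.1.1 + q.2, q.1.2)) (by fun_prop))

instance measurableAdd₂_prod {H : Type*} [Add H] [MeasurableSpace H] [MeasurableAdd₂ H] :
    MeasurableAdd₂ (G × H) where
  measurable_add := by
    change Measurable fun p : (G × H) × G × H => (p.1.1 + p.2.1, p.1.2 + p.2.2)
    fun_prop

variable {Q : Set G} {g Γ : G → G → ℝ≥0∞} {a b : G → ℝ≥0∞}

lemma setLIntegral_prod_translate_sq_le (hQ : MeasurableSet Q)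
    (hΓ : Measurable (Function.uncurry Γ)) (ha : Measurable a) (hb : Measurable b)
    (hgΓ : ∀ y ζ, ∀ x₁ ∈ Q, ∀ x₂ ∈ Q, g y (ζ + (x₁ + x₂)) ^ 2 ≤ Γ y ζ) (Z : G × G × G) :
    ∫⁻ Y in Q ×ˢ Q ×ˢ Q, (g (Z + Y).1 ((Z + Y).2.1 + (Z + Y).2.2) *
        (a (Z + Y).2.1 * b (Z + Y).2.2)) ^ 2 ∂μ.prod (μ.prod μ) ≤
      (∫⁻ y in Q, Γ (Z.1 + y) (Z.2.1 + Z.2.2) ∂μ) *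
        ((∫⁻ x in Q, a (Z.2.1 + x) ^ 2 ∂μ) * ∫⁻ x in Q, b (Z.2.2 + x) ^ 2 ∂μ) := by
  have hΓZ : Measurable fun y => Γ (Z.1 + y) (Z.2.1 + Z.2.2) :=
    hΓ.comp (f := fun y => (Z.1 + y, Z.2.1 + Z.2.2)) (by fun_prop)
  calc _ ≤ ∫⁻ Y in Q ×ˢ Q ×ˢ Q, Γ (Z.1 + Y.1) (Z.2.1 + Z.2.2) *
          (a (Z.2.1 + Y.2.1) ^ 2 * b (Z.2.2 + Y.2.2) ^ 2) ∂μ.prod (μ.prod μ) := by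
        refine setLIntegral_mono' (hQ.prod (hQ.prod hQ)) fun Y hY => ?_
        rw [mul_pow, mul_pow]
        refine mul_le_mul_left ?_ _
        simpa only [Prod.fst_add, Prod.snd_add, add_add_add_comm] using
          hgΓ (Z.1 + Y.1) (Z.2.1 + Z.2.2) Y.2.1 hY.2.1 Y.2.2 hY.2.2
    _ = _ := by
        rw [← Measure.prod_restrict, ← Measure.prod_restrict,
          lintegral_prod_mul (f := fun y => Γ (Z.1 + y) (Z.2.1 + Z.2.2))
            (g := fun y : G × G => a (Z.2.1 + y.1) ^ 2 * b (Z.2.2 + y.2) ^ 2)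
            hΓZ.aemeasurable (by fun_prop),
          lintegral_prod_mul (f := fun y => a (Z.2.1 + y) ^ 2) (g := fun y => b (Z.2.2 + y) ^ 2)
            (by fun_prop) (by fun_prop)]

variable [μ.IsAddLeftInvariant]

lemma lintegral_eq_lintegral_lintegral_translate (hQ : μ Q = 1) {f : G → ℝ≥0∞}
    (hf : Measurable f) : ∫⁻ x, f x ∂μ = ∫⁻ p, ∫⁻ x in Q, f (p + x) ∂μ ∂μ := by
  rw [lintegral_lintegral_swap (by fun_prop)]
  simp only [add_comm _ (_ : G), lintegral_add_left_eq_self]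
  rw [setLIntegral_const, hQ, mul_one]

lemma lintegral_mul_le_lintegral_sqrt_translate (hQ : μ Q = 1) {f g : G → ℝ≥0∞}
    (hf : Measurable f) (hg : Measurable g) {M : ℝ≥0∞}
    (hM : ∀ p, ∫⁻ x in Q, f (p + x) ^ 2 ∂μ ≤ M ^ 2) :
    ∫⁻ x, f x * g x ∂μ ≤ ∫⁻ p, M * (∫⁻ x in Q, g (p + x) ^ 2 ∂μ) ^ (1 / 2 : ℝ) ∂μ := by
  rw [lintegral_eq_lintegral_lintegral_translate hQ (f := fun x => f x * g x) (by fun_prop)]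
  refine lintegral_mono fun p => (lintegral_mul_le_sqrt (by fun_prop) (by fun_prop)).trans ?_
  gcongr
  rw [← sq_rpow_half M]
  exact ENNReal.rpow_le_rpow (hM p) (by norm_num)

lemma lintegral_sqrt_mul_comp_add_le [MeasurableNeg G] {α β γ w v : G → ℝ≥0∞} (hα : Measurable α)
    (hβ : Measurable β) (hγ : Measurable γ) (hw : IsWeight w) (hv : IsWeight v)
    {D : ℝ≥0∞} (hD : ∀ τ, ∫⁻ x, (w x)⁻¹ * (v (τ - x))⁻¹ ∂μ ≤ D) :
    ∫⁻ p : G × G, (γ (p.1 + p.2) * (α p.1 * β p.2)) ^ (1 / 2 : ℝ) ∂μ.prod μ ≤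
      ((∫⁻ x, w x * α x ∂μ) * ∫⁻ x, v x * β x ∂μ) ^ (1 / 2 : ℝ) *
        (D * ∫⁻ τ, γ τ ∂μ) ^ (1 / 2 : ℝ) := by
  have hwm := hw.measurable
  have hvm := hv.measurable
  have hsplit (p : G × G) : (γ (p.1 + p.2) * (α p.1 * β p.2)) ^ (1 / 2 : ℝ) =
      ((w p.1 * α p.1) * (v p.2 * β p.2)) ^ (1 / 2 : ℝ) *
        (γ (p.1 + p.2) * ((w p.1)⁻¹ * (v p.2)⁻¹)) ^ (1 / 2 : ℝ) := by
    rw [← ENNReal.mul_rpow_of_nonneg _ _ (by norm_num : (0 : ℝ) ≤ 1 / 2)]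
    congr 1
    calc γ (p.1 + p.2) * (α p.1 * β p.2)
        = (w p.1 * (w p.1)⁻¹) * (v p.2 * (v p.2)⁻¹) * (γ (p.1 + p.2) * (α p.1 * β p.2)) := by
          rw [ENNReal.mul_inv_cancel (hw.ne_zero _) (hw.ne_top _),
            ENNReal.mul_inv_cancel (hv.ne_zero _) (hv.ne_top _), one_mul, one_mul]
      _ = _ := by ring
  have hconv : ∫⁻ p : G × G, γ (p.1 + p.2) * ((w p.1)⁻¹ * (v p.2)⁻¹) ∂μ.prod μ ≤
      D * ∫⁻ τ, γ τ ∂μ := by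
    rw [lintegral_prod _ (by fun_prop)]
    calc ∫⁻ x, ∫⁻ y, γ (x + y) * ((w x)⁻¹ * (v y)⁻¹) ∂μ ∂μ
        = ∫⁻ x, ∫⁻ τ, γ τ * ((w x)⁻¹ * (v (τ - x))⁻¹) ∂μ ∂μ := by
          refine lintegral_congr fun x => ?_
          rw [← lintegral_add_left_eq_self (fun τ => γ τ * ((w x)⁻¹ * (v (τ - x))⁻¹)) x]
          simp only [add_sub_cancel_left]
      _ = ∫⁻ τ, ∫⁻ x, γ τ * ((w x)⁻¹ * (v (τ - x))⁻¹) ∂μ ∂μ :=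
          lintegral_lintegral_swap (by fun_prop)
      _ = ∫⁻ τ, γ τ * ∫⁻ x, (w x)⁻¹ * (v (τ - x))⁻¹ ∂μ ∂μ :=
          lintegral_congr fun τ => lintegral_const_mul _ (by fun_prop)
      _ ≤ ∫⁻ τ, γ τ * D ∂μ := by
          gcongr with τ
          exact hD τ
      _ = D * ∫⁻ τ, γ τ ∂μ := by rw [lintegral_mul_const _ hγ, mul_comm]
  simp only [hsplit]
  refine (lintegral_mul_le_sqrt (by fun_prop) (by fun_prop)).trans ?_
  simp only [rpow_half_sq]
  rw [lintegral_prod_mul (f := fun x => w x * α x) (g := fun x => v x * β x) (by fun_prop)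
    (by fun_prop)]
  gcongr

lemma lintegral_trilinear_le [MeasurableNeg G] (hQm : MeasurableSet Q) (hQ : μ Q = 1)
    {F : G × G × G → ℝ≥0∞} {w v : G → ℝ≥0∞} (hF : Measurable F)
    (hg : Measurable (Function.uncurry g)) (hΓ : Measurable (Function.uncurry Γ))
    (ha : Measurable a) (hb : Measurable b) (hw : IsWeight w) (hv : IsWeight v)
    {D M : ℝ≥0∞} (hD : ∀ τ, ∫⁻ x, (w x)⁻¹ * (v (τ - x))⁻¹ ∂μ ≤ D)
    (hM : ∀ Z, ∫⁻ Y in Q ×ˢ Q ×ˢ Q, F (Z + Y) ^ 2 ∂μ.prod (μ.prod μ) ≤ M ^ 2)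
    (hgΓ : ∀ y ζ, ∀ x₁ ∈ Q, ∀ x₂ ∈ Q, g y (ζ + (x₁ + x₂)) ^ 2 ≤ Γ y ζ) :
    ∫⁻ X, F X * (g X.1 (X.2.1 + X.2.2) * (a X.2.1 * b X.2.2)) ∂μ.prod (μ.prod μ) ≤
      M * (((∫⁻ ξ, w ξ * ∫⁻ x in Q, a (ξ + x) ^ 2 ∂μ ∂μ) *
        ∫⁻ η, v η * ∫⁻ x in Q, b (η + x) ^ 2 ∂μ ∂μ) ^ (1 / 2 : ℝ) * D ^ (1 / 2 : ℝ)) *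
        ∫⁻ z, (∫⁻ y in Q, ∫⁻ τ, Γ (z + y) τ ∂μ ∂μ) ^ (1 / 2 : ℝ) ∂μ := by
  set α : G → ℝ≥0∞ := fun ξ => ∫⁻ x in Q, a (ξ + x) ^ 2 ∂μ
  set β : G → ℝ≥0∞ := fun η => ∫⁻ x in Q, b (η + x) ^ 2 ∂μ
  set T : G → G → ℝ≥0∞ := fun z τ => ∫⁻ y in Q, Γ (z + y) τ ∂μ
  have hα : Measurable α :=
    Measurable.lintegral_prod_right' (f := fun p : G × G => a (p.1 + p.2) ^ 2) (by fun_prop)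
  have hβ : Measurable β :=
    Measurable.lintegral_prod_right' (f := fun p : G × G => b (p.1 + p.2) ^ 2) (by fun_prop)
  have hT : Measurable (Function.uncurry T) := measurable_setLIntegral_translate hΓ
  have : Measurable fun Z : G × G × G => T Z.1 (Z.2.1 + Z.2.2) :=
    hT.comp (f := fun Z : G × G × G => (Z.1, Z.2.1 + Z.2.2)) (by fun_prop)
  have : Measurable fun X : G × G × G => g X.1 (X.2.1 + X.2.2) :=
    hg.comp (f := fun X : G × G × G => (X.1, X.2.1 + X.2.2)) (by fun_prop)
  have : Measurable fun z => ∫⁻ τ, T z τ ∂μ := Measurable.lintegral_prod_right' hT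
  have hTswap (z : G) : ∫⁻ τ, T z τ ∂μ = ∫⁻ y in Q, ∫⁻ τ, Γ (z + y) τ ∂μ ∂μ :=
    lintegral_lintegral_swap (Measurable.aemeasurable
      (hΓ.comp (f := fun p : G × G => (z + p.2, p.1)) (by fun_prop)))
  have hQ3 : (μ.prod (μ.prod μ)) (Q ×ˢ Q ×ˢ Q) = 1 := by
    rw [Measure.prod_prod, Measure.prod_prod, hQ, one_mul, one_mul]
  calc _ ≤ ∫⁻ Z, M * (T Z.1 (Z.2.1 + Z.2.2) * (α Z.2.1 * β Z.2.2)) ^ (1 / 2 : ℝ)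
          ∂μ.prod (μ.prod μ) := by
        refine (lintegral_mul_le_lintegral_sqrt_translate hQ3 hF (by fun_prop) hM).trans ?_
        gcongr with Z
        exact setLIntegral_prod_translate_sq_le hQm hΓ ha hb hgΓ Z
    _ = M * ∫⁻ z, ∫⁻ p : G × G, (T z (p.1 + p.2) * (α p.1 * β p.2)) ^ (1 / 2 : ℝ)
          ∂μ.prod μ ∂μ := by
        rw [lintegral_const_mul _ (by fun_prop), lintegral_prod _ (by fun_prop)]
    _ ≤ M * ∫⁻ z, ((∫⁻ ξ, w ξ * α ξ ∂μ) * ∫⁻ η, v η * β η ∂μ) ^ (1 / 2 : ℝ) *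
          (D * ∫⁻ τ, T z τ ∂μ) ^ (1 / 2 : ℝ) ∂μ := by
        gcongr with z
        exact lintegral_sqrt_mul_comp_add_le hα hβ (hT.comp measurable_prodMk_left) hw hv hD
    _ = _ := by
        simp only [ENNReal.mul_rpow_of_nonneg _ _ (by norm_num : (0 : ℝ) ≤ 1 / 2), ← mul_assoc]
        rw [lintegral_const_mul _ (by fun_prop)]
        simp only [hTswap]
        ring

end TrilinearEstimate

section LocalAverages

variable {E : Type*} [NormedAddCommGroup E] [MeasurableSpace E] [BorelSpace E]

lemma isWeight_one_add_norm_pow (K : ℕ) :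
    IsWeight fun x : E => ENNReal.ofReal ((1 + ‖x‖) ^ K) where
  measurable := by fun_prop
  ne_zero x := by
    have : 0 < (1 + ‖x‖) ^ K := by positivity
    simpa only [ne_eq, ENNReal.ofReal_eq_zero, not_le] using this
  ne_top _ := ENNReal.ofReal_ne_top

variable {μ : Measure E} [μ.IsAddLeftInvariant] [μ.IsNegInvariant]
  {Q : Set E} {r : ℝ} {g : E → ℝ≥0∞}

lemma lintegral_translate_mul_one_add_norm_pow_le (hg : Measurable g) (p : E) {x y : E}
    (hx : ‖x‖ ≤ r) (hy : ‖y‖ ≤ r) (K : ℕ) :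
    ∫⁻ z, g (p + x - (z + y)) * ENNReal.ofReal ((1 + ‖z - p‖) ^ K) ∂μ ≤
      ENNReal.ofReal ((1 + 2 * r) ^ K) * ∫⁻ u, g u * ENNReal.ofReal ((1 + ‖u‖) ^ K) ∂μ := by
  have hr : 0 ≤ r := (norm_nonneg x).trans hx
  rw [← lintegral_const_mul _ (by fun_prop), ← lintegral_sub_left_eq_self _ (p + x - y)]
  refine lintegral_mono fun z => ?_
  have harg : p + x - (p + x - y - z + y) = z := by abel
  have hweight : p + x - y - z - p = x - y - z := by abel
  have hnorm : ‖x - y - z‖ ≤ ‖x‖ + ‖y‖ + ‖z‖ :=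
    (norm_sub_le _ _).trans (add_le_add (norm_sub_le _ _) le_rfl)
  rw [harg, hweight, mul_left_comm, ← ENNReal.ofReal_mul (by positivity), ← mul_pow]
  gcongr
  nlinarith [norm_nonneg z]

lemma lintegral_sqrt_setLIntegral_translate_le [SecondCountableTopology E] [SFinite μ]
    (hQm : MeasurableSet Q) (hQ : μ Q = 1) (hQr : ∀ x ∈ Q, ‖x‖ ≤ r) (hg : Measurable g) (p : E)
    (K : ℕ) :
    ∫⁻ z, (∫⁻ y in Q, ∫⁻ x in Q, g (p + x - (z + y)) ∂μ ∂μ) ^ (1 / 2 : ℝ) ∂μ ≤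
      ((∫⁻ x, ENNReal.ofReal (((1 + ‖x‖) ^ K)⁻¹) ∂μ) *
        (ENNReal.ofReal ((1 + 2 * r) ^ K) *
          ∫⁻ u, g u * ENNReal.ofReal ((1 + ‖u‖) ^ K) ∂μ)) ^ (1 / 2 : ℝ) := by
  set W : E → ℝ≥0∞ := fun x => ENNReal.ofReal ((1 + ‖x‖) ^ K)
  have hW : IsWeight W := isWeight_one_add_norm_pow K
  have hWm := hW.measurable
  have hWp : IsWeight fun z => W (z - p) :=
    ⟨hWm.comp (by fun_prop), fun _ => hW.ne_zero _, fun _ => hW.ne_top _⟩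
  have hWinv (x : E) : (W x)⁻¹ = ENNReal.ofReal (((1 + ‖x‖) ^ K)⁻¹) :=
    (ENNReal.ofReal_inv_of_pos (by positivity)).symm
  have hinner : Measurable fun q : E × E => ∫⁻ x in Q, g (p + x - (q.1 + q.2)) ∂μ :=
    Measurable.lintegral_prod_right' (f := fun s : (E × E) × E =>
      g (p + s.2 - (s.1.1 + s.1.2))) (by fun_prop)
  have hinnerW : Measurable fun q : E × E =>
      ∫⁻ x in Q, g (p + x - (q.1 + q.2)) * W (q.1 - p) ∂μ :=
    Measurable.lintegral_prod_right' (f := fun s : (E × E) × E =>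
      g (p + s.2 - (s.1.1 + s.1.2)) * W (s.1.1 - p)) (by fun_prop)
  refine (lintegral_sqrt_le_of_isWeight hinner.lintegral_prod_right' hWp).trans ?_
  rw [lintegral_sub_right_eq_self (fun z => (W z)⁻¹) p]
  simp only [hWinv]
  gcongr
  calc ∫⁻ z, (∫⁻ y in Q, ∫⁻ x in Q, g (p + x - (z + y)) ∂μ ∂μ) * W (z - p) ∂μ
      = ∫⁻ z, ∫⁻ y in Q, ∫⁻ x in Q, g (p + x - (z + y)) * W (z - p) ∂μ ∂μ ∂μ := by
        refine lintegral_congr fun z => ?_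
        have hz : Measurable fun y => ∫⁻ x in Q, g (p + x - (z + y)) ∂μ :=
          hinner.comp measurable_prodMk_left
        rw [← lintegral_mul_const _ hz]
        exact lintegral_congr fun y => (lintegral_mul_const _ (by fun_prop)).symm
    _ = ∫⁻ y in Q, ∫⁻ z, ∫⁻ x in Q, g (p + x - (z + y)) * W (z - p) ∂μ ∂μ ∂μ :=
        lintegral_lintegral_swap hinnerW.aemeasurable
    _ = ∫⁻ y in Q, ∫⁻ x in Q, ∫⁻ z, g (p + x - (z + y)) * W (z - p) ∂μ ∂μ ∂μ :=
        lintegral_congr fun y => lintegral_lintegral_swap (by fun_prop)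
    _ ≤ ∫⁻ _ in Q, ∫⁻ _ in Q, ENNReal.ofReal ((1 + 2 * r) ^ K) * ∫⁻ u, g u * W u ∂μ ∂μ ∂μ :=
        setLIntegral_mono' hQm fun _ hy => setLIntegral_mono' hQm fun _ hx =>
          lintegral_translate_mul_one_add_norm_pow_le hg p (hQr _ hx) (hQr _ hy) K
    _ = ENNReal.ofReal ((1 + 2 * r) ^ K) * ∫⁻ u, g u * W u ∂μ := by
        simp only [setLIntegral_const, hQ, mul_one]

end LocalAverages

section BoundedFunctions

variable {α β : Type*} [MeasurableSpace α] [MeasurableSpace β] {f : α → ℂ}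

/-- A bounded measurable function; the bound holds everywhere, not just almost everywhere. -/
structure IsBoundedMeasurable (f : α → ℂ) : Prop where
  measurable : Measurable f
  exists_bound : ∃ A : ℝ, ∀ x, ‖f x‖ ≤ A

lemma IsBoundedMeasurable.comp (hf : IsBoundedMeasurable f) {g : β → α} (hg : Measurable g) :
    IsBoundedMeasurable fun x => f (g x) where
  measurable := hf.measurable.comp hg
  exists_bound := hf.exists_bound.imp fun _ hA x => hA (g x)

lemma IsBoundedMeasurable.integrable_mul (hf : IsBoundedMeasurable f) {μ : Measure α}
    {g : α → ℂ} (hg : Integrable g μ) : Integrable (fun x => f x * g x) μ :=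
  have ⟨_, hA⟩ := hf.exists_bound
  hg.bdd_mul hf.measurable.aestronglyMeasurable (.of_forall hA)

lemma isBoundedMeasurable_exp {t : α → ℝ} (ht : Measurable t) :
    IsBoundedMeasurable fun x => (Circle.exp (t x) : ℂ) where
  measurable := by fun_prop
  exists_bound := ⟨1, fun x => by simp⟩

end BoundedFunctions

section Convolution

variable {G : Type*} [AddCommGroup G] [MeasurableSpace G] [MeasurableAdd₂ G]
  {μ : Measure G} [SFinite μ] [μ.IsAddLeftInvariant] {f g : G → ℂ}

lemma integrable_mul_comp_add (hf : Integrable f μ) (hg : Integrable g μ) :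
    Integrable (fun p : G × G => f p.2 * g (p.1 + p.2)) (μ.prod μ) :=
  ((measurePreserving_add_prod μ μ).integrable_comp_of_integrable (hg.mul_prod hf)).congr
    (.of_forall fun _ => mul_comm _ _)

variable [MeasurableNeg G]

lemma integrable_mul_comp_sub (hf : Integrable f μ) (hg : Integrable g μ) :
    Integrable (fun p : G × G => f p.2 * g (p.1 - p.2)) (μ.prod μ) :=
  ((measurePreserving_sub_prod μ μ).integrable_comp_of_integrable (hg.mul_prod hf)).congr
    (.of_forall fun _ => mul_comm _ _)

lemma lintegral_lintegral_mul_comp_sub {ω h : G → ℝ≥0∞} (hω : Measurable ω) (hh : Measurable h) :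
    ∫⁻ x, ∫⁻ s, ω s * h (x - s) ∂μ ∂μ = (∫⁻ s, ω s ∂μ) * ∫⁻ x, h x ∂μ := by
  have hinner (s : G) : ∫⁻ x, ω s * h (x - s) ∂μ = ω s * ∫⁻ x, h x ∂μ := by
    rw [lintegral_const_mul _ (by fun_prop), lintegral_sub_right_eq_self h s]
  rw [lintegral_lintegral_swap (by fun_prop)]
  simp only [hinner]
  rw [lintegral_mul_const _ hω]

lemma sq_lintegral_mul_le {α : Type*} [MeasurableSpace α] {ν : Measure α} {ω h : α → ℝ≥0∞}
    (hω : Measurable ω) (hh : Measurable h) :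
    (∫⁻ s, ω s * h s ∂ν) ^ 2 ≤ (∫⁻ s, ω s ∂ν) * ∫⁻ s, ω s * h s ^ 2 ∂ν := by
  have hsplit (s : α) :
      ω s * h s = ω s ^ (1 / 2 : ℝ) * (ω s * h s ^ 2) ^ (1 / 2 : ℝ) := by
    rw [← ENNReal.mul_rpow_of_nonneg _ _ (by norm_num : (0 : ℝ) ≤ 1 / 2), ← mul_assoc, ← sq,
      ← mul_pow, sq_rpow_half]
  simp only [hsplit]
  refine (pow_le_pow_left' (lintegral_mul_le_sqrt (by fun_prop) (by fun_prop)) 2).trans_eq ?_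
  simp only [rpow_half_sq, mul_pow]

end Convolution

section OscillatoryIntegrals

lemma measurable_oscIntegral_param {E α : Type*} [NormedAddCommGroup E] [InnerProductSpace ℝ E]
    [FiniteDimensional ℝ E] [MeasurableSpace E] [BorelSpace E] [MeasurableSpace α]
    {f : α → E → ℂ} (hf : Measurable (Function.uncurry f)) :
    Measurable fun q : α × E => oscIntegral (f q.1) q.2 := by
  have : Measurable fun q : (α × E) × E => f q.1.1 q.2 :=
    hf.comp (f := fun q : (α × E) × E => (q.1.1, q.2)) (by fun_prop)
  have hintegrand : Measurable fun q : (α × E) × E =>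
      Circle.exp (inner ℝ q.2 q.1.2) * f q.1.1 q.2 := by fun_prop
  exact hintegrand.stronglyMeasurable.integral_prod_right'.measurable

lemma oscIntegral_eq_convolution {u : Rn n → ℂ} (hu : Integrable u) {v : 𝓢(Rn n, ℂ)} {p : Rn n}
    (hv : ∀ x, u x ≠ 0 → v (x - p) = 1) (ζ : Rn n) :
    oscIntegral u ζ =
      ∫ s, Circle.exp (inner ℝ p s) * schwartzCheck v s * oscIntegral u (ζ - s) := by
  have hint : Integrable (Function.uncurry fun (s x : Rn n) =>
      (Circle.exp (inner ℝ p s + inner ℝ x (ζ - s)) : ℂ) * (schwartzCheck v s * u x))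
      ((volume : Measure (Rn n)).prod volume) :=
    (isBoundedMeasurable_exp (by fun_prop)).integrable_mul
      ((schwartzCheck v).integrable.mul_prod hu)
  have hphase (s x : Rn n) : inner ℝ p s + inner ℝ x (ζ - s) =
      inner ℝ x ζ + -inner ℝ s (x - p) := by
    rw [inner_sub_right, inner_sub_right, real_inner_comm p s, real_inner_comm x s]
    ring
  calc oscIntegral u ζ
      = ∫ x, ∫ s, Circle.exp (inner ℝ p s + inner ℝ x (ζ - s)) * (schwartzCheck v s * u x) := by
        refine integral_congr_ae (.of_forall fun x => ?_)
        have hfactor (s : Rn n) :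
            Circle.exp (inner ℝ p s + inner ℝ x (ζ - s)) * (schwartzCheck v s * u x) =
              Circle.exp (inner ℝ x ζ) * u x *
                (Circle.exp (-inner ℝ s (x - p)) * schwartzCheck v s) := by
          rw [hphase, Circle.exp_add, Circle.coe_mul]
          ring
        simp only [hfactor]
        rw [integral_const_mul, integral_exp_mul_schwartzCheck]
        by_cases hx : u x = 0
        · simp [hx]
        · rw [hv x hx, mul_one]
    _ = ∫ s, ∫ x, Circle.exp (inner ℝ p s + inner ℝ x (ζ - s)) * (schwartzCheck v s * u x) :=
        (integral_integral_swap hint).symm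
    _ = _ := by
        refine integral_congr_ae (.of_forall fun s => ?_)
        simp only [oscIntegral]
        rw [← integral_const_mul]
        refine integral_congr_ae (.of_forall fun x => ?_)
        simp only [Circle.exp_add, Circle.coe_mul]
        ring

lemma exists_enorm_schwartz_add_le {E : Type*} [NormedAddCommGroup E] [NormedSpace ℝ E]
    (v : 𝓢(E, ℂ)) (K : ℕ) (r : ℝ) : ∃ C : ℝ≥0, ∀ s e : E, ‖e‖ ≤ r →
      ‖v (s + e)‖ₑ ≤ C * ENNReal.ofReal (((1 + ‖s‖) ^ K)⁻¹) := by
  obtain ⟨C, hC₀, hC⟩ := exists_norm_schwartz_le v K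
  refine ⟨(C * (1 + r) ^ K).toNNReal, fun s e he => ?_⟩
  have hr : 0 ≤ r := (norm_nonneg e).trans he
  have hs : 1 + ‖s‖ ≤ (1 + r) * (1 + ‖s + e‖) := by
    have : ‖s‖ ≤ ‖s + e‖ + ‖e‖ := by simpa using norm_sub_le (s + e) e
    nlinarith [norm_nonneg (s + e)]
  have hdecay : ((1 + ‖s + e‖) ^ K)⁻¹ ≤ (1 + r) ^ K * ((1 + ‖s‖) ^ K)⁻¹ := by
    rw [← div_eq_mul_inv, le_div_iff₀ (by positivity), inv_mul_le_iff₀ (by positivity),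
      ← mul_pow, mul_comm (1 + ‖s + e‖)]
    gcongr
  rw [← ENNReal.ofReal, ← ofReal_norm, ← ENNReal.ofReal_mul (by positivity), mul_assoc]
  exact ENNReal.ofReal_le_ofReal ((hC _).trans (by gcongr))

/-- The uncertainty principle: localizing `u` near `p` makes its Fourier transform essentially
constant at unit scale. -/
lemma exists_enorm_oscIntegral_add_sq_le (v : 𝓢(Rn n, ℂ)) (r : ℝ) :
    ∃ C : ℝ≥0, ∀ (u : Rn n → ℂ) (p : Rn n), Integrable u → (∀ x, u x ≠ 0 → v (x - p) = 1) →
      ∀ ζ e : Rn n, ‖e‖ ≤ r → ‖oscIntegral u (ζ + e)‖ₑ ^ 2 ≤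
        C * ∫⁻ s, ENNReal.ofReal (((1 + ‖s‖) ^ (n + 1))⁻¹) * ‖oscIntegral u (ζ - s)‖ₑ ^ 2 := by
  set ω : Rn n → ℝ≥0∞ := fun s => ENNReal.ofReal (((1 + ‖s‖) ^ (n + 1))⁻¹)
  have hω : Measurable ω := by fun_prop
  have hω_fin : ∫⁻ s, ω s < ∞ := lintegral_one_add_norm_pow_inv_lt_top _ (by simp)
  obtain ⟨C, hC⟩ := exists_enorm_schwartz_add_le (schwartzCheck v) (n + 1) r
  refine ⟨C ^ 2 * (∫⁻ s, ω s).toNNReal, fun u p hu hv ζ e he => ?_⟩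
  have hm : Measurable fun s => ‖oscIntegral u (ζ - s)‖ₑ := by
    have := (continuous_oscIntegral hu).measurable
    fun_prop
  have hle : ‖oscIntegral u (ζ + e)‖ₑ ≤ C * ∫⁻ s, ω s * ‖oscIntegral u (ζ - s)‖ₑ := by
    calc ‖oscIntegral u (ζ + e)‖ₑ
        ≤ ∫⁻ s, ‖schwartzCheck v (s + e)‖ₑ * ‖oscIntegral u (ζ - s)‖ₑ := by
          rw [oscIntegral_eq_convolution hu hv (ζ + e)]
          refine (enorm_integral_le_lintegral_enorm _).trans_eq ?_
          rw [← lintegral_add_right_eq_self _ e]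
          refine lintegral_congr fun s => ?_
          simp [← ofReal_norm]
      _ ≤ ∫⁻ s, C * (ω s * ‖oscIntegral u (ζ - s)‖ₑ) := by
          refine lintegral_mono fun s => ?_
          rw [← mul_assoc]
          exact mul_le_mul_left (hC s e he) _
      _ = _ := lintegral_const_mul _ (by fun_prop)
  calc ‖oscIntegral u (ζ + e)‖ₑ ^ 2 ≤ (C * ∫⁻ s, ω s * ‖oscIntegral u (ζ - s)‖ₑ) ^ 2 := by gcongr
    _ ≤ C ^ 2 * ((∫⁻ s, ω s) * ∫⁻ s, ω s * ‖oscIntegral u (ζ - s)‖ₑ ^ 2) := by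
        rw [mul_pow]
        gcongr
        exact sq_lintegral_mul_le hω hm
    _ = _ := by
        rw [ENNReal.coe_mul, ENNReal.coe_toNNReal hω_fin.ne, ENNReal.coe_pow, mul_assoc]

end OscillatoryIntegrals

section ModerateWeights

variable {E : Type*} [NormedAddCommGroup E] [MeasurableSpace E]

/-- A weight of polynomial growth: translating it by `s` costs at most a factor `(1 + ‖s‖) ^ K`. -/
structure IsModerateWeight (K : ℕ) (w : E → ℝ≥0∞) : Prop extends IsWeight w where
  moderate : ∀ ξ s, w (ξ - s) ≤ ENNReal.ofReal ((1 + ‖s‖) ^ K) * w ξ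

variable [BorelSpace E] {μ : Measure E} [μ.IsAddRightInvariant] {K : ℕ} {w f : E → ℝ≥0∞}

lemma IsModerateWeight.lintegral_mul_comp_add_le (hw : IsModerateWeight K w) (hf : Measurable f)
    (s : E) : ∫⁻ ξ, w ξ * f (ξ + s) ∂μ ≤
      ENNReal.ofReal ((1 + ‖s‖) ^ K) * ∫⁻ ξ, w ξ * f ξ ∂μ := by
  have := hw.measurable
  rw [← lintegral_sub_right_eq_self _ s, ← lintegral_const_mul _ (by fun_prop)]
  refine lintegral_mono fun ξ => ?_
  rw [sub_add_cancel, ← mul_assoc]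
  exact mul_le_mul_left (hw.moderate ξ s) _

lemma IsModerateWeight.lintegral_mul_setLIntegral_translate_le [SecondCountableTopology E]
    [SFinite μ] (hw : IsModerateWeight K w) (hf : Measurable f) {Q : Set E} {r : ℝ}
    (hQm : MeasurableSet Q) (hQ : μ Q = 1) (hQr : ∀ x ∈ Q, ‖x‖ ≤ r) :
    ∫⁻ ξ, w ξ * ∫⁻ x in Q, f (ξ + x) ∂μ ∂μ ≤
      ENNReal.ofReal ((1 + r) ^ K) * ∫⁻ ξ, w ξ * f ξ ∂μ := by
  have := hw.measurable
  calc ∫⁻ ξ, w ξ * ∫⁻ x in Q, f (ξ + x) ∂μ ∂μ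
      = ∫⁻ ξ, ∫⁻ x in Q, w ξ * f (ξ + x) ∂μ ∂μ :=
        lintegral_congr fun ξ => (lintegral_const_mul _ (by fun_prop)).symm
    _ = ∫⁻ x in Q, ∫⁻ ξ, w ξ * f (ξ + x) ∂μ ∂μ := lintegral_lintegral_swap (by fun_prop)
    _ ≤ ∫⁻ _ in Q, ENNReal.ofReal ((1 + r) ^ K) * ∫⁻ ξ, w ξ * f ξ ∂μ ∂μ := by
        refine setLIntegral_mono' hQm fun x hx => (hw.lintegral_mul_comp_add_le hf x).trans ?_
        gcongr
        exact hQr x hx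
    _ = _ := by rw [setLIntegral_const, hQ, mul_one]

end ModerateWeights

section Localization

/-- The restriction of the inverse Fourier transform of `a` to a neighbourhood of `p`, performed on
the frequency side: the Fourier multiplier `a` is averaged against the kernel `e^{i p·s} χ̌(s)`. -/
def localize (χ : 𝓢(Rn n, ℂ)) (p : Rn n) (a : Rn n → ℂ) (ξ : Rn n) : ℂ :=
  oscIntegral (fun s => schwartzCheck χ s * a (ξ + s)) p

variable {χ : 𝓢(Rn n, ℂ)} {a : Rn n → ℂ}

lemma measurable_localize (χ : 𝓢(Rn n, ℂ)) (ha : Measurable a) :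
    Measurable fun q : Rn n × Rn n => localize χ q.1 a q.2 := by
  have := (schwartzCheck χ).continuous.measurable
  have hkernel : Measurable fun q : Rn n × Rn n => schwartzCheck χ q.2 * a (q.1 + q.2) := by
    fun_prop
  have hosc : Measurable fun q : Rn n × Rn n =>
      oscIntegral (fun s => schwartzCheck χ s * a (q.1 + s)) q.2 :=
    measurable_oscIntegral_param (f := fun ξ s => schwartzCheck χ s * a (ξ + s)) hkernel
  have hswap : Measurable fun q : Rn n × Rn n => (q.2, q.1) := by fun_prop
  simpa only [localize, Function.comp_def] using hosc.comp hswap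

lemma integrable_localize (χ : 𝓢(Rn n, ℂ)) (p : Rn n) (ha : Integrable a) :
    Integrable (localize χ p a) :=
  ((isBoundedMeasurable_exp (t := fun q : Rn n × Rn n => inner ℝ q.2 p)
    (by fun_prop)).integrable_mul
      (integrable_mul_comp_add (schwartzCheck χ).integrable ha)).integral_prod_left

lemma lintegral_enorm_localize_sq (χ : 𝓢(Rn n, ℂ)) (ha : IsBoundedMeasurable a) (ξ : Rn n) :
    ∫⁻ p, ‖localize χ p a ξ‖ₑ ^ 2 = ENNReal.ofReal ((2 * Real.pi) ^ n) *
      ∫⁻ s, ‖schwartzCheck χ s‖ₑ ^ 2 * ‖a (ξ + s)‖ₑ ^ 2 := by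
  have hξ : IsBoundedMeasurable fun s => a (ξ + s) := ha.comp (by fun_prop)
  obtain ⟨A, hA⟩ := hξ.exists_bound
  have hL1 : Integrable (fun s => schwartzCheck χ s * a (ξ + s)) := by
    simpa only [mul_comm] using hξ.integrable_mul (schwartzCheck χ).integrable
  have hL2 : MemLp (fun s => schwartzCheck χ s * a (ξ + s)) 2 :=
    (memLp_top_of_bound hξ.measurable.aestronglyMeasurable A (.of_forall hA)).mul
      ((schwartzCheck χ).memLp 2)
  simpa only [localize, enorm_mul, mul_pow, finrank_euclideanSpace_fin] using
    lintegral_enorm_oscIntegral_sq hL1 hL2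

/-- The weighted `L²` norm squared of `localize χ p a`, averaged over unit cubes. -/
def localWeightNorm (χ : 𝓢(Rn n, ℂ)) (w : Rn n → ℝ≥0∞) (a : Rn n → ℂ) (p : Rn n) : ℝ≥0∞ :=
  ∫⁻ ξ, w ξ * ∫⁻ x in unitCube n, ‖localize χ p a (ξ + x)‖ₑ ^ 2

variable {w : Rn n → ℝ≥0∞}

lemma measurable_localWeightNorm (χ : 𝓢(Rn n, ℂ)) (hw : Measurable w) (ha : Measurable a) :
    Measurable (localWeightNorm χ w a) := by
  have : Measurable fun r : (Rn n × Rn n) × Rn n => localize χ r.1.1 a (r.1.2 + r.2) :=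
    (measurable_localize χ ha).comp (f := fun r : (Rn n × Rn n) × Rn n =>
      (r.1.1, r.1.2 + r.2)) (by fun_prop)
  have : Measurable fun q : Rn n × Rn n =>
      ∫⁻ x in unitCube n, ‖localize χ q.1 a (q.2 + x)‖ₑ ^ 2 :=
    Measurable.lintegral_prod_right' (f := fun r : (Rn n × Rn n) × Rn n =>
      ‖localize χ r.1.1 a (r.1.2 + r.2)‖ₑ ^ 2) (by fun_prop)
  exact Measurable.lintegral_prod_right' (f := fun q : Rn n × Rn n =>
    w q.2 * ∫⁻ x in unitCube n, ‖localize χ q.1 a (q.2 + x)‖ₑ ^ 2) (by fun_prop)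

lemma lintegral_weight_mul_lintegral_localize_sq_le (χ : 𝓢(Rn n, ℂ))
    (ha : IsBoundedMeasurable a) {K : ℕ} (hw : IsModerateWeight K w) :
    ∫⁻ ξ, w ξ * ∫⁻ p, ‖localize χ p a ξ‖ₑ ^ 2 ≤ ENNReal.ofReal ((2 * Real.pi) ^ n) *
      ((∫⁻ s, ‖schwartzCheck χ s‖ₑ ^ 2 * ENNReal.ofReal ((1 + ‖s‖) ^ K)) *
        ∫⁻ ξ, w ξ * ‖a ξ‖ₑ ^ 2) := by
  have := (schwartzCheck χ).continuous.measurable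
  have := hw.measurable
  have := ha.measurable
  calc ∫⁻ ξ, w ξ * ∫⁻ p, ‖localize χ p a ξ‖ₑ ^ 2
      = ENNReal.ofReal ((2 * Real.pi) ^ n) *
          ∫⁻ ξ, ∫⁻ s, ‖schwartzCheck χ s‖ₑ ^ 2 * (w ξ * ‖a (ξ + s)‖ₑ ^ 2) := by
        rw [← lintegral_const_mul' _ _ ENNReal.ofReal_ne_top]
        refine lintegral_congr fun ξ => ?_
        rw [lintegral_enorm_localize_sq χ ha, mul_left_comm,
          ← lintegral_const_mul _ (by fun_prop)]
        simp only [mul_left_comm (w ξ)]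
    _ = ENNReal.ofReal ((2 * Real.pi) ^ n) *
          ∫⁻ s, ‖schwartzCheck χ s‖ₑ ^ 2 * ∫⁻ ξ, w ξ * ‖a (ξ + s)‖ₑ ^ 2 := by
        rw [lintegral_lintegral_swap (by fun_prop)]
        congr 1
        exact lintegral_congr fun s => lintegral_const_mul _ (by fun_prop)
    _ ≤ ENNReal.ofReal ((2 * Real.pi) ^ n) *
          ∫⁻ s, ‖schwartzCheck χ s‖ₑ ^ 2 * ENNReal.ofReal ((1 + ‖s‖) ^ K) *
            ∫⁻ ξ, w ξ * ‖a ξ‖ₑ ^ 2 := by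
        simp only [mul_assoc]
        gcongr with s
        exact hw.lintegral_mul_comp_add_le (f := fun ξ => ‖a ξ‖ₑ ^ 2) (by fun_prop) s
    _ = _ := by rw [lintegral_mul_const _ (by fun_prop)]

lemma lintegral_localWeightNorm_le (χ : 𝓢(Rn n, ℂ)) (ha : IsBoundedMeasurable a) {K : ℕ}
    (hw : IsModerateWeight K w) :
    ∫⁻ p, localWeightNorm χ w a p ≤
      ENNReal.ofReal ((1 + n) ^ K) * (ENNReal.ofReal ((2 * Real.pi) ^ n) *
        ((∫⁻ s, ‖schwartzCheck χ s‖ₑ ^ 2 * ENNReal.ofReal ((1 + ‖s‖) ^ K)) *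
          ∫⁻ ξ, w ξ * ‖a ξ‖ₑ ^ 2)) := by
  have := hw.measurable
  have hL := measurable_localize χ ha.measurable
  have hLp (p : Rn n) : Measurable (localize χ p a) := hL.comp (f := fun ξ => (p, ξ)) (by fun_prop)
  calc ∫⁻ p, localWeightNorm χ w a p
      ≤ ∫⁻ p, ENNReal.ofReal ((1 + n) ^ K) * ∫⁻ ξ, w ξ * ‖localize χ p a ξ‖ₑ ^ 2 :=
        lintegral_mono fun p => hw.lintegral_mul_setLIntegral_translate_le
          (f := fun ξ => ‖localize χ p a ξ‖ₑ ^ 2) ((hLp p).enorm.pow_const 2)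
          measurableSet_unitCube volume_unitCube fun _ => norm_le_of_mem_unitCube
    _ = ENNReal.ofReal ((1 + n) ^ K) * ∫⁻ p, ∫⁻ ξ, w ξ * ‖localize χ p a ξ‖ₑ ^ 2 :=
        lintegral_const_mul' _ _ ENNReal.ofReal_ne_top
    _ = ENNReal.ofReal ((1 + n) ^ K) * ∫⁻ ξ, w ξ * ∫⁻ p, ‖localize χ p a ξ‖ₑ ^ 2 := by
        rw [lintegral_lintegral_swap (by fun_prop)]
        congr 1
        exact lintegral_congr fun ξ => lintegral_const_mul _ (by fun_prop)
    _ ≤ _ := by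
        gcongr
        exact lintegral_weight_mul_lintegral_localize_sq_le χ ha hw

end Localization

section Reproducing

variable {G : Type*} [AddCommGroup G] [MeasurableSpace G] {μ : Measure G} {κ U m : G → ℂ}

/-- `m` is reproduced by convolution with `κ`. For a Schwartz function `κ` this encodes that the
Fourier transform of `m` lives where that of `κ` equals `1`. -/
def IsReproducedBy (μ : Measure G) (κ m : G → ℂ) : Prop :=
  ∀ x, m x = ∫ y, κ y * m (x - y) ∂μ

variable [MeasurableAdd₂ G] [MeasurableNeg G] [SFinite μ] [μ.IsAddLeftInvariant]

lemma IsReproducedBy.integral_mul_eq (h : IsReproducedBy μ κ m) (hκ : Integrable κ μ)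
    (hm : IsBoundedMeasurable m) (hU : Integrable U μ) :
    ∫ x, U x * m x ∂μ = ∫ y, (∫ s, κ s * U (y + s) ∂μ) * m y ∂μ := by
  have hint : Integrable (fun p : G × G => m p.1 * (κ p.2 * U (p.1 + p.2))) (μ.prod μ) :=
    (hm.comp measurable_fst).integrable_mul (integrable_mul_comp_add hκ hU)
  have hint' : Integrable (fun p : G × G => m (p.1 - p.2) * (κ p.2 * U p.1)) (μ.prod μ) := by
    refine (hm.comp (by fun_prop)).integrable_mul ?_
    simpa only [mul_comm] using hU.mul_prod hκ
  calc ∫ x, U x * m x ∂μ = ∫ x, ∫ s, m (x - s) * (κ s * U x) ∂μ ∂μ := by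
        refine integral_congr_ae (.of_forall fun x => ?_)
        simp only
        rw [h x, ← integral_const_mul]
        simp only [mul_assoc, mul_comm, mul_left_comm]
    _ = ∫ s, ∫ x, m (x - s) * (κ s * U x) ∂μ ∂μ := integral_integral_swap hint'
    _ = ∫ s, ∫ y, m y * (κ s * U (y + s)) ∂μ ∂μ := by
        refine integral_congr_ae (.of_forall fun s => ?_)
        simp only
        rw [← integral_add_right_eq_self _ s]
        simp only [add_sub_cancel_right]
    _ = ∫ y, ∫ s, m y * (κ s * U (y + s)) ∂μ ∂μ := (integral_integral_swap hint).symm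
    _ = _ := by simp only [integral_const_mul, mul_comm]

lemma IsReproducedBy.modulated {m : Rn n → ℂ} (hm : IsBoundedMeasurable m) {u v : 𝓢(Rn n, ℂ)}
    (hu : IsReproducedBy volume (schwartzCheck u) m) {q : Rn n}
    (h : ∀ ξ, v (ξ + q) * u ξ = u ξ) :
    IsReproducedBy volume (fun s => Circle.exp (-inner ℝ q s) * schwartzCheck v s) m := by
  intro ζ
  have hint : Integrable (Function.uncurry fun (t s : Rn n) =>
      (Circle.exp (-inner ℝ q s) : ℂ) *
        (m (ζ - t) * (schwartzCheck v s * schwartzCheck u (t - s))))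
      ((volume : Measure (Rn n)).prod volume) :=
    (isBoundedMeasurable_exp (by fun_prop)).integrable_mul
      ((hm.comp (g := fun p : Rn n × Rn n => ζ - p.1) (by fun_prop)).integrable_mul
        (integrable_mul_comp_sub (schwartzCheck v).integrable (schwartzCheck u).integrable))
  symm
  calc ∫ s, Circle.exp (-inner ℝ q s) * schwartzCheck v s * m (ζ - s)
      = ∫ s, ∫ t, Circle.exp (-inner ℝ q s) *
          (m (ζ - t) * (schwartzCheck v s * schwartzCheck u (t - s))) := by
        refine integral_congr_ae (.of_forall fun s => ?_)
        simp only
        rw [hu (ζ - s), ← integral_const_mul, ← integral_sub_right_eq_self (μ := volume) _ s]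
        refine integral_congr_ae (.of_forall fun t => ?_)
        simp only
        rw [show ζ - s - (t - s) = ζ - t by abel]
        ring
    _ = ∫ t, ∫ s, Circle.exp (-inner ℝ q s) *
          (m (ζ - t) * (schwartzCheck v s * schwartzCheck u (t - s))) :=
        (integral_integral_swap hint).symm
    _ = ∫ t, schwartzCheck u t * m (ζ - t) := by
        refine integral_congr_ae (.of_forall fun t => ?_)
        simp only
        rw [← schwartzCheck_reproducing_modulated u v q t h, ← integral_mul_const]
        refine integral_congr_ae (.of_forall fun s => ?_)
        simp only
        ring
    _ = m ζ := (hu ζ).symm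

lemma integral_exp_mul_localize {m : Rn n → ℂ} (hm : IsBoundedMeasurable m) {u v : 𝓢(Rn n, ℂ)}
    (hu : IsReproducedBy volume (schwartzCheck u) m) {x p : Rn n}
    (h : ∀ ξ, v (ξ + (x - p)) * u ξ = u ξ) {a : Rn n → ℂ} (ha : Integrable a) :
    ∫ ξ, Circle.exp (inner ℝ x ξ) * localize v p a ξ * m ξ =
      ∫ ξ, Circle.exp (inner ℝ x ξ) * a ξ * m ξ := by
  have hphase (ξ s : Rn n) : -inner ℝ (x - p) s + inner ℝ x (ξ + s) =
      inner ℝ x ξ + inner ℝ s p := by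
    rw [inner_sub_left, inner_add_right, real_inner_comm p s]
    ring
  rw [(hu.modulated hm h).integral_mul_eq
    ((isBoundedMeasurable_exp (by fun_prop)).integrable_mul (schwartzCheck v).integrable) hm
    ((isBoundedMeasurable_exp (by fun_prop)).integrable_mul ha)]
  refine integral_congr_ae (.of_forall fun ξ => ?_)
  simp only [localize, oscIntegral]
  rw [← integral_const_mul]
  congr 2 with s
  have hexp : (Circle.exp (-inner ℝ (x - p) s) * Circle.exp (inner ℝ x (ξ + s)) : ℂ) =
      Circle.exp (inner ℝ x ξ) * Circle.exp (inner ℝ s p) := by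
    simp only [← Circle.coe_mul, ← Circle.exp_add, hphase]
  linear_combination -(schwartzCheck v s * a (ξ + s)) * hexp

end Reproducing

section BilinearOperator

/-- The bilinear operator with symbol `F`, as a function of the Fourier transforms `a`, `b` of its
arguments and without the normalizing factor `(2π)^{-2n}`. -/
def bilinearFourierOp (F : Phase n → ℂ) (a b : Rn n → ℂ) (x : Rn n) : ℂ :=
  ∫ p : Rn n × Rn n, Circle.exp (inner ℝ x (p.1 + p.2)) * F (x, p.1, p.2) * a p.1 * b p.2

variable {F : Phase n → ℂ} {a b : Rn n → ℂ}

lemma integrable_bilinearFourierOp_integrand (hF : IsBoundedMeasurable F) (ha : Integrable a)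
    (hb : Integrable b) (x : Rn n) :
    Integrable fun p : Rn n × Rn n =>
      Circle.exp (inner ℝ x (p.1 + p.2)) * F (x, p.1, p.2) * a p.1 * b p.2 := by
  simp only [mul_assoc]
  exact (isBoundedMeasurable_exp (by fun_prop)).integrable_mul
    ((hF.comp (g := fun p : Rn n × Rn n => (x, p.1, p.2)) (by fun_prop)).integrable_mul
      (ha.mul_prod hb))

lemma bilinearFourierOp_swap (F : Phase n → ℂ) (a b : Rn n → ℂ) (x : Rn n) :
    bilinearFourierOp (fun X => F (X.1, X.2.2, X.2.1)) b a x = bilinearFourierOp F a b x := by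
  unfold bilinearFourierOp
  rw [Measure.volume_eq_prod, ← integral_prod_swap]
  simp only [Prod.fst_swap, Prod.snd_swap, add_comm, mul_right_comm]

lemma bilinearFourierOp_localize_left (hF : IsBoundedMeasurable F) {u v : 𝓢(Rn n, ℂ)}
    {x p : Rn n} (hu : ∀ η, IsReproducedBy volume (schwartzCheck u) fun ξ => F (x, ξ, η))
    (hv : ∀ ξ, v (ξ + (x - p)) * u ξ = u ξ) (ha : Integrable a) (hb : Integrable b) :
    bilinearFourierOp F (localize v p a) b x = bilinearFourierOp F a b x := by
  have hsplit (a : Rn n → ℂ) (η : Rn n) :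
      ∫ ξ, Circle.exp (inner ℝ x (ξ + η)) * F (x, ξ, η) * a ξ * b η =
        Circle.exp (inner ℝ x η) * b η *
          ∫ ξ, Circle.exp (inner ℝ x ξ) * a ξ * F (x, ξ, η) := by
    rw [← integral_const_mul]
    congr 1 with ξ
    rw [inner_add_right, Circle.exp_add, Circle.coe_mul]
    ring
  unfold bilinearFourierOp
  rw [Measure.volume_eq_prod, integral_prod_symm _ (integrable_bilinearFourierOp_integrand hF
    (integrable_localize v p ha) hb x),
    integral_prod_symm _ (integrable_bilinearFourierOp_integrand hF ha hb x)]
  congr 1 with η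
  rw [hsplit, hsplit,
    integral_exp_mul_localize (hF.comp (g := fun ξ => (x, ξ, η)) (by fun_prop)) (hu η) hv ha]

lemma bilinearFourierOp_localize (hF : IsBoundedMeasurable F) {u₁ u₂ v₁ v₂ : 𝓢(Rn n, ℂ)}
    {x p : Rn n} (hu₁ : ∀ η, IsReproducedBy volume (schwartzCheck u₁) fun ξ => F (x, ξ, η))
    (hu₂ : ∀ ξ, IsReproducedBy volume (schwartzCheck u₂) fun η => F (x, ξ, η))
    (hv₁ : ∀ ξ, v₁ (ξ + (x - p)) * u₁ ξ = u₁ ξ) (hv₂ : ∀ η, v₂ (η + (x - p)) * u₂ η = u₂ η)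
    (ha : Integrable a) (hb : Integrable b) :
    bilinearFourierOp F (localize v₁ p a) (localize v₂ p b) x = bilinearFourierOp F a b x := by
  rw [bilinearFourierOp_localize_left hF hu₁ hv₁ ha (integrable_localize v₂ p hb),
    ← bilinearFourierOp_swap, bilinearFourierOp_localize_left (hF.comp (by fun_prop)) hu₂ hv₂ hb ha,
    bilinearFourierOp_swap]

lemma integral_mul_exp_mul_eq (u : 𝓢(Rn n, ℂ)) {m U : Rn n → ℂ} (hm : IsBoundedMeasurable m)
    (hu : IsReproducedBy volume (schwartzCheck u) m) (hU : Integrable U) (ζ : Rn n) :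
    ∫ x, Circle.exp (inner ℝ x ζ) * U x * m x =
      ∫ y, oscIntegral (fun x => U x * schwartzCheck u (x - y)) ζ * m y := by
  rw [hu.integral_mul_eq (schwartzCheck u).integrable hm
    ((isBoundedMeasurable_exp (by fun_prop)).integrable_mul hU)]
  congr 1 with y
  rw [oscIntegral, ← integral_add_left_eq_self
    (fun x => (Circle.exp (inner ℝ x ζ) * (U x * schwartzCheck u (x - y)) : ℂ)) y]
  simp only [add_sub_cancel_left, mul_assoc, mul_comm, mul_left_comm]

lemma enorm_integral_mul_bilinearFourierOp_le (hF : IsBoundedMeasurable F) (u : 𝓢(Rn n, ℂ))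
    (hu : ∀ ξ η, IsReproducedBy volume (schwartzCheck u) fun x => F (x, ξ, η))
    {U : Rn n → ℂ} (hUm : Measurable U) (hU : Integrable U) (ham : Measurable a)
    (hbm : Measurable b) (ha : Integrable a) (hb : Integrable b) :
    ‖∫ x, U x * bilinearFourierOp F a b x‖ₑ ≤ ∫⁻ X : Phase n, ‖F X‖ₑ *
      (‖oscIntegral (fun x => U x * schwartzCheck u (x - X.1)) (X.2.1 + X.2.2)‖ₑ *
        (‖a X.2.1‖ₑ * ‖b X.2.2‖ₑ)) := by
  have hint : Integrable (Function.uncurry fun (x : Rn n) (p : Rn n × Rn n) =>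
      (Circle.exp (inner ℝ x (p.1 + p.2)) : ℂ) * (F (x, p.1, p.2) * (U x * (a p.1 * b p.2))))
      ((volume : Measure (Rn n)).prod volume) :=
    (isBoundedMeasurable_exp (by fun_prop)).integrable_mul
      (hF.integrable_mul (hU.mul_prod (ha.mul_prod hb)))
  have hinner (p : Rn n × Rn n) :
      ∫ x, Circle.exp (inner ℝ x (p.1 + p.2)) * (F (x, p.1, p.2) * (U x * (a p.1 * b p.2))) =
        (∫ y, oscIntegral (fun x => U x * schwartzCheck u (x - y)) (p.1 + p.2) *
          F (y, p.1, p.2)) * (a p.1 * b p.2) := by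
    rw [← integral_mul_exp_mul_eq u (hF.comp (g := fun x => (x, p.1, p.2)) (by fun_prop))
      (hu p.1 p.2) hU, ← integral_mul_const]
    simp only [mul_assoc, mul_left_comm]
  calc ‖∫ x, U x * bilinearFourierOp F a b x‖ₑ
      = ‖∫ p : Rn n × Rn n, (∫ y, oscIntegral (fun x => U x * schwartzCheck u (x - y))
          (p.1 + p.2) * F (y, p.1, p.2)) * (a p.1 * b p.2)‖ₑ := by
        simp only [← hinner]
        rw [← integral_integral_swap hint]
        simp only [bilinearFourierOp, ← integral_const_mul, mul_assoc, mul_left_comm]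
    _ ≤ ∫⁻ p : Rn n × Rn n, ∫⁻ y, ‖F (y, p.1, p.2)‖ₑ *
        (‖oscIntegral (fun x => U x * schwartzCheck u (x - y)) (p.1 + p.2)‖ₑ *
          (‖a p.1‖ₑ * ‖b p.2‖ₑ)) := by
        refine (enorm_integral_le_lintegral_enorm _).trans (lintegral_mono fun p => ?_)
        rw [← integral_mul_const]
        refine (enorm_integral_le_lintegral_enorm _).trans_eq ?_
        simp only [enorm_mul, mul_comm, mul_left_comm]
    _ = _ := by
        have hker : Measurable (Function.uncurry fun y x => U x * schwartzCheck u (x - y)) := by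
          have := (schwartzCheck u).continuous.measurable
          unfold Function.uncurry
          fun_prop
        have : Measurable fun X : Phase n =>
            oscIntegral (fun x => U x * schwartzCheck u (x - X.1)) (X.2.1 + X.2.2) :=
          (measurable_oscIntegral_param hker).comp
            (f := fun X : Phase n => (X.1, X.2.1 + X.2.2)) (by fun_prop)
        have := hF.measurable
        rw [Measure.volume_eq_prod (Rn n) (Rn n × Rn n), lintegral_prod_symm _ (by fun_prop)]

end BilinearOperator

section Duality

lemma star_div_norm_mul_self (z : ℂ) : star z / ‖z‖ * z = ‖z‖ := by
  rcases eq_or_ne z 0 with rfl | hz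
  · simp
  · rw [div_mul_eq_mul_div, div_eq_iff (by simpa using hz), ← sq]
    exact Complex.conj_mul' z

lemma exists_lintegral_enorm_eq_enorm_integral {α : Type*} [MeasurableSpace α] {μ : Measure α}
    {g : α → ℂ} (hg : IsBoundedMeasurable g) {S : Set α} (hS : MeasurableSet S)
    (hS' : μ S ≠ ∞) :
    ∃ U : α → ℂ, Measurable U ∧ (∀ x, ‖U x‖ ≤ S.indicator 1 x) ∧
      ∫⁻ x in S, ‖g x‖ₑ ∂μ = ‖∫ x, U x * g x ∂μ‖ₑ := by
  have hgm := hg.measurable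
  obtain ⟨A, hA⟩ := hg.exists_bound
  refine ⟨S.indicator fun x => star (g x) / ‖g x‖, ?_, fun x => ?_, ?_⟩
  · have : Measurable fun x => star (g x) := continuous_star.measurable.comp hgm
    exact Measurable.indicator (by fun_prop) hS
  · rw [norm_indicator_eq_indicator_norm]
    refine Set.indicator_le_indicator ?_
    simpa using div_self_le_one ‖g x‖
  · have hi : IntegrableOn (fun x => ‖g x‖) S μ :=
      Measure.integrableOn_of_bounded (M := A) hS' hgm.norm.aestronglyMeasurable
        (.of_forall fun x => by simpa using hA x)
    have hmul (x : α) : S.indicator (fun x => star (g x) / (‖g x‖ : ℂ)) x * g x =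
        S.indicator (fun x => (‖g x‖ : ℂ)) x := by
      rw [← Set.indicator_mul_left]
      simp only [star_div_norm_mul_self]
    simp only [hmul]
    rw [integral_indicator hS, integral_complex_ofReal, ← ofReal_norm, Complex.norm_real,
      Real.norm_of_nonneg (integral_nonneg fun x => norm_nonneg _),
      ofReal_integral_eq_lintegral_ofReal hi (.of_forall fun x => norm_nonneg _)]
    simp only [ofReal_norm]

end Duality

section DyadicDilates

variable {V : Type*} [NormedAddCommGroup V] [NormedSpace ℝ V] {φ : 𝓢(V, ℂ)} {k : ℕ} {x : V}

lemma IsLPGenerator.dyadicDilate_eq_one (hφ : IsLPGenerator φ) (hx : ‖x‖ ≤ 2 ^ k) :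
    dyadicDilate k φ x = 1 := by
  rw [dyadicDilate_apply]
  refine hφ.eq_one _ ?_
  rwa [norm_smul, norm_inv, norm_pow, Real.norm_of_nonneg zero_le_two,
    inv_mul_le_iff₀ (by positivity), mul_one]

lemma IsLPGenerator.norm_le_of_dyadicDilate_ne_zero (hφ : IsLPGenerator φ)
    (hx : dyadicDilate k φ x ≠ 0) : ‖x‖ ≤ 2 ^ (k + 1) := by
  have h : ((2 : ℝ) ^ k)⁻¹ • x ∈ Metric.closedBall 0 2 :=
    hφ.supp (subset_tsupport _ (Function.mem_support.2 hx))
  rw [mem_closedBall_zero_iff, norm_smul, norm_inv, norm_pow, Real.norm_of_nonneg zero_le_two,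
    inv_mul_le_iff₀ (by positivity)] at h
  rwa [pow_succ]

lemma IsLPGenerator.dyadicDilate_mul_dyadicDilate {φ : 𝓢(Rn n, ℂ)} (hφ : IsLPGenerator φ) (k : ℕ)
    {q : Rn n} (hq : q ∈ unitCube n) (ξ : Rn n) :
    dyadicDilate (k + 1 + n) φ (ξ + q) * dyadicDilate k φ ξ = dyadicDilate k φ ξ := by
  by_cases h : dyadicDilate k φ ξ = 0
  · simp [h]
  rw [hφ.dyadicDilate_eq_one, one_mul]
  have hn : (n : ℝ) + 1 ≤ 2 ^ n := by exact_mod_cast Nat.lt_two_pow_self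
  have hk : (1 : ℝ) ≤ 2 ^ (k + 1) := one_le_pow₀ one_le_two
  calc ‖ξ + q‖ ≤ 2 ^ (k + 1) + n :=
        (norm_add_le _ _).trans
          (add_le_add (hφ.norm_le_of_dyadicDilate_ne_zero h) (norm_le_of_mem_unitCube hq))
    _ ≤ 2 ^ (k + 1) * (n + 1) := by nlinarith [Nat.cast_nonneg (α := ℝ) n]
    _ ≤ 2 ^ (k + 1) * 2 ^ n := by gcongr
    _ = 2 ^ (k + 1 + n) := (pow_add _ _ _).symm

lemma ofReal_two_pow_pow (n k : ℕ) :
    ENNReal.ofReal (((2 : ℝ) ^ k) ^ n) = (2 : ℝ≥0∞) ^ (n * k) := by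
  rw [← pow_mul, mul_comm, ENNReal.ofReal_pow (by norm_num)]
  simp

end DyadicDilates

section CubeTestFunctions

/-- A test function supported in the unit cube centred at `p`, against which the `L¹` norm on that
cube is computed by duality. -/
structure IsCubeTestFunction (p : Rn n) (U : Rn n → ℂ) : Prop where
  measurable : Measurable U
  norm_le_one : ∀ x, ‖U x‖ ≤ 1
  sub_mem : ∀ x, U x ≠ 0 → x - p ∈ unitCube n

variable {p : Rn n} {U : Rn n → ℂ}

lemma exists_isCubeTestFunction_setLIntegral_eq {g : Rn n → ℂ} (hg : IsBoundedMeasurable g)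
    (p : Rn n) : ∃ U, IsCubeTestFunction p U ∧
      ∫⁻ x in unitCube n, ‖g (p + x)‖ₑ = ‖∫ x, U x * g x‖ₑ := by
  obtain ⟨U, hUm, hU, hUg⟩ := exists_lintegral_enorm_eq_enorm_integral (μ := volume)
    (hg.comp (g := fun x => p + x) (by fun_prop)) measurableSet_unitCube (by simp [volume_unitCube])
  refine ⟨fun x => U (x - p), ⟨by fun_prop, fun x => ?_, fun x hx => ?_⟩, ?_⟩
  · exact (hU _).trans (Set.indicator_le_self' (fun _ _ => zero_le_one) _)
  · by_contra h
    have := hU (x - p)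
    rw [Set.indicator_of_notMem h] at this
    exact hx (norm_le_zero_iff.1 this)
  · rw [hUg, ← integral_sub_right_eq_self _ p]
    simp only [add_sub_cancel]

lemma IsCubeTestFunction.isBoundedMeasurable (hU : IsCubeTestFunction p U) :
    IsBoundedMeasurable U :=
  ⟨hU.measurable, 1, hU.norm_le_one⟩

lemma IsCubeTestFunction.integrable (hU : IsCubeTestFunction p U) : Integrable U := by
  have hvol : volume ((fun x => x - p) ⁻¹' unitCube n) ≠ ∞ := by
    rw [(measurePreserving_sub_right volume p).measure_preimage
      measurableSet_unitCube.nullMeasurableSet, volume_unitCube]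
    exact ENNReal.one_ne_top
  have hUS : IntegrableOn U ((fun x => x - p) ⁻¹' unitCube n) :=
    Measure.integrableOn_of_bounded (M := 1) hvol hU.measurable.aestronglyMeasurable
      (.of_forall hU.norm_le_one)
  exact hUS.integrable_of_forall_notMem_eq_zero fun x hx => by_contra fun h => hx (hU.sub_mem x h)

lemma IsCubeTestFunction.lintegral_enorm_oscIntegral_sq_le (hU : IsCubeTestFunction p U)
    (θ : 𝓢(Rn n, ℂ)) (y : Rn n) :
    ∫⁻ ζ, ‖oscIntegral (fun x => U x * θ (x - y)) ζ‖ₑ ^ 2 ≤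
      ENNReal.ofReal ((2 * Real.pi) ^ n) * ∫⁻ x in unitCube n, ‖θ (p + x - y)‖ₑ ^ 2 := by
  have hL1 : Integrable fun x => U x * θ (x - y) :=
    hU.isBoundedMeasurable.integrable_mul (θ.integrable.comp_sub_right y)
  have hL2 : MemLp (fun x => U x * θ (x - y)) 2 :=
    MemLp.mul (p := ∞) (q := 2)
      ((θ.memLp 2).comp_measurePreserving (measurePreserving_sub_right volume y))
      (memLp_top_of_bound hU.measurable.aestronglyMeasurable 1 (.of_forall hU.norm_le_one))
  rw [lintegral_enorm_oscIntegral_sq hL1 hL2, finrank_euclideanSpace_fin,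
    ← lintegral_indicator measurableSet_unitCube,
    ← lintegral_sub_right_eq_self ((unitCube n).indicator fun x => ‖θ (p + x - y)‖ₑ ^ 2) p]
  gcongr with x
  by_cases hx : x - p ∈ unitCube n
  · rw [Set.indicator_of_mem hx, enorm_mul, add_sub_cancel, mul_pow]
    refine mul_le_of_le_one_left' (pow_le_one₀ (by simp) ?_)
    rw [← ofReal_norm]
    exact ENNReal.ofReal_le_one.2 (hU.norm_le_one x)
  · simp [by_contra fun h => hx (hU.sub_mem x h)]

/-- The average at unit scale of the squared Fourier transform of `U θ(· - y)`. -/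
def averagedSpectrum (U θ : Rn n → ℂ) (y ζ : Rn n) : ℝ≥0∞ :=
  ∫⁻ s, ENNReal.ofReal (((1 + ‖s‖) ^ (n + 1))⁻¹) *
    ‖oscIntegral (fun x => U x * θ (x - y)) (ζ - s)‖ₑ ^ 2

variable {θ : Rn n → ℂ}

lemma measurable_oscIntegral_mul_translate (hU : Measurable U) (hθ : Measurable θ) :
    Measurable fun q : Rn n × Rn n => oscIntegral (fun x => U x * θ (x - q.1)) q.2 := by
  have hker : Measurable (Function.uncurry fun y x => U x * θ (x - y)) := by
    unfold Function.uncurry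
    fun_prop
  exact measurable_oscIntegral_param hker

lemma measurable_averagedSpectrum (hU : Measurable U) (hθ : Measurable θ) :
    Measurable (Function.uncurry (averagedSpectrum U θ)) := by
  have : Measurable fun q : (Rn n × Rn n) × Rn n =>
      oscIntegral (fun x => U x * θ (x - q.1.1)) (q.1.2 - q.2) :=
    (measurable_oscIntegral_mul_translate hU hθ).comp
      (f := fun q : (Rn n × Rn n) × Rn n => (q.1.1, q.1.2 - q.2)) (by fun_prop)
  exact Measurable.lintegral_prod_right' (f := fun q : (Rn n × Rn n) × Rn n =>
    ENNReal.ofReal (((1 + ‖q.2‖) ^ (n + 1))⁻¹) *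
      ‖oscIntegral (fun x => U x * θ (x - q.1.1)) (q.1.2 - q.2)‖ₑ ^ 2) (by fun_prop)

lemma IsCubeTestFunction.lintegral_averagedSpectrum_le (hU : IsCubeTestFunction p U)
    (θ : 𝓢(Rn n, ℂ)) (y : Rn n) :
    ∫⁻ τ, averagedSpectrum U θ y τ ≤
      (∫⁻ s : Rn n, ENNReal.ofReal (((1 + ‖s‖) ^ (n + 1))⁻¹)) *
        (ENNReal.ofReal ((2 * Real.pi) ^ n) * ∫⁻ x in unitCube n, ‖θ (p + x - y)‖ₑ ^ 2) := by
  have := (measurable_oscIntegral_mul_translate hU.measurable θ.continuous.measurable).comp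
    (f := fun ζ => (y, ζ)) (by fun_prop)
  simp only [averagedSpectrum]
  rw [lintegral_lintegral_mul_comp_sub (by fun_prop)
    (h := fun ζ => ‖oscIntegral (fun x => U x * θ (x - y)) ζ‖ₑ ^ 2) (this.enorm.pow_const 2)]
  gcongr
  exact hU.lintegral_enorm_oscIntegral_sq_le θ y

lemma IsCubeTestFunction.lintegral_sqrt_averagedSpectrum_le (hU : IsCubeTestFunction p U)
    (θ : 𝓢(Rn n, ℂ)) :
    ∫⁻ z, (∫⁻ y in unitCube n, ∫⁻ τ, averagedSpectrum U θ (z + y) τ) ^ (1 / 2 : ℝ) ≤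
      ((∫⁻ s : Rn n, ENNReal.ofReal (((1 + ‖s‖) ^ (n + 1))⁻¹)) *
        ENNReal.ofReal ((2 * Real.pi) ^ n)) ^ (1 / 2 : ℝ) *
      ((∫⁻ s : Rn n, ENNReal.ofReal (((1 + ‖s‖) ^ (n + 1))⁻¹)) *
        (ENNReal.ofReal ((1 + 2 * n) ^ (n + 1)) *
          ∫⁻ u, ‖θ u‖ₑ ^ 2 * ENNReal.ofReal ((1 + ‖u‖) ^ (n + 1)))) ^ (1 / 2 : ℝ) := by
  set Ω := ∫⁻ s : Rn n, ENNReal.ofReal (((1 + ‖s‖) ^ (n + 1))⁻¹)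
  set P := ENNReal.ofReal ((2 * Real.pi) ^ n)
  have hΩP : Ω * P ≠ ∞ :=
    ENNReal.mul_ne_top (lintegral_one_add_norm_pow_inv_lt_top _ (by simp)).ne ENNReal.ofReal_ne_top
  have := θ.continuous.measurable
  calc ∫⁻ z, (∫⁻ y in unitCube n, ∫⁻ τ, averagedSpectrum U θ (z + y) τ) ^ (1 / 2 : ℝ)
      ≤ ∫⁻ z, (∫⁻ y in unitCube n, Ω * P *
          ∫⁻ x in unitCube n, ‖θ (p + x - (z + y))‖ₑ ^ 2) ^ (1 / 2 : ℝ) := by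
        simp only [mul_assoc]
        gcongr with z y
        exact hU.lintegral_averagedSpectrum_le θ (z + y)
    _ = (Ω * P) ^ (1 / 2 : ℝ) * ∫⁻ z, (∫⁻ y in unitCube n,
          ∫⁻ x in unitCube n, ‖θ (p + x - (z + y))‖ₑ ^ 2) ^ (1 / 2 : ℝ) := by
        rw [← lintegral_const_mul' _ _ (ENNReal.rpow_ne_top_of_nonneg (by norm_num) hΩP)]
        refine lintegral_congr fun z => ?_
        rw [lintegral_const_mul' _ _ hΩP, ENNReal.mul_rpow_of_nonneg _ _ (by norm_num)]
    _ ≤ _ := by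
        gcongr
        exact lintegral_sqrt_setLIntegral_translate_le measurableSet_unitCube volume_unitCube
          (fun _ => norm_le_of_mem_unitCube) (g := fun x => ‖θ x‖ₑ ^ 2) (by fun_prop) p (n + 1)

lemma IsLPGenerator.exists_enorm_oscIntegral_le_averagedSpectrum {φ : 𝓢(Rn n, ℂ)}
    (hφ : IsLPGenerator φ) : ∃ C : ℝ≥0, ∀ (p : Rn n) (U : Rn n → ℂ), IsCubeTestFunction p U →
      ∀ (θ : 𝓢(Rn n, ℂ)) (y ζ e : Rn n), ‖e‖ ≤ 2 * n →
        ‖oscIntegral (fun x => U x * θ (x - y)) (ζ + e)‖ₑ ^ 2 ≤ C * averagedSpectrum U θ y ζ := by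
  obtain ⟨C, hC⟩ := exists_enorm_oscIntegral_add_sq_le (dyadicDilate n φ) (2 * n)
  refine ⟨C, fun p U hU θ y ζ e he => hC _ p
    (hU.isBoundedMeasurable.integrable_mul (θ.integrable.comp_sub_right y)) (fun x hx => ?_) ζ e he⟩
  refine hφ.dyadicDilate_eq_one ?_
  exact (norm_le_of_mem_unitCube (hU.sub_mem x (left_ne_zero_of_mul hx))).trans
    (by exact_mod_cast Nat.lt_two_pow_self.le)

lemma exists_lintegral_sqrt_averagedSpectrum_dyadicDilate_le (φ : 𝓢(Rn n, ℂ)) :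
    ∃ C : ℝ≥0, ∀ (k : ℕ) (p : Rn n) (U : Rn n → ℂ), IsCubeTestFunction p U →
      ∫⁻ z, (∫⁻ y in unitCube n, ∫⁻ τ,
        averagedSpectrum U (schwartzCheck (dyadicDilate k φ)) (z + y) τ) ^ (1 / 2 : ℝ) ≤
      C * ((2 : ℝ≥0∞) ^ (n * k)) ^ (1 / 2 : ℝ) := by
  set Ω := ∫⁻ s : Rn n, ENNReal.ofReal (((1 + ‖s‖) ^ (n + 1))⁻¹)
  set P := ENNReal.ofReal ((2 * Real.pi) ^ n)
  set R := ENNReal.ofReal ((1 + 2 * n) ^ (n + 1))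
  set E := ∫⁻ s, ‖schwartzCheck φ s‖ₑ ^ 2 * ENNReal.ofReal ((1 + ‖s‖) ^ (n + 1))
  have hΩ : Ω ≠ ∞ := (lintegral_one_add_norm_pow_inv_lt_top _ (by simp)).ne
  have hE : E ≠ ∞ := (lintegral_schwartz_sq_mul_pow_lt_top volume _ (n + 1)).ne
  have hC : (Ω * P) ^ (1 / 2 : ℝ) * (Ω * (R * E)) ^ (1 / 2 : ℝ) ≠ ∞ := by finiteness
  refine ⟨((Ω * P) ^ (1 / 2 : ℝ) * (Ω * (R * E)) ^ (1 / 2 : ℝ)).toNNReal, fun k p U hU => ?_⟩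
  rw [ENNReal.coe_toNNReal hC]
  calc _ ≤ (Ω * P) ^ (1 / 2 : ℝ) * (Ω * (R * ((2 : ℝ≥0∞) ^ (n * k) * E))) ^ (1 / 2 : ℝ) := by
        refine (hU.lintegral_sqrt_averagedSpectrum_le _).trans ?_
        gcongr
        rw [← ofReal_two_pow_pow]
        exact lintegral_schwartzCheck_dyadicDilate_sq_mul_pow_le φ k (n + 1)
    _ = _ := by
        rw [show Ω * (R * ((2 : ℝ≥0∞) ^ (n * k) * E)) = Ω * (R * E) * (2 : ℝ≥0∞) ^ (n * k) by ring,
          ENNReal.mul_rpow_of_nonneg (Ω * (R * E)) _ (by norm_num), mul_assoc]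

end CubeTestFunctions

section BandLimitedSymbols

/-- The symbol `F` has its partial Fourier transforms supported at frequencies `≲ 2 ^ k`, expressed
by the convolution identities with dilates of `φ̌`. -/
structure IsBandLimited (φ : 𝓢(Rn n, ℂ)) (k : ℕ × ℕ × ℕ) (F : Phase n → ℂ) : Prop
    extends IsBoundedMeasurable F where
  reproducing₀ (ξ η : Rn n) :
    IsReproducedBy volume (schwartzCheck (dyadicDilate (k.1 + 1) φ)) fun x => F (x, ξ, η)
  reproducing₁ (x η : Rn n) :
    IsReproducedBy volume (schwartzCheck (dyadicDilate (k.2.1 + 1) φ)) fun ξ => F (x, ξ, η)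
  reproducing₂ (x ξ : Rn n) :
    IsReproducedBy volume (schwartzCheck (dyadicDilate (k.2.2 + 1) φ)) fun η => F (x, ξ, η)

/-- The uniformly local `L²` norm with the supremum taken over all translates of the unit cube
instead of the lattice ones. -/
def translateL2Norm (F : Phase n → ℂ) : ℝ≥0∞ :=
  ⨆ Z, (∫⁻ Y in phaseCube n, ‖F (Z + Y)‖ₑ ^ 2) ^ (1 / 2 : ℝ)

lemma setLIntegral_le_translateL2Norm_sq (F : Phase n → ℂ) (Z : Phase n) :
    ∫⁻ Y in phaseCube n, ‖F (Z + Y)‖ₑ ^ 2 ≤ translateL2Norm F ^ 2 := by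
  rw [← rpow_half_sq (∫⁻ Y in phaseCube n, ‖F (Z + Y)‖ₑ ^ 2)]
  gcongr
  exact le_iSup (fun Z => (∫⁻ Y in phaseCube n, ‖F (Z + Y)‖ₑ ^ 2) ^ (1 / 2 : ℝ)) Z

/-- A pair of weights for the weighted Cauchy–Schwarz inequality
`(∫ f(ξ) g(τ - ξ) dξ)² ≤ D ∫ w(ξ) f(ξ)² v(τ - ξ) g(τ - ξ)² dξ`. -/
structure IsModerateWeightPair (K : ℕ) (w v : Rn n → ℝ≥0∞) (D : ℝ≥0∞) : Prop where
  left : IsModerateWeight K w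
  right : IsModerateWeight K v
  lintegral_inv_mul_inv_le : ∀ τ, ∫⁻ ξ, (w ξ)⁻¹ * (v (τ - ξ))⁻¹ ≤ D

variable {φ : 𝓢(Rn n, ℂ)} {F : Phase n → ℂ} {a b : Rn n → ℂ}

lemma isBoundedMeasurable_bilinearFourierOp (hF : IsBoundedMeasurable F) (ham : Measurable a)
    (hbm : Measurable b) (ha : Integrable a) (hb : Integrable b) :
    IsBoundedMeasurable (bilinearFourierOp F a b) := by
  obtain ⟨A, hA⟩ := hF.exists_bound
  have := hF.measurable
  have hm : Measurable fun q : Rn n × Rn n × Rn n =>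
      (Circle.exp (inner ℝ q.1 (q.2.1 + q.2.2)) : ℂ) * F q * a q.2.1 * b q.2.2 := by
    fun_prop
  refine ⟨(StronglyMeasurable.integral_prod_right' hm.stronglyMeasurable).measurable,
    ∫ q : Rn n × Rn n, A * ‖a q.1 * b q.2‖, fun x => ?_⟩
  refine norm_integral_le_of_norm_le ((ha.mul_prod hb).norm.const_mul A) (.of_forall fun q => ?_)
  rw [norm_mul, norm_mul, norm_mul, Circle.norm_coe, one_mul, mul_assoc, norm_mul]
  gcongr
  exact hA _

lemma exists_enorm_integral_mul_bilinearFourierOp_le (hφ : IsLPGenerator φ) :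
    ∃ C : ℝ≥0, ∀ (k : ℕ × ℕ × ℕ) (F : Phase n → ℂ) (a b : Rn n → ℂ) (p : Rn n) (U : Rn n → ℂ)
      (K : ℕ) (w v : Rn n → ℝ≥0∞) (D : ℝ≥0∞), IsBandLimited φ k F →
      Measurable a → Measurable b → Integrable a → Integrable b → IsCubeTestFunction p U →
      IsModerateWeightPair K w v D →
      ‖∫ x, U x * bilinearFourierOp F a b x‖ₑ ≤ translateL2Norm F *
        (((∫⁻ ξ, w ξ * ∫⁻ x in unitCube n, ‖a (ξ + x)‖ₑ ^ 2) *
          ∫⁻ η, v η * ∫⁻ x in unitCube n, ‖b (η + x)‖ₑ ^ 2) ^ (1 / 2 : ℝ) * D ^ (1 / 2 : ℝ)) *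
            (C * ((2 : ℝ≥0∞) ^ (n * (k.1 + 1))) ^ (1 / 2 : ℝ)) := by
  obtain ⟨C₁, hC₁⟩ := hφ.exists_enorm_oscIntegral_le_averagedSpectrum
  obtain ⟨C₂, hC₂⟩ := exists_lintegral_sqrt_averagedSpectrum_dyadicDilate_le φ
  have hC : (C₁ : ℝ≥0∞) ^ (1 / 2 : ℝ) * C₂ ≠ ∞ := by finiteness
  refine ⟨((C₁ : ℝ≥0∞) ^ (1 / 2 : ℝ) * C₂).toNNReal,
    fun k F a b p U K w v D hF ham hbm ha hb hU hwv => ?_⟩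
  rw [ENNReal.coe_toNNReal hC]
  set θ := schwartzCheck (dyadicDilate (k.1 + 1) φ)
  have hθ := θ.continuous.measurable
  have hcube (x₁ x₂ : Rn n) (h₁ : x₁ ∈ unitCube n) (h₂ : x₂ ∈ unitCube n) :
      ‖x₁ + x₂‖ ≤ 2 * n := by
    linarith [norm_add_le x₁ x₂, norm_le_of_mem_unitCube h₁, norm_le_of_mem_unitCube h₂]
  refine (enorm_integral_mul_bilinearFourierOp_le hF.toIsBoundedMeasurable _ hF.reproducing₀
    hU.measurable hU.integrable ham hbm ha hb).trans ((lintegral_trilinear_le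
      (g := fun y ζ => ‖oscIntegral (fun x => U x * θ (x - y)) ζ‖ₑ)
      (Γ := fun y ζ => C₁ * averagedSpectrum U θ y ζ) measurableSet_unitCube volume_unitCube
      hF.measurable.enorm (measurable_oscIntegral_mul_translate hU.measurable hθ).enorm
      ((measurable_averagedSpectrum hU.measurable hθ).const_mul _) ham.enorm hbm.enorm
      hwv.left.toIsWeight hwv.right.toIsWeight hwv.lintegral_inv_mul_inv_le
      (setLIntegral_le_translateL2Norm_sq F)
      fun y ζ x₁ h₁ x₂ h₂ => hC₁ p U hU θ y ζ _ (hcube x₁ x₂ h₁ h₂)).trans ?_)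
  gcongr
  simp only [lintegral_const_mul' _ _ ENNReal.coe_ne_top]
  simp only [ENNReal.mul_rpow_of_nonneg _ _ one_half_pos.le]
  rw [lintegral_const_mul' _ _ (by finiteness), mul_assoc]
  gcongr
  exact hC₂ _ p U hU

lemma IsBandLimited.bilinearFourierOp_localize {k : ℕ × ℕ × ℕ} (hF : IsBandLimited φ k F)
    (hφ : IsLPGenerator φ) (ha : Integrable a) (hb : Integrable b) (p : Rn n) {x : Rn n}
    (hx : x - p ∈ unitCube n) :
    bilinearFourierOp F (localize (dyadicDilate (k.2.1 + 1 + 1 + n) φ) p a)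
      (localize (dyadicDilate (k.2.2 + 1 + 1 + n) φ) p b) x = bilinearFourierOp F a b x :=
  _root_.bilinearFourierOp_localize hF.toIsBoundedMeasurable (hF.reproducing₁ x)
    (hF.reproducing₂ x) (hφ.dyadicDilate_mul_dyadicDilate _ hx)
    (hφ.dyadicDilate_mul_dyadicDilate _ hx) ha hb

lemma exists_setLIntegral_bilinearFourierOp_le (hφ : IsLPGenerator φ) :
    ∃ C : ℝ≥0, ∀ (k : ℕ × ℕ × ℕ) (F : Phase n → ℂ) (a b : Rn n → ℂ) (p : Rn n)
      (K : ℕ) (w v : Rn n → ℝ≥0∞) (D : ℝ≥0∞), IsBandLimited φ k F →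
      Measurable a → Measurable b → Integrable a → Integrable b → IsModerateWeightPair K w v D →
      ∫⁻ x in unitCube n, ‖bilinearFourierOp F a b (p + x)‖ₑ ≤
        C * translateL2Norm F * D ^ (1 / 2 : ℝ) * ((2 : ℝ≥0∞) ^ (n * (k.1 + 1))) ^ (1 / 2 : ℝ) *
          (localWeightNorm (dyadicDilate (k.2.1 + 1 + 1 + n) φ) w a p ^ (1 / 2 : ℝ) *
            localWeightNorm (dyadicDilate (k.2.2 + 1 + 1 + n) φ) v b p ^ (1 / 2 : ℝ)) := by
  obtain ⟨C, hC⟩ := exists_enorm_integral_mul_bilinearFourierOp_le hφ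
  refine ⟨C, fun k F a b p K w v D hF ham hbm ha hb hwv => ?_⟩
  obtain ⟨U, hU, hUF⟩ := exists_isCubeTestFunction_setLIntegral_eq
    (isBoundedMeasurable_bilinearFourierOp hF.toIsBoundedMeasurable ham hbm ha hb) p
  set a' := localize (dyadicDilate (k.2.1 + 1 + 1 + n) φ) p a
  set b' := localize (dyadicDilate (k.2.2 + 1 + 1 + n) φ) p b
  have ha'm : Measurable a' := (measurable_localize _ ham).comp (f := fun ξ => (p, ξ)) (by fun_prop)
  have hb'm : Measurable b' := (measurable_localize _ hbm).comp (f := fun ξ => (p, ξ)) (by fun_prop)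
  have hlocal (x : Rn n) :
      U x * bilinearFourierOp F a b x = U x * bilinearFourierOp F a' b' x := by
    by_cases hx : U x = 0
    · rw [hx, zero_mul, zero_mul]
    · rw [hF.bilinearFourierOp_localize hφ ha hb p (hU.sub_mem x hx)]
  calc ∫⁻ x in unitCube n, ‖bilinearFourierOp F a b (p + x)‖ₑ
      = ‖∫ x, U x * bilinearFourierOp F a' b' x‖ₑ := by simp only [hUF, hlocal]
    _ ≤ translateL2Norm F *
          ((localWeightNorm _ w a p * localWeightNorm _ v b p) ^ (1 / 2 : ℝ) * D ^ (1 / 2 : ℝ)) *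
            (C * ((2 : ℝ≥0∞) ^ (n * (k.1 + 1))) ^ (1 / 2 : ℝ)) :=
        hC k F a' b' p U K w v D hF ha'm hb'm (integrable_localize _ p ha)
          (integrable_localize _ p hb) hU hwv
    _ = _ := by
        rw [ENNReal.mul_rpow_of_nonneg _ _ one_half_pos.le]
        ring

/-- A bounded integrable function; the bound holds everywhere, not just almost everywhere. -/
structure IsBoundedIntegrable (a : Rn n → ℂ) : Prop extends IsBoundedMeasurable a where
  integrable : Integrable a

lemma exists_lintegral_localWeightNorm_le (φ : 𝓢(Rn n, ℂ)) (K : ℕ) :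
    ∃ R : ℝ≥0, ∀ (i : ℕ) (w : Rn n → ℝ≥0∞) (a : Rn n → ℂ), IsModerateWeight K w →
      IsBoundedMeasurable a → ∫⁻ p, localWeightNorm (dyadicDilate (i + 1 + 1 + n) φ) w a p ≤
        R * (2 : ℝ≥0∞) ^ (n * i) * ∫⁻ ξ, w ξ * ‖a ξ‖ₑ ^ 2 := by
  set E := ∫⁻ s, ‖schwartzCheck φ s‖ₑ ^ 2 * ENNReal.ofReal ((1 + ‖s‖) ^ K)
  set P := ENNReal.ofReal ((1 + n) ^ K) * ENNReal.ofReal ((2 * Real.pi) ^ n)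
  have hE : E ≠ ∞ := (lintegral_schwartz_sq_mul_pow_lt_top volume _ K).ne
  have hR : P * (2 : ℝ≥0∞) ^ (n * (2 + n)) * E ≠ ∞ := by finiteness
  refine ⟨(P * (2 : ℝ≥0∞) ^ (n * (2 + n)) * E).toNNReal, fun i w a hw ha => ?_⟩
  rw [ENNReal.coe_toNNReal hR]
  calc _ ≤ ENNReal.ofReal ((1 + n) ^ K) * (ENNReal.ofReal ((2 * Real.pi) ^ n) *
        (((2 : ℝ≥0∞) ^ (n * (i + 1 + 1 + n)) * E) * ∫⁻ ξ, w ξ * ‖a ξ‖ₑ ^ 2)) := by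
        refine (lintegral_localWeightNorm_le _ ha hw).trans ?_
        gcongr
        rw [← ofReal_two_pow_pow]
        exact lintegral_schwartzCheck_dyadicDilate_sq_mul_pow_le φ (i + 1 + 1 + n) K
    _ = _ := by ring

lemma exists_lintegral_bilinearFourierOp_le (hφ : IsLPGenerator φ) (K : ℕ) :
    ∃ C : ℝ≥0, ∀ (k : ℕ × ℕ × ℕ) (F : Phase n → ℂ) (D : ℝ≥0∞) (a b : Rn n → ℂ)
      (w v : Rn n → ℝ≥0∞), IsBandLimited φ k F → IsBoundedIntegrable a → IsBoundedIntegrable b →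
      IsModerateWeightPair K w v D →
      ∫⁻ x, ‖bilinearFourierOp F a b x‖ₑ ≤
        C * ((2 : ℝ≥0∞) ^ (n * (k.1 + k.2.1 + k.2.2))) ^ (1 / 2 : ℝ) * translateL2Norm F *
          D ^ (1 / 2 : ℝ) *
            ((∫⁻ ξ, w ξ * ‖a ξ‖ₑ ^ 2) * ∫⁻ η, v η * ‖b η‖ₑ ^ 2) ^ (1 / 2 : ℝ) := by
  obtain ⟨C, hC⟩ := exists_setLIntegral_bilinearFourierOp_le hφ
  obtain ⟨R, hR⟩ := exists_lintegral_localWeightNorm_le φ K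
  have hfin : (C * ((2 : ℝ≥0∞) ^ n) ^ (1 / 2 : ℝ) * R : ℝ≥0∞) ≠ ∞ := by finiteness
  refine ⟨(C * ((2 : ℝ≥0∞) ^ n) ^ (1 / 2 : ℝ) * R).toNNReal,
    fun k F D a b w v hF ha hb hwv => ?_⟩
  rw [ENNReal.coe_toNNReal hfin]
  set X := localWeightNorm (dyadicDilate (k.2.1 + 1 + 1 + n) φ) w a
  set Y := localWeightNorm (dyadicDilate (k.2.2 + 1 + 1 + n) φ) v b
  set A := C * translateL2Norm F * D ^ (1 / 2 : ℝ) *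
    ((2 : ℝ≥0∞) ^ (n * (k.1 + 1))) ^ (1 / 2 : ℝ) with hA
  have hX : Measurable X := measurable_localWeightNorm _ hwv.left.measurable ha.measurable
  have hY : Measurable Y := measurable_localWeightNorm _ hwv.right.measurable hb.measurable
  have hop := isBoundedMeasurable_bilinearFourierOp hF.toIsBoundedMeasurable ha.measurable
    hb.measurable ha.integrable hb.integrable
  calc ∫⁻ x, ‖bilinearFourierOp F a b x‖ₑ
      = ∫⁻ p, ∫⁻ x in unitCube n, ‖bilinearFourierOp F a b (p + x)‖ₑ :=
        lintegral_eq_lintegral_lintegral_translate volume_unitCube hop.measurable.enorm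
    _ ≤ ∫⁻ p, A * (X p ^ (1 / 2 : ℝ) * Y p ^ (1 / 2 : ℝ)) :=
        lintegral_mono fun p => hC k F a b p K w v D hF ha.measurable hb.measurable ha.integrable
          hb.integrable hwv
    _ ≤ A * ((∫⁻ p, X p) ^ (1 / 2 : ℝ) * (∫⁻ p, Y p) ^ (1 / 2 : ℝ)) := by
        rw [lintegral_const_mul _ (by fun_prop)]
        gcongr
        refine (lintegral_mul_le_sqrt (by fun_prop) (by fun_prop)).trans_eq ?_
        simp only [rpow_half_sq]
    _ ≤ A * ((R * (2 : ℝ≥0∞) ^ (n * k.2.1) * ∫⁻ ξ, w ξ * ‖a ξ‖ₑ ^ 2) ^ (1 / 2 : ℝ) *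
          (R * (2 : ℝ≥0∞) ^ (n * k.2.2) * ∫⁻ η, v η * ‖b η‖ₑ ^ 2) ^ (1 / 2 : ℝ)) := by
        gcongr
        · exact hR _ w a hwv.left ha.toIsBoundedMeasurable
        · exact hR _ v b hwv.right hb.toIsBoundedMeasurable
    _ = _ := by
        have hRR : (R : ℝ≥0∞) ^ (1 / 2 : ℝ) * (R : ℝ≥0∞) ^ (1 / 2 : ℝ) = R := by
          rw [← sq, rpow_half_sq]
        rw [hA, show n * (k.1 + k.2.1 + k.2.2) = n * k.1 + n * k.2.1 + n * k.2.2 by ring,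
          mul_add_one, pow_add, pow_add, pow_add]
        simp only [ENNReal.mul_rpow_of_nonneg _ _ one_half_pos.le]
        conv_rhs => rw [← hRR]
        ring

end BandLimitedSymbols

section LittlewoodPaleyPieces

variable {V : Type*} [NormedAddCommGroup V] [NormedSpace ℝ V] {φ : 𝓢(V, ℂ)} {k : ℕ} {x : V}

/-- The Littlewood–Paley partition of unity `lpPiece φ` as a sequence of Schwartz functions. -/
def lpSchwartz (φ : 𝓢(V, ℂ)) : ℕ → 𝓢(V, ℂ)
  | 0 => dyadicDilate 0 φ
  | k + 1 => dyadicDilate (k + 1) φ - dyadicDilate k φ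

lemma lpSchwartz_apply (φ : 𝓢(V, ℂ)) (k : ℕ) (x : V) : lpSchwartz φ k x = lpPiece φ k x := by
  cases k with
  | zero => simp [lpSchwartz, lpPiece, dyadicDilate_apply]
  | succ k =>
    have h : (2 : ℝ) • ((2 : ℝ) ^ (k + 1))⁻¹ • x = ((2 : ℝ) ^ k)⁻¹ • x := by
      rw [smul_smul, pow_succ, mul_inv_rev, mul_inv_cancel_left₀ two_ne_zero]
    simp [lpSchwartz, lpPiece, dyadicDilate_apply, h]

lemma continuous_lpPiece (φ : 𝓢(V, ℂ)) (k : ℕ) : Continuous (lpPiece φ k) :=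
  (lpSchwartz φ k).continuous.congr (lpSchwartz_apply φ k)

lemma sum_lpSchwartz (φ : 𝓢(V, ℂ)) (K : ℕ) :
    ∑ k ∈ Finset.range (K + 1), lpSchwartz φ k = dyadicDilate K φ := by
  induction K with
  | zero => simp [lpSchwartz]
  | succ K ih => rw [Finset.sum_range_succ, ih, lpSchwartz, add_sub_cancel]

lemma sum_lpPiece (φ : 𝓢(V, ℂ)) (K : ℕ) (x : V) :
    ∑ k ∈ Finset.range (K + 1), lpPiece φ k x = φ (((2 : ℝ) ^ K)⁻¹ • x) := by
  simp only [← lpSchwartz_apply, ← dyadicDilate_apply, ← sum_lpSchwartz, sum_apply]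

lemma exists_norm_lpPiece_le (φ : 𝓢(V, ℂ)) : ∃ M, ∀ k x, ‖lpPiece φ k x‖ ≤ M := by
  obtain ⟨M, hM⟩ := φ.decay 0 0
  replace hM (x : V) : ‖φ x‖ ≤ M := by simpa using hM.2 x
  refine ⟨M + M, fun k x => ?_⟩
  unfold lpPiece
  split_ifs
  · linarith [hM x, norm_nonneg (φ x)]
  · exact norm_sub_le_of_le (hM _) (hM _)

lemma IsLPGenerator.norm_le_of_lpPiece_ne_zero (hφ : IsLPGenerator φ) (hx : lpPiece φ k x ≠ 0) :
    ‖x‖ ≤ 2 ^ (k + 1) := by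
  rw [← lpSchwartz_apply] at hx
  cases k with
  | zero => exact hφ.norm_le_of_dyadicDilate_ne_zero hx
  | succ k =>
    by_contra! h
    refine hx (sub_eq_zero_of_eq ?_)
    have h₁ : dyadicDilate (k + 1) φ x = 0 :=
      by_contra fun h₁ => h.not_ge (hφ.norm_le_of_dyadicDilate_ne_zero h₁)
    have h₂ : dyadicDilate k φ x = 0 := by
      by_contra h₂
      refine h.not_ge ((hφ.norm_le_of_dyadicDilate_ne_zero h₂).trans ?_)
      gcongr <;> norm_num
    exact h₁.trans h₂.symm

lemma IsLPGenerator.two_pow_lt_norm_of_lpPiece_ne_zero (hφ : IsLPGenerator φ)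
    (hx : lpPiece φ (k + 1) x ≠ 0) : 2 ^ k < ‖x‖ := by
  rw [← lpSchwartz_apply] at hx
  by_contra! h
  refine hx (sub_eq_zero_of_eq ?_)
  exact (hφ.dyadicDilate_eq_one (h.trans (by gcongr <;> norm_num))).trans
    (hφ.dyadicDilate_eq_one h).symm

lemma IsLPGenerator.dyadicDilate_mul_lpSchwartz (hφ : IsLPGenerator φ) (k : ℕ) (x : V) :
    dyadicDilate (k + 1) φ x * lpSchwartz φ k x = lpSchwartz φ k x := by
  by_cases h : lpSchwartz φ k x = 0
  · simp [h]
  · rw [lpSchwartz_apply] at h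
    rw [hφ.dyadicDilate_eq_one (hφ.norm_le_of_lpPiece_ne_zero h), one_mul]

end LittlewoodPaleyPieces

section FrequencyBlocks

lemma schwartzCheck_sum {ι : Type*} (s : Finset ι) (u : ι → 𝓢(Rn n, ℂ)) :
    schwartzCheck (∑ k ∈ s, u k) = ∑ k ∈ s, schwartzCheck (u k) := by
  ext x
  simp only [sum_apply, schwartzCheck_eq_integral, Finset.mul_sum]
  rw [integral_finsetSum _ fun k _ =>
    (isBoundedMeasurable_exp (by fun_prop)).integrable_mul (u k).integrable, Finset.mul_sum]

/-- The convolution kernel `ǔ₀ ⊗ ǔ₁ ⊗ ǔ₂` on the phase space. -/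
def tensorCheck (u₀ u₁ u₂ : 𝓢(Rn n, ℂ)) (Y : Phase n) : ℂ :=
  schwartzCheck u₀ Y.1 * schwartzCheck u₁ Y.2.1 * schwartzCheck u₂ Y.2.2

variable (u₀ u₁ u₂ : 𝓢(Rn n, ℂ)) {φ : 𝓢(Rn n, ℂ)} {τ T : Phase n → ℂ}

lemma continuous_tensorCheck : Continuous (tensorCheck u₀ u₁ u₂) := by
  unfold tensorCheck; fun_prop

lemma integrable_tensorCheck : Integrable (tensorCheck u₀ u₁ u₂) :=
  ((schwartzCheck u₀).integrable.mul_prod ((schwartzCheck u₁).integrable.mul_prod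
    (schwartzCheck u₂).integrable)).congr (.of_forall fun _ => (mul_assoc _ _ _).symm)

lemma deltaBlock_eq (φ : 𝓢(Rn n, ℂ)) (k : ℕ × ℕ × ℕ) (τ : Phase n → ℂ) (X : Phase n) :
    deltaBlock φ k τ X = ∫ Y, tensorCheck (lpSchwartz φ k.1) (lpSchwartz φ k.2.1)
      (lpSchwartz φ k.2.2) Y * τ (X - Y) := by
  have h (k : ℕ) : ⇑(lpSchwartz φ k) = lpPiece φ k := funext (lpSchwartz_apply φ k)
  simp only [deltaBlock, tensorCheck, schwartzCheck_apply, h]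

lemma integrable_mul_comp_const_sub (hT : Integrable T) (hτ : IsBoundedMeasurable τ) (X : Phase n) :
    Integrable fun Y => T Y * τ (X - Y) := by
  simpa only [mul_comm] using (hτ.comp (g := fun Y => X - Y) (by fun_prop)).integrable_mul hT

lemma isBoundedMeasurable_convolution (hT : Integrable T) (hTm : Measurable T)
    (hτ : IsBoundedMeasurable τ) : IsBoundedMeasurable fun X => ∫ Y, T Y * τ (X - Y) := by
  obtain ⟨A, hA⟩ := hτ.exists_bound
  have := hτ.measurable
  have hm : Measurable fun q : Phase n × Phase n => T q.2 * τ (q.1 - q.2) := by fun_prop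
  refine ⟨(StronglyMeasurable.integral_prod_right' hm.stronglyMeasurable).measurable,
    ∫ Y, ‖T Y‖ * A, fun X => ?_⟩
  refine norm_integral_le_of_norm_le (hT.norm.mul_const A) (.of_forall fun Y => ?_)
  rw [norm_mul]
  gcongr
  exact hA _

lemma convolution_eq_integral_convolution (hT : Integrable T) {g : Rn n → ℂ} (hg : Integrable g)
    (hτ : IsBoundedMeasurable τ) {ι : Rn n → Phase n} (hι : Measurable ι)
    (h : ∀ Y, ∫ y, g y * T (Y - ι y) = T Y) (X : Phase n) :
    ∫ Y, T Y * τ (X - Y) = ∫ y, g y * ∫ Y, T Y * τ (X - ι y - Y) := by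
  have hint : Integrable (Function.uncurry fun (Y : Phase n) (y : Rn n) =>
      τ (X - Y) * (T (Y - ι y) * g y)) ((volume : Measure (Phase n)).prod volume) := by
    have hmp : MeasurePreserving (fun q : Rn n × Phase n => (q.1, q.2 - ι q.1))
        ((volume : Measure (Rn n)).prod volume) ((volume : Measure (Rn n)).prod volume) :=
      (MeasurePreserving.id _).skew_product (g := fun y Y => Y - ι y)
        (by unfold Function.uncurry; fun_prop)
        (.of_forall fun y => (measurePreserving_sub_right volume (ι y)).map_eq)
    exact (hτ.comp (g := fun q : Phase n × Rn n => X - q.1) (by fun_prop)).integrable_mul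
      ((hmp.integrable_comp_of_integrable (hg.mul_prod hT)).swap.congr
        (.of_forall fun q => mul_comm _ _))
  calc ∫ Y, T Y * τ (X - Y)
      = ∫ Y, ∫ y, τ (X - Y) * (T (Y - ι y) * g y) := by
        congr 1 with Y
        rw [integral_const_mul, ← h Y, mul_comm]
        simp only [mul_comm]
    _ = ∫ y, ∫ Y, τ (X - Y) * (T (Y - ι y) * g y) := integral_integral_swap hint
    _ = ∫ y, g y * ∫ Y, T Y * τ (X - ι y - Y) := by
        congr 1 with y
        rw [← integral_add_right_eq_self _ (ι y), ← integral_const_mul]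
        congr 1 with Y
        rw [add_sub_cancel_right, sub_sub, add_comm (ι y)]
        ring

lemma isBandLimited_deltaBlock (hφ : IsLPGenerator φ) (k : ℕ × ℕ × ℕ)
    (hτ : IsBoundedMeasurable τ) : IsBandLimited φ k (deltaBlock φ k τ) := by
  have hT := integrable_tensorCheck (lpSchwartz φ k.1) (lpSchwartz φ k.2.1) (lpSchwartz φ k.2.2)
  have hTm := (continuous_tensorCheck (lpSchwartz φ k.1) (lpSchwartz φ k.2.1)
    (lpSchwartz φ k.2.2)).measurable
  have hrep (i : ℕ) (x : Rn n) : ∫ y, schwartzCheck (dyadicDilate (i + 1) φ) y *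
      schwartzCheck (lpSchwartz φ i) (x - y) = schwartzCheck (lpSchwartz φ i) x :=
    schwartzCheck_reproducing _ _ _ (hφ.dyadicDilate_mul_lpSchwartz i)
  have hconv (i : ℕ) {ι : Rn n → Phase n} (hι : Measurable ι) :=
    convolution_eq_integral_convolution hT (schwartzCheck (dyadicDilate (i + 1) φ)).integrable hτ hι
  have hbdd : IsBoundedMeasurable (deltaBlock φ k τ) := by
    simpa only [← deltaBlock_eq] using isBoundedMeasurable_convolution hT hTm hτ
  refine ⟨hbdd, fun ξ η x => ?_, fun x η ξ => ?_, fun x ξ η => ?_⟩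
  · simp only [deltaBlock_eq]
    refine (hconv k.1 (ι := fun y => (y, 0, 0)) (by fun_prop) (fun Y => ?_) (x, ξ, η)).trans ?_
    · simp only [tensorCheck, Prod.fst_sub, Prod.snd_sub, sub_zero, ← mul_assoc]
      rw [integral_mul_const, integral_mul_const, hrep]
    · simp only [Prod.mk_sub_mk, sub_zero]
  · simp only [deltaBlock_eq]
    refine (hconv k.2.1 (ι := fun y => (0, y, 0)) (by fun_prop) (fun Y => ?_) (x, ξ, η)).trans ?_
    · simp only [tensorCheck, Prod.fst_sub, Prod.snd_sub, sub_zero, ← mul_assoc,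
        mul_right_comm _ (schwartzCheck (lpSchwartz φ k.1) Y.1)]
      rw [integral_mul_const, integral_mul_const, hrep]
      ring
    · simp only [Prod.mk_sub_mk, sub_zero]
  · simp only [deltaBlock_eq]
    refine (hconv k.2.2 (ι := fun y => (0, 0, y)) (by fun_prop) (fun Y => ?_) (x, ξ, η)).trans ?_
    · simp only [tensorCheck, Prod.fst_sub, Prod.snd_sub, sub_zero,
        mul_left_comm _ (_ * schwartzCheck (lpSchwartz φ k.2.1) Y.2.1)]
      rw [integral_const_mul, hrep]
    · simp only [Prod.mk_sub_mk, sub_zero]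

lemma sum_deltaBlock (φ : 𝓢(Rn n, ℂ)) (hτ : IsBoundedMeasurable τ) (K : ℕ) (X : Phase n) :
    ∑ k ∈ Finset.range (K + 1) ×ˢ Finset.range (K + 1) ×ˢ Finset.range (K + 1),
        deltaBlock φ k τ X =
      ∫ Y, tensorCheck (dyadicDilate K φ) (dyadicDilate K φ) (dyadicDilate K φ) Y * τ (X - Y) := by
  simp only [deltaBlock_eq]
  rw [← integral_finsetSum _ fun k _ =>
    integrable_mul_comp_const_sub (integrable_tensorCheck _ _ _) hτ X]
  congr 1 with Y
  rw [← Finset.sum_mul]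
  congr 1
  simp only [tensorCheck, ← sum_lpSchwartz φ K, schwartzCheck_sum, sum_apply,
    Finset.sum_product, ← Finset.mul_sum, ← Finset.sum_mul]

end FrequencyBlocks

section ApproximateIdentity

open Filter Topology

variable {V : Type*} [NormedAddCommGroup V] [NormedSpace ℝ V] [FiniteDimensional ℝ V]
  [MeasurableSpace V] [BorelSpace V] {μ : Measure V} [μ.IsAddHaarMeasure] {W T τ : V → ℂ}

lemma continuous_integral_mul_comp_sub (hW : Integrable W μ) (hτ : IsBoundedMeasurable τ) :
    Continuous fun h => ∫ x, W x * τ (x - h) ∂μ := by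
  obtain ⟨A, hA⟩ := hτ.exists_bound
  have hτ' : MemLp τ ∞ μ := memLp_top_of_bound hτ.measurable.aestronglyMeasurable A (.of_forall hA)
  have hW' := memLp_one_iff_integrable.2 hW
  have : Fact ((1 : ℝ≥0∞) ≠ ∞) := ⟨ENNReal.one_ne_top⟩
  have hcont : Continuous fun h : V => (ContinuousLinearMap.mul ℂ ℂ).lpPairing μ 1 ∞
      (DomAddAct.mk h +ᵥ hW'.toLp W) (hτ'.toLp τ) := by
    have : Continuous fun h : V => DomAddAct.mk h +ᵥ hW'.toLp W :=
      DomAddAct.continuous_mk.vadd continuous_const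
    fun_prop
  refine hcont.congr fun h => ?_
  rw [ContinuousLinearMap.lpPairing_eq_integral, DomAddAct.mk_vadd_toLp,
    ← integral_add_right_eq_self (fun x => W x * τ (x - h)) h]
  refine integral_congr_ae ?_
  filter_upwards [(hW'.comp_measurePreserving (measurePreserving_vadd h μ)).coeFn_toLp,
    hτ'.coeFn_toLp] with x hWx hτx
  refine (congrArg₂ (· * ·) hWx hτx).trans ?_
  rw [Function.comp_apply, vadd_eq_add, add_sub_cancel_right, add_comm]

lemma tendsto_integral_mul_convolution_smul (hW : Integrable W μ) (hT : Integrable T μ)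
    (hT₁ : ∫ y, T y ∂μ = 1) (hτ : IsBoundedMeasurable τ) {r : ℕ → ℝ} (hr : Tendsto r atTop (𝓝 0)) :
    Tendsto (fun K => ∫ x, W x * ∫ y, T y * τ (x - r K • y) ∂μ ∂μ) atTop
      (𝓝 (∫ x, W x * τ x ∂μ)) := by
  obtain ⟨A, hA⟩ := hτ.exists_bound
  have hint (K : ℕ) : Integrable (Function.uncurry fun x y => W x * (T y * τ (x - r K • y)))
      (μ.prod μ) :=
    ((hτ.comp (g := fun q : V × V => q.1 - r K • q.2) (by fun_prop)).integrable_mul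
      (hW.mul_prod hT)).congr (.of_forall fun q => by simp only [Function.uncurry]; ring)
  have hswap (K : ℕ) : ∫ x, W x * ∫ y, T y * τ (x - r K • y) ∂μ ∂μ =
      ∫ y, T y * ∫ x, W x * τ (x - r K • y) ∂μ ∂μ := by
    simp only [← integral_const_mul]
    rw [integral_integral_swap (hint K)]
    simp only [mul_left_comm]
  have hlim : ∫ x, W x * τ x ∂μ = ∫ y, T y * ∫ x, W x * τ x ∂μ ∂μ := by
    rw [integral_mul_const, hT₁, one_mul]
  simp only [hswap]
  rw [hlim]
  refine tendsto_integral_of_dominated_convergence (fun y => ‖T y‖ * ∫ x, ‖W x‖ * A ∂μ)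
    (fun K => ?_) (hT.norm.mul_const _) (fun K => .of_forall fun y => ?_) (.of_forall fun y => ?_)
  · have := (continuous_integral_mul_comp_sub hW hτ).comp (continuous_const_smul (r K))
    exact hT.aestronglyMeasurable.mul this.aestronglyMeasurable
  · rw [norm_mul]
    gcongr
    refine norm_integral_le_of_norm_le (hW.norm.mul_const A) (.of_forall fun x => ?_)
    rw [norm_mul]
    gcongr
    exact hA _
  · have := ((continuous_integral_mul_comp_sub hW hτ).tendsto (0 : V)).comp
      (by simpa using hr.smul_const y)
    simpa only [sub_zero, Function.comp_def] using this.const_mul (T y)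

end ApproximateIdentity

section Reconstruction

open Filter Topology

variable {φ : 𝓢(Rn n, ℂ)} {W τ : Phase n → ℂ}

lemma IsLPGenerator.integral_tensorCheck (hφ : IsLPGenerator φ) :
    ∫ Y, tensorCheck φ φ φ Y = 1 := by
  have h₁ : ∫ x, schwartzCheck φ x = 1 := by
    simpa [hφ.eq_one 0 (by simp)] using integral_exp_mul_schwartzCheck φ 0
  simp only [tensorCheck, mul_assoc]
  have h₂ : ∫ p : Rn n × Rn n, schwartzCheck φ p.1 * schwartzCheck φ p.2 = 1 := by
    rw [Measure.volume_eq_prod, integral_prod_mul (fun x => schwartzCheck φ x)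
      (fun x => schwartzCheck φ x), h₁, one_mul]
  rw [Measure.volume_eq_prod, integral_prod_mul (fun x => schwartzCheck φ x)
      (fun p : Rn n × Rn n => schwartzCheck φ p.1 * schwartzCheck φ p.2), h₁, h₂, one_mul]

lemma integral_tensorCheck_dyadicDilate_mul (φ : 𝓢(Rn n, ℂ)) (K : ℕ) (τ : Phase n → ℂ) :
    ∫ Y, tensorCheck (dyadicDilate K φ) (dyadicDilate K φ) (dyadicDilate K φ) Y * τ Y =
      ∫ Y, tensorCheck φ φ φ Y * τ (((2 : ℝ) ^ K)⁻¹ • Y) := by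
  have hcov := Measure.integral_comp_smul (volume : Measure (Phase n))
    (fun Y => tensorCheck φ φ φ Y * τ (((2 : ℝ) ^ K)⁻¹ • Y)) ((2 : ℝ) ^ K)
  have hne : ((2 : ℂ) ^ K) ^ (n + (n + n)) ≠ 0 := by simp
  simp only [Module.finrank_prod, finrank_euclideanSpace_fin] at hcov
  rw [abs_of_pos (by positivity), Complex.real_smul, eq_comm] at hcov
  push_cast at hcov
  rw [inv_mul_eq_iff_eq_mul₀ hne, ← integral_const_mul] at hcov
  rw [hcov]
  congr 1 with Y
  rw [inv_smul_smul₀ (by positivity)]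
  simp only [tensorCheck, schwartzCheck_dyadicDilate, Prod.smul_fst, Prod.smul_snd]
  ring

lemma tendsto_integral_mul_sum_deltaBlock (hφ : IsLPGenerator φ) (hW : Integrable W)
    (hτ : IsBoundedMeasurable τ) :
    Tendsto (fun K => ∫ X, W X * ∑ k ∈ Finset.range (K + 1) ×ˢ Finset.range (K + 1) ×ˢ
      Finset.range (K + 1), deltaBlock φ k τ X) atTop (𝓝 (∫ X, W X * τ X)) := by
  have hr : Tendsto (fun K : ℕ => ((2 : ℝ) ^ K)⁻¹) atTop (𝓝 0) := by
    simpa only [inv_pow] using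
      tendsto_pow_atTop_nhds_zero_of_lt_one (r := (2 : ℝ)⁻¹) (by norm_num) (by norm_num)
  simp only [sum_deltaBlock φ hτ, integral_tensorCheck_dyadicDilate_mul φ _ fun Y => τ (_ - Y)]
  exact tendsto_integral_mul_convolution_smul hW (integrable_tensorCheck φ φ φ)
    hφ.integral_tensorCheck hτ hr

end Reconstruction

section LatticeTranslates

/-- The lattice points whose unit cubes may meet the unit cube centred at `z`. -/
def nearLattice (z : Rn n) : Finset (Fin n → ℤ) :=
  Fintype.piFinset fun i => Finset.Icc (⌊z i + 1 / 2⌋ - 1) (⌊z i + 1 / 2⌋ + 1)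

lemma card_nearLattice (z : Rn n) : (nearLattice z).card = 3 ^ n := by
  have h (m : ℤ) : m + 1 + 1 - (m - 1) = 3 := by ring
  simp [nearLattice, h]

lemma exists_mem_nearLattice (z : Rn n) {y : Rn n} (hy : y ∈ unitCube n) :
    ∃ ν ∈ nearLattice z, z + y - latticePoint ν ∈ unitCube n := by
  refine ⟨fun i => ⌊z i + y i + 1 / 2⌋, Fintype.mem_piFinset.2 fun i => ?_, fun i => ?_⟩
  · have hle := Int.floor_le (z i + 1 / 2)
    have hlt := Int.lt_floor_add_one (z i + 1 / 2)
    rw [Finset.mem_Icc, Int.le_floor, ← Int.lt_add_one_iff, Int.floor_lt]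
    push_cast
    constructor <;> linarith [(hy i).1, (hy i).2]
  · have hle := Int.floor_le (z i + y i + 1 / 2)
    have hlt := Int.lt_floor_add_one (z i + y i + 1 / 2)
    simp only [latticePoint, PiLp.sub_apply, PiLp.add_apply, Set.mem_Ico]
    constructor <;> linarith

lemma phaseCube_subset_iUnion_nearLattice (Z : Phase n) :
    phaseCube n ⊆ ⋃ ν ∈ nearLattice Z.1 ×ˢ nearLattice Z.2.1 ×ˢ nearLattice Z.2.2,
      (fun Y => Z - (latticePoint ν.1, latticePoint ν.2.1, latticePoint ν.2.2) + Y) ⁻¹'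
        phaseCube n := by
  intro Y hY
  obtain ⟨ν₀, hν₀, h₀⟩ := exists_mem_nearLattice Z.1 hY.1
  obtain ⟨ν₁, hν₁, h₁⟩ := exists_mem_nearLattice Z.2.1 hY.2.1
  obtain ⟨ν₂, hν₂, h₂⟩ := exists_mem_nearLattice Z.2.2 hY.2.2
  simp only [Set.mem_iUnion, Set.mem_preimage, sub_add_eq_add_sub]
  exact ⟨(ν₀, ν₁, ν₂), Finset.mk_mem_product hν₀ (Finset.mk_mem_product hν₁ hν₂), h₀, h₁, h₂⟩

lemma setLIntegral_biUnion_finset_le {α ι : Type*} [MeasurableSpace α] {μ : Measure α}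
    (N : Finset ι) (S : ι → Set α) (f : α → ℝ≥0∞) :
    ∫⁻ x in ⋃ i ∈ N, S i, f x ∂μ ≤ ∑ i ∈ N, ∫⁻ x in S i, f x ∂μ := by
  rw [← Finset.set_biUnion_coe, Set.biUnion_eq_iUnion, ← Finset.tsum_subtype]
  exact lintegral_iUnion_le _ _

lemma translateL2Norm_le_normL2ul (F : Phase n → ℂ) :
    translateL2Norm F ≤ ((27 : ℝ≥0∞) ^ n) ^ (1 / 2 : ℝ) * normL2ul F := by
  refine iSup_le fun Z => ?_
  set N := nearLattice Z.1 ×ˢ nearLattice Z.2.1 ×ˢ nearLattice Z.2.2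
  have hcard : (N.card : ℝ≥0∞) = 27 ^ n := by
    simp only [N, Finset.card_product, card_nearLattice, ← mul_pow]
    norm_num
  have hlattice (ν : (Fin n → ℤ) × (Fin n → ℤ) × (Fin n → ℤ)) :
      ∫⁻ X in phaseCube n, ‖F (X + (latticePoint ν.1, latticePoint ν.2.1, latticePoint ν.2.2))‖ₑ ^ 2
        ≤ normL2ul F ^ 2 := by
    rw [← rpow_half_sq (∫⁻ X in phaseCube n, _)]
    gcongr
    exact le_iSup (fun ν : (Fin n → ℤ) × (Fin n → ℤ) × (Fin n → ℤ) => (∫⁻ X in phaseCube n,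
      ‖F (X + (latticePoint ν.1, latticePoint ν.2.1, latticePoint ν.2.2))‖ₑ ^ 2) ^ (1 / 2 : ℝ)) ν
  have hcover : ∫⁻ Y in phaseCube n, ‖F (Z + Y)‖ₑ ^ 2 ≤ 27 ^ n * normL2ul F ^ 2 := by
    refine (lintegral_mono_set (phaseCube_subset_iUnion_nearLattice Z)).trans ?_
    refine (setLIntegral_biUnion_finset_le N _ _).trans ?_
    rw [← hcard, ← nsmul_eq_mul]
    refine Finset.sum_le_card_nsmul _ _ _ fun ν _ => (le_of_eq ?_).trans (hlattice ν)
    set q : Phase n := (latticePoint ν.1, latticePoint ν.2.1, latticePoint ν.2.2)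
    have h := (measurePreserving_add_left volume (Z - q)).setLIntegral_comp_preimage_emb
      (measurableEmbedding_addLeft _) (fun X => ‖F (X + q)‖ₑ ^ 2) (phaseCube n)
    simpa only [sub_add_eq_add_sub, sub_add_cancel, add_sub_cancel_right] using h
  calc (∫⁻ Y in phaseCube n, ‖F (Z + Y)‖ₑ ^ 2) ^ (1 / 2 : ℝ)
      ≤ (27 ^ n * normL2ul F ^ 2) ^ (1 / 2 : ℝ) := by gcongr
    _ = (27 ^ n) ^ (1 / 2 : ℝ) * normL2ul F := by
        rw [ENNReal.mul_rpow_of_nonneg _ _ one_half_pos.le, sq_rpow_half]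

end LatticeTranslates

section BlockNorm

/-- The norm at a single dyadic scale of the symbol class: the sum of the `L²_ul` norms of the
Littlewood–Paley blocks of `τ`, weighted with the critical exponents `s₀ = s₁ = s₂ = n/2`. -/
def blockNorm (φ : 𝓢(Rn n, ℂ)) (τ : Phase n → ℂ) : ℝ≥0∞ :=
  ∑' k : ℕ × ℕ × ℕ, ((2 : ℝ≥0∞) ^ (n * (k.1 + k.2.1 + k.2.2))) ^ (1 / 2 : ℝ) *
    normL2ul (deltaBlock φ k τ)

/-- The integral kernel of the trilinear form `(U, a, b) ↦ ∫ U · bilinearFourierOp F a b`, which is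
linear in the symbol `F`. -/
def trilinearKernel (U a b : Rn n → ℂ) (X : Phase n) : ℂ :=
  Circle.exp (inner ℝ X.1 (X.2.1 + X.2.2)) * (U X.1 * (a X.2.1 * b X.2.2))

lemma integrable_trilinearKernel {U a b : Rn n → ℂ} (hU : Integrable U) (ha : Integrable a)
    (hb : Integrable b) : Integrable (trilinearKernel U a b) :=
  (isBoundedMeasurable_exp (by fun_prop)).integrable_mul (hU.mul_prod (ha.mul_prod hb))

lemma integral_mul_bilinearFourierOp {F : Phase n → ℂ} (hF : IsBoundedMeasurable F)
    {U a b : Rn n → ℂ} (hU : Integrable U) (ha : Integrable a) (hb : Integrable b) :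
    ∫ x, U x * bilinearFourierOp F a b x = ∫ X, trilinearKernel U a b X * F X := by
  have hint : Integrable (fun X => trilinearKernel U a b X * F X)
      ((volume : Measure (Rn n)).prod volume) := by
    simpa only [mul_comm (trilinearKernel U a b _), ← Measure.volume_eq_prod] using
      hF.integrable_mul (integrable_trilinearKernel hU ha hb)
  rw [Measure.volume_eq_prod (Rn n) (Rn n × Rn n), integral_prod _ hint]
  congr 1 with x
  rw [bilinearFourierOp, ← integral_const_mul]
  simp only [trilinearKernel, mul_assoc, mul_comm, mul_left_comm]

lemma enorm_integral_mul_le_tsum_deltaBlock {φ : 𝓢(Rn n, ℂ)} (hφ : IsLPGenerator φ)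
    {W τ : Phase n → ℂ} (hW : Integrable W) (hτ : IsBoundedMeasurable τ) :
    ‖∫ X, W X * τ X‖ₑ ≤ ∑' k, ‖∫ X, W X * deltaBlock φ k τ X‖ₑ := by
  refine le_of_tendsto (tendsto_integral_mul_sum_deltaBlock hφ hW hτ).enorm (.of_forall fun K => ?_)
  have hint (k : ℕ × ℕ × ℕ) : Integrable fun X => W X * deltaBlock φ k τ X := by
    simpa only [mul_comm] using (isBandLimited_deltaBlock hφ k hτ).integrable_mul hW
  simp only [Finset.mul_sum]
  rw [integral_finsetSum _ fun k _ => hint k]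
  exact (enorm_sum_le _ _).trans (ENNReal.sum_le_tsum _)

lemma enorm_integral_mul_le_lintegral_enorm {α : Type*} [MeasurableSpace α] {μ : Measure α}
    {U : α → ℂ} (hU : ∀ x, ‖U x‖ ≤ 1) (g : α → ℂ) :
    ‖∫ x, U x * g x ∂μ‖ₑ ≤ ∫⁻ x, ‖g x‖ₑ ∂μ := by
  refine (enorm_integral_le_lintegral_enorm _).trans (lintegral_mono fun x => ?_)
  rw [enorm_mul, ← ofReal_norm (U x)]
  exact mul_le_of_le_one_left' (ENNReal.ofReal_le_one.2 (hU x))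

lemma setLIntegral_bilinearFourierOp_le_tsum {φ : 𝓢(Rn n, ℂ)} (hφ : IsLPGenerator φ)
    {τ : Phase n → ℂ} (hτ : IsBoundedMeasurable τ) {a b : Rn n → ℂ} (ha : IsBoundedIntegrable a)
    (hb : IsBoundedIntegrable b) {S : Set (Rn n)} (hS : MeasurableSet S) (hS' : volume S ≠ ∞) :
    ∫⁻ x in S, ‖bilinearFourierOp τ a b x‖ₑ ≤
      ∑' k, ∫⁻ x, ‖bilinearFourierOp (deltaBlock φ k τ) a b x‖ₑ := by
  have hg := isBoundedMeasurable_bilinearFourierOp hτ ha.measurable hb.measurable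
    ha.integrable hb.integrable
  obtain ⟨U, hUm, hUS, hU⟩ := exists_lintegral_enorm_eq_enorm_integral hg hS hS'
  have hU_int : Integrable U :=
    ((integrable_indicator_iff hS).2 (integrableOn_const hS')).mono' hUm.aestronglyMeasurable
      (.of_forall hUS)
  have hU_le (x : Rn n) : ‖U x‖ ≤ 1 :=
    (hUS x).trans (Set.indicator_le_self' (fun _ _ => zero_le_one) x)
  rw [hU, integral_mul_bilinearFourierOp hτ hU_int ha.integrable hb.integrable]
  refine (enorm_integral_mul_le_tsum_deltaBlock hφ
    (integrable_trilinearKernel hU_int ha.integrable hb.integrable) hτ).trans ?_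
  gcongr with k
  rw [← integral_mul_bilinearFourierOp (isBandLimited_deltaBlock hφ k hτ).toIsBoundedMeasurable
    hU_int ha.integrable hb.integrable]
  exact enorm_integral_mul_le_lintegral_enorm hU_le _

lemma lintegral_le_of_forall_setLIntegral_ball_le {E : Type*} [PseudoMetricSpace E]
    [MeasurableSpace E] {μ : Measure E} (x : E) {f : E → ℝ≥0∞} {C : ℝ≥0∞}
    (h : ∀ R : ℕ, ∫⁻ y in Metric.ball x R, f y ∂μ ≤ C) : ∫⁻ y, f y ∂μ ≤ C := by
  have hmono : Monotone fun R : ℕ => Metric.ball x R := fun i j hij =>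
    Metric.ball_subset_ball (Nat.cast_le.2 hij)
  rw [← setLIntegral_univ, ← Metric.iUnion_ball_nat x,
    setLIntegral_iUnion_of_directed _ hmono.directed_le]
  exact iSup_le h

lemma lintegral_bilinearFourierOp_le_tsum_deltaBlock {φ : 𝓢(Rn n, ℂ)} (hφ : IsLPGenerator φ)
    {τ : Phase n → ℂ} (hτ : IsBoundedMeasurable τ) {a b : Rn n → ℂ} (ha : IsBoundedIntegrable a)
    (hb : IsBoundedIntegrable b) :
    ∫⁻ x, ‖bilinearFourierOp τ a b x‖ₑ ≤
      ∑' k, ∫⁻ x, ‖bilinearFourierOp (deltaBlock φ k τ) a b x‖ₑ :=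
  lintegral_le_of_forall_setLIntegral_ball_le 0 fun _ =>
    setLIntegral_bilinearFourierOp_le_tsum hφ hτ ha hb measurableSet_ball measure_ball_lt_top.ne

lemma exists_lintegral_bilinearFourierOp_le_blockNorm {φ : 𝓢(Rn n, ℂ)} (hφ : IsLPGenerator φ)
    (K : ℕ) : ∃ C : ℝ≥0, ∀ (τ : Phase n → ℂ) (D : ℝ≥0∞) (a b : Rn n → ℂ) (w v : Rn n → ℝ≥0∞),
      IsBoundedMeasurable τ → IsBoundedIntegrable a → IsBoundedIntegrable b →
      IsModerateWeightPair K w v D →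
      ∫⁻ x, ‖bilinearFourierOp τ a b x‖ₑ ≤ C * blockNorm φ τ * D ^ (1 / 2 : ℝ) *
        ((∫⁻ ξ, w ξ * ‖a ξ‖ₑ ^ 2) * ∫⁻ η, v η * ‖b η‖ₑ ^ 2) ^ (1 / 2 : ℝ) := by
  obtain ⟨C, hC⟩ := exists_lintegral_bilinearFourierOp_le hφ K
  have hfin : ((27 : ℝ≥0∞) ^ n) ^ (1 / 2 : ℝ) ≠ ∞ := by finiteness
  refine ⟨C * (((27 : ℝ≥0∞) ^ n) ^ (1 / 2 : ℝ)).toNNReal, fun τ D a b w v hτ ha hb hwv => ?_⟩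
  rw [ENNReal.coe_mul, ENNReal.coe_toNNReal hfin]
  set V := ((∫⁻ ξ, w ξ * ‖a ξ‖ₑ ^ 2) * ∫⁻ η, v η * ‖b η‖ₑ ^ 2) ^ (1 / 2 : ℝ)
  have hblock (k : ℕ × ℕ × ℕ) : ∫⁻ x, ‖bilinearFourierOp (deltaBlock φ k τ) a b x‖ₑ ≤
      (C * ((27 : ℝ≥0∞) ^ n) ^ (1 / 2 : ℝ) * D ^ (1 / 2 : ℝ) * V) *
        (((2 : ℝ≥0∞) ^ (n * (k.1 + k.2.1 + k.2.2))) ^ (1 / 2 : ℝ) *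
          normL2ul (deltaBlock φ k τ)) := by
    refine (hC k _ D a b w v (isBandLimited_deltaBlock hφ k hτ) ha hb hwv).trans ?_
    grw [translateL2Norm_le_normL2ul (deltaBlock φ k τ)]
    exact le_of_eq (by ring)
  refine (lintegral_bilinearFourierOp_le_tsum_deltaBlock hφ hτ ha hb).trans
    ((ENNReal.tsum_le_tsum hblock).trans_eq ?_)
  rw [ENNReal.tsum_mul_left, ← blockNorm]
  ring

end BlockNorm

section Rescaling

/-- The symbol rescaled by `r⁻¹` in space and by `r` in frequency. -/
def rescaleSymbol (r : ℝ) (F : Phase n → ℂ) (X : Phase n) : ℂ :=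
  F (r⁻¹ • X.1, r • X.2.1, r • X.2.2)

lemma IsBoundedMeasurable.rescaleSymbol {F : Phase n → ℂ} (hF : IsBoundedMeasurable F) (r : ℝ) :
    IsBoundedMeasurable (rescaleSymbol r F) :=
  hF.comp (g := fun X : Phase n => (r⁻¹ • X.1, r • X.2.1, r • X.2.2)) (by fun_prop)

lemma IsBoundedIntegrable.comp_smul {a : Rn n → ℂ} (ha : IsBoundedIntegrable a) {r : ℝ}
    (hr : r ≠ 0) : IsBoundedIntegrable fun ξ => a (r • ξ) where
  toIsBoundedMeasurable := ha.toIsBoundedMeasurable.comp (measurable_const_smul r)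
  integrable := ha.integrable.comp_smul hr

lemma IsBoundedIntegrable.indicator {a : Rn n → ℂ} (ha : IsBoundedIntegrable a) {S : Set (Rn n)}
    (hS : MeasurableSet S) : IsBoundedIntegrable (S.indicator a) where
  measurable := ha.measurable.indicator hS
  integrable := ha.integrable.indicator hS
  exists_bound := ha.exists_bound.imp fun _ hA ξ => (norm_indicator_le_norm_self a ξ).trans (hA ξ)

variable {F : Phase n → ℂ} {a b : Rn n → ℂ} {r : ℝ}

lemma bilinearFourierOp_inv_smul (F : Phase n → ℂ) (a b : Rn n → ℂ) (hr : 0 < r) (x : Rn n) :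
    bilinearFourierOp F a b (r⁻¹ • x) = ((r ^ (2 * n) : ℝ) : ℂ) *
      bilinearFourierOp (rescaleSymbol r F) (fun ξ => a (r • ξ)) (fun η => b (r • η)) x := by
  have hscale := Measure.integral_comp_smul (volume : Measure (Rn n × Rn n))
    (fun p => Circle.exp (inner ℝ (r⁻¹ • x) (p.1 + p.2)) * F (r⁻¹ • x, p.1, p.2) * a p.1 * b p.2) r
  have hdim : Module.finrank ℝ (Rn n × Rn n) = 2 * n := by
    rw [Module.finrank_prod, finrank_euclideanSpace_fin, two_mul]
  have hphase (p : Rn n × Rn n) :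
      inner ℝ (r⁻¹ • x) (r • p.1 + r • p.2) = inner ℝ x (p.1 + p.2) := by
    rw [← smul_add, real_inner_smul_left, real_inner_smul_right, inv_mul_cancel_left₀ hr.ne']
  have hr' : ((r ^ (2 * n) : ℝ) : ℂ) ≠ 0 := Complex.ofReal_ne_zero.2 (pow_pos hr _).ne'
  rw [hdim, abs_of_pos (by positivity), Complex.real_smul, Complex.ofReal_inv,
    eq_inv_mul_iff_mul_eq₀ hr'] at hscale
  simp only [Prod.smul_fst, Prod.smul_snd, hphase] at hscale
  exact hscale.symm

lemma lintegral_enorm_bilinearFourierOp_rescaleSymbol (hF : IsBoundedMeasurable F)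
    (ha : IsBoundedIntegrable a) (hb : IsBoundedIntegrable b) (hr : 0 < r) :
    ∫⁻ x, ‖bilinearFourierOp F a b x‖ₑ = ENNReal.ofReal (r ^ n) *
      ∫⁻ x, ‖bilinearFourierOp (rescaleSymbol r F) (fun ξ => a (r • ξ)) (fun η => b (r • η)) x‖ₑ
        := by
  have hrn : 0 < r ^ n := pow_pos hr n
  have hg := isBoundedMeasurable_bilinearFourierOp hF ha.measurable hb.measurable
    ha.integrable hb.integrable
  have hspace := lintegral_comp_smul volume hg.measurable.enorm (inv_pos.2 hr).ne'
  have hfactor : ‖((r ^ (2 * n) : ℝ) : ℂ)‖ₑ = ENNReal.ofReal (r ^ n) * ENNReal.ofReal (r ^ n) := by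
    rw [← ofReal_norm, Complex.norm_real, Real.norm_of_nonneg (by positivity),
      ← ENNReal.ofReal_mul hrn.le, ← pow_add, two_mul]
  simp only [bilinearFourierOp_inv_smul F a b hr, enorm_mul, hfactor,
    finrank_euclideanSpace_fin, inv_pow, inv_inv, abs_of_pos hrn] at hspace
  rw [lintegral_const_mul' _ _ (by finiteness), mul_assoc] at hspace
  exact ((ENNReal.mul_right_inj (ENNReal.ofReal_pos.2 hrn).ne' ENNReal.ofReal_ne_top).1 hspace).symm

lemma lintegral_mul_enorm_comp_smul_sq {w : Rn n → ℝ≥0∞} (hw : Measurable w) (ha : Measurable a)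
    (hr : 0 < r) :
    ENNReal.ofReal (r ^ n) * ∫⁻ ξ, w ξ * ‖a (r • ξ)‖ₑ ^ 2 = ∫⁻ ξ, w (r⁻¹ • ξ) * ‖a ξ‖ₑ ^ 2 := by
  have hrn : 0 < r ^ n := pow_pos hr n
  have hscale := lintegral_comp_smul volume (f := fun ξ => w (r⁻¹ • ξ) * ‖a ξ‖ₑ ^ 2)
    (by fun_prop) hr.ne'
  simp only [inv_smul_smul₀ hr.ne', finrank_euclideanSpace_fin, abs_of_pos (inv_pos.2 hrn)]
    at hscale
  rw [hscale, ← mul_assoc, ← ENNReal.ofReal_mul hrn.le, mul_inv_cancel₀ hrn.ne', ENNReal.ofReal_one,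
    one_mul]

lemma exists_lintegral_bilinearFourierOp_le_rescaleSymbol {φ : 𝓢(Rn n, ℂ)} (hφ : IsLPGenerator φ)
    (K : ℕ) : ∃ C : ℝ≥0,
      ∀ (F : Phase n → ℂ) (D : ℝ≥0∞) (a b : Rn n → ℂ) (w v : Rn n → ℝ≥0∞) (r : ℝ),
      IsBoundedMeasurable F → IsBoundedIntegrable a → IsBoundedIntegrable b →
      IsModerateWeightPair K w v D → 0 < r →
      ∫⁻ x, ‖bilinearFourierOp F a b x‖ₑ ≤ C * blockNorm φ (rescaleSymbol r F) * D ^ (1 / 2 : ℝ) *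
        ((∫⁻ ξ, w (r⁻¹ • ξ) * ‖a ξ‖ₑ ^ 2) * ∫⁻ η, v (r⁻¹ • η) * ‖b η‖ₑ ^ 2) ^ (1 / 2 : ℝ) := by
  obtain ⟨C, hC⟩ := exists_lintegral_bilinearFourierOp_le_blockNorm hφ K
  refine ⟨C, fun F D a b w v r hF ha hb hwv hr => ?_⟩
  rw [lintegral_enorm_bilinearFourierOp_rescaleSymbol hF ha hb hr,
    ← lintegral_mul_enorm_comp_smul_sq hwv.left.measurable ha.measurable hr,
    ← lintegral_mul_enorm_comp_smul_sq hwv.right.measurable hb.measurable hr,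
    mul_mul_mul_comm (ENNReal.ofReal (r ^ n)), ← sq,
    ENNReal.mul_rpow_of_nonneg _ _ one_half_pos.le, sq_rpow_half, mul_left_comm]
  gcongr
  exact hC _ D _ _ w v (hF.rescaleSymbol r) (ha.comp_smul hr.ne') (hb.comp_smul hr.ne') hwv

end Rescaling

section ScaleWeight

/-- A moderate weight of scale `N`: on the ball of radius `N` it is bounded and comparable to
`√((1 + ‖ξ‖) / N)`, while the integral of its inverse is still of the order `N ^ n`. -/
def scaleWeight (N : ℝ) (ξ : Rn n) : ℝ≥0∞ :=
  ENNReal.ofReal (√((1 + ‖ξ‖) / N) * (1 + ‖ξ‖ / N) ^ (n + 1))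

lemma measurable_scaleWeight (N : ℝ) : Measurable (scaleWeight (n := n) N) := by
  unfold scaleWeight
  fun_prop

lemma isModerateWeight_one {E : Type*} [NormedAddCommGroup E] [MeasurableSpace E] (K : ℕ) :
    IsModerateWeight K (fun _ : E => (1 : ℝ≥0∞)) where
  measurable := measurable_const
  ne_zero _ := one_ne_zero
  ne_top _ := ENNReal.one_ne_top
  moderate _ s := by
    rw [mul_one, ENNReal.one_le_ofReal]
    exact one_le_pow₀ (le_add_of_nonneg_right (norm_nonneg s))

lemma one_add_norm_sub_div_le {E : Type*} [SeminormedAddGroup E] {N : ℝ} (hN : 1 ≤ N) (ξ s : E) :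
    1 + ‖ξ - s‖ / N ≤ (1 + ‖s‖) * (1 + ‖ξ‖ / N) := by
  have : 0 < N := one_pos.trans_le hN
  have hdiv : ‖ξ - s‖ / N ≤ ‖ξ‖ / N + ‖s‖ := by
    grw [norm_sub_le, add_div, div_le_self (norm_nonneg s) hN]
  have hmul : 0 ≤ ‖s‖ * (‖ξ‖ / N) := by positivity
  linarith

lemma isModerateWeight_scaleWeight {N : ℝ} (hN : 1 ≤ N) :
    IsModerateWeight (n + 2) (scaleWeight (n := n) N) where
  measurable := measurable_scaleWeight N
  ne_zero _ := by
    have : 0 < N := one_pos.trans_le hN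
    exact (ENNReal.ofReal_pos.2 (by positivity)).ne'
  ne_top _ := ENNReal.ofReal_ne_top
  moderate ξ s := by
    have : 0 < N := one_pos.trans_le hN
    have hsqrt : √((1 + ‖ξ - s‖) / N) ≤ (1 + ‖s‖) * √((1 + ‖ξ‖) / N) := by
      refine Real.sqrt_le_iff.2 ⟨by positivity, ?_⟩
      rw [mul_pow, Real.sq_sqrt (by positivity), ← mul_div_assoc]
      gcongr
      have := one_add_norm_sub_div_le le_rfl ξ s
      simp only [div_one] at this
      exact this.trans (mul_le_mul_of_nonneg_right
        (le_self_pow₀ (le_add_of_nonneg_right (norm_nonneg s)) two_ne_zero) (by positivity))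
    rw [scaleWeight, scaleWeight, ← ENNReal.ofReal_mul (by positivity)]
    refine ENNReal.ofReal_le_ofReal ?_
    calc √((1 + ‖ξ - s‖) / N) * (1 + ‖ξ - s‖ / N) ^ (n + 1)
        ≤ ((1 + ‖s‖) * √((1 + ‖ξ‖) / N)) * ((1 + ‖s‖) * (1 + ‖ξ‖ / N)) ^ (n + 1) := by
          gcongr
          exact one_add_norm_sub_div_le hN ξ s
      _ = _ := by rw [mul_pow]; ring

section InverseIntegral

variable {E : Type*} [NormedAddCommGroup E] [NormedSpace ℝ E] [FiniteDimensional ℝ E]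
  [MeasurableSpace E] [BorelSpace E] (μ : Measure E) [μ.IsAddHaarMeasure] (K : ℕ)

lemma setLIntegral_ball_inv_sqrt_norm_mul_pow_lt_top (hE : 0 < Module.finrank ℝ E) :
    ∫⁻ u in Metric.ball (0 : E) 1, ENNReal.ofReal ((√‖u‖ * (1 + ‖u‖) ^ K)⁻¹) ∂μ < ∞ := by
  have hint : IntegrableOn (fun u : E => (√‖u‖)⁻¹) (Metric.ball 0 1) μ := by
    refine integrableOn_ball_of_norm_le_rpow (C := 1) (α := 1 / 2) hE ?_ (.of_forall fun u => ?_)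
      (Measurable.aestronglyMeasurable (by fun_prop))
    · have : (1 : ℝ) ≤ Module.finrank ℝ E := Nat.one_le_cast.2 hE
      linarith
    · rw [one_mul, Real.norm_of_nonneg (by positivity), Real.rpow_neg (norm_nonneg u),
        ← Real.sqrt_eq_rpow]
  refine (lintegral_mono fun u => ENNReal.ofReal_le_ofReal ?_).trans_lt hint.lintegral_lt_top
  rw [mul_inv]
  exact mul_le_of_le_one_right (by positivity)
    (inv_le_one_of_one_le₀ (one_le_pow₀ (le_add_of_nonneg_right (norm_nonneg u))))

lemma lintegral_inv_sqrt_norm_mul_pow_lt_top (hE : 0 < Module.finrank ℝ E)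
    (hK : Module.finrank ℝ E < K) :
    ∫⁻ u : E, ENNReal.ofReal ((√‖u‖ * (1 + ‖u‖) ^ K)⁻¹) ∂μ < ∞ := by
  rw [← lintegral_add_compl _ (measurableSet_ball (x := (0 : E)) (ε := 1))]
  refine ENNReal.add_lt_top.2 ⟨setLIntegral_ball_inv_sqrt_norm_mul_pow_lt_top μ K hE, ?_⟩
  refine lt_of_le_of_lt ?_ (lintegral_one_add_norm_pow_inv_lt_top μ hK)
  refine (setLIntegral_mono (by fun_prop) fun u hu => ?_).trans (setLIntegral_le_lintegral _ _)
  have hu' : 1 ≤ ‖u‖ := by simpa using hu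
  refine ENNReal.ofReal_le_ofReal (inv_anti₀ (by positivity) ?_)
  exact le_mul_of_one_le_left (by positivity) (Real.one_le_sqrt.2 hu')

end InverseIntegral

lemma exists_lintegral_inv_scaleWeight_le (hn : 0 < n) : ∃ C : ℝ≥0, ∀ N : ℝ, 1 ≤ N →
    ∫⁻ ξ : Rn n, (scaleWeight N ξ)⁻¹ ≤ C * ENNReal.ofReal (N ^ n) := by
  set G : Rn n → ℝ≥0∞ := fun u => ENNReal.ofReal ((√‖u‖ * (1 + ‖u‖) ^ (n + 1))⁻¹)
  have hG : ∫⁻ u, G u < ∞ :=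
    lintegral_inv_sqrt_norm_mul_pow_lt_top volume _ (by simpa using hn) (by simp)
  refine ⟨(∫⁻ u, G u).toNNReal, fun N hN => ?_⟩
  have hN0 : 0 < N := one_pos.trans_le hN
  have hscale := lintegral_comp_smul volume (f := G) (by fun_prop) (inv_pos.2 hN0).ne'
  rw [finrank_euclideanSpace_fin, inv_pow, inv_inv, abs_of_pos (pow_pos hN0 n)] at hscale
  rw [ENNReal.coe_toNNReal hG.ne, mul_comm, ← hscale]
  have : NeZero n := ⟨hn.ne'⟩
  refine lintegral_mono_ae ?_
  filter_upwards [Measure.ae_ne volume (0 : Rn n)] with ξ hξ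
  have : 0 < ‖ξ‖ := norm_pos_iff.2 hξ
  rw [scaleWeight, ← ENNReal.ofReal_inv_of_pos (by positivity)]
  simp only [G, norm_smul, norm_inv, Real.norm_of_nonneg hN0.le, inv_mul_eq_div]
  gcongr
  exact le_add_of_nonneg_left zero_le_one

end ScaleWeight

section SupportSplitting

lemma isModerateWeightPair_scaleWeight_one {C : ℝ≥0∞} {N : ℝ} (hN : 1 ≤ N)
    (hC : ∫⁻ ξ : Rn n, (scaleWeight N ξ)⁻¹ ≤ C) :
    IsModerateWeightPair (n + 2) (scaleWeight (n := n) N) (fun _ => 1) C where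
  left := isModerateWeight_scaleWeight hN
  right := isModerateWeight_one _
  lintegral_inv_mul_inv_le _ := by simpa using hC

lemma isModerateWeightPair_one_scaleWeight {C : ℝ≥0∞} {N : ℝ} (hN : 1 ≤ N)
    (hC : ∫⁻ ξ : Rn n, (scaleWeight N ξ)⁻¹ ≤ C) :
    IsModerateWeightPair (n + 2) (fun _ => 1) (scaleWeight (n := n) N) C where
  left := isModerateWeight_one _
  right := isModerateWeight_scaleWeight hN
  lintegral_inv_mul_inv_le τ := by
    simpa only [inv_one, one_mul, lintegral_sub_left_eq_self fun ξ => (scaleWeight N ξ)⁻¹] using hC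

lemma lintegral_mul_enorm_indicator_sq {α : Type*} [MeasurableSpace α] {μ : Measure α}
    {S : Set α} (hS : MeasurableSet S) (w : α → ℝ≥0∞) (c : α → ℂ) :
    ∫⁻ ξ, w ξ * ‖S.indicator c ξ‖ₑ ^ 2 ∂μ = ∫⁻ ξ in S, w ξ * ‖c ξ‖ₑ ^ 2 ∂μ := by
  rw [← lintegral_indicator hS]
  refine lintegral_congr fun ξ => ?_
  by_cases hξ : ξ ∈ S <;> simp [hξ]

/-- The symbol `F` lives on frequency pairs in `S × S` of which at least one entry lies in `E`. -/
def HasFrequencySupport (F : Phase n → ℂ) (S E : Set (Rn n)) : Prop :=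
  ∀ x ξ η, F (x, ξ, η) ≠ 0 → ξ ∈ S ∧ η ∈ S ∧ (ξ ∈ E ∨ η ∈ E)

variable {F : Phase n → ℂ} {S E : Set (Rn n)} {a b : Rn n → ℂ}

lemma HasFrequencySupport.bilinearFourierOp_eq_add (hsupp : HasFrequencySupport F S E)
    (hF : IsBoundedMeasurable F) (hS : MeasurableSet S) (hE : MeasurableSet E)
    (ha : Integrable a) (hb : Integrable b) (x : Rn n) :
    bilinearFourierOp F a b x = bilinearFourierOp F (S.indicator a) (E.indicator b) x +
      bilinearFourierOp F (E.indicator a) ((S \ E).indicator b) x := by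
  unfold bilinearFourierOp
  rw [← integral_add
    (integrable_bilinearFourierOp_integrand hF (ha.indicator hS) (hb.indicator hE) x)
    (integrable_bilinearFourierOp_integrand hF (ha.indicator hE) (hb.indicator (hS.diff hE)) x)]
  congr 1 with p
  by_cases h : F (x, p.1, p.2) = 0
  · simp [h]
  · obtain ⟨hξS, hηS, hE⟩ := hsupp _ _ _ h
    by_cases hηE : p.2 ∈ E
    · simp [hξS, hηE]
    · simp [hηS, hηE, hE.resolve_right hηE]

lemma HasFrequencySupport.lintegral_enorm_bilinearFourierOp_le (hsupp : HasFrequencySupport F S E)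
    (hF : IsBoundedMeasurable F) (hS : MeasurableSet S) (hE : MeasurableSet E)
    (ha : IsBoundedIntegrable a) (hb : IsBoundedIntegrable b) :
    ∫⁻ x, ‖bilinearFourierOp F a b x‖ₑ ≤
      (∫⁻ x, ‖bilinearFourierOp F (S.indicator a) (E.indicator b) x‖ₑ) +
        ∫⁻ x, ‖bilinearFourierOp F (E.indicator a) ((S \ E).indicator b) x‖ₑ := by
  have haS := ha.indicator hS
  have hbE := hb.indicator hE
  rw [← lintegral_add_left (isBoundedMeasurable_bilinearFourierOp hF haS.measurable hbE.measurable
    haS.integrable hbE.integrable).measurable.enorm]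
  refine lintegral_mono fun x => ?_
  rw [hsupp.bilinearFourierOp_eq_add hF hS hE ha.integrable hb.integrable]
  exact enorm_add_le _ _

lemma exists_lintegral_bilinearFourierOp_le_of_hasFrequencySupport {φ : 𝓢(Rn n, ℂ)}
    (hφ : IsLPGenerator φ) (hn : 0 < n) : ∃ C : ℝ≥0,
    ∀ (F : Phase n → ℂ) (S E : Set (Rn n)) (a b : Rn n → ℂ) (r N : ℝ),
      IsBoundedMeasurable F → MeasurableSet S → MeasurableSet E → HasFrequencySupport F S E →
      IsBoundedIntegrable a → IsBoundedIntegrable b → 0 < r → 1 ≤ N →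
      ∫⁻ x, ‖bilinearFourierOp F a b x‖ₑ ≤
        C * blockNorm φ (rescaleSymbol r F) * ENNReal.ofReal (N ^ n) ^ (1 / 2 : ℝ) *
        (((∫⁻ ξ in S, scaleWeight N (r⁻¹ • ξ) * ‖a ξ‖ₑ ^ 2) *
            ∫⁻ η in E, ‖b η‖ₑ ^ 2) ^ (1 / 2 : ℝ) +
          ((∫⁻ ξ in E, ‖a ξ‖ₑ ^ 2) *
            ∫⁻ η in S, scaleWeight N (r⁻¹ • η) * ‖b η‖ₑ ^ 2) ^ (1 / 2 : ℝ)) := by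
  obtain ⟨C, hC⟩ := exists_lintegral_bilinearFourierOp_le_rescaleSymbol hφ (n + 2)
  obtain ⟨C', hC'⟩ := exists_lintegral_inv_scaleWeight_le hn
  refine ⟨C * C' ^ (1 / 2 : ℝ), fun F S E a b r N hF hS hE hsupp ha hb hr hN => ?_⟩
  have hleft := hC F _ _ _ _ _ r hF (ha.indicator hS) (hb.indicator hE)
    (isModerateWeightPair_scaleWeight_one hN (hC' N hN)) hr
  have hright := hC F _ _ _ _ _ r hF (ha.indicator hE) (hb.indicator (hS.diff hE))
    (isModerateWeightPair_one_scaleWeight hN (hC' N hN)) hr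
  rw [lintegral_mul_enorm_indicator_sq hS, lintegral_mul_enorm_indicator_sq hE] at hleft
  rw [lintegral_mul_enorm_indicator_sq (hS.diff hE), lintegral_mul_enorm_indicator_sq hE] at hright
  simp only [one_mul] at hleft hright
  have hconst : (C : ℝ≥0∞) * blockNorm φ (rescaleSymbol r F) *
      (C' * ENNReal.ofReal (N ^ n)) ^ (1 / 2 : ℝ) = (C * C' ^ (1 / 2 : ℝ) : ℝ≥0) *
      blockNorm φ (rescaleSymbol r F) * ENNReal.ofReal (N ^ n) ^ (1 / 2 : ℝ) := by
    rw [ENNReal.mul_rpow_of_nonneg _ _ one_half_pos.le, ENNReal.coe_mul,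
      ENNReal.coe_rpow_of_nonneg _ one_half_pos.le]
    ring
  rw [← hconst, mul_add]
  refine (hsupp.lintegral_enorm_bilinearFourierOp_le hF hS hE ha hb).trans
    (add_le_add hleft (hright.trans ?_))
  gcongr
  exact Set.sdiff_subset

end SupportSplitting

section DyadicSums

lemma sqrt_div_two_pow_succ_le {t : ℝ} (ht : 0 ≤ t) (j : ℕ) :
    √(t / 2 ^ (j + 1)) ≤ 3 / 4 * √(t / 2 ^ j) := by
  refine Real.sqrt_le_iff.2 ⟨by positivity, ?_⟩
  rw [mul_pow, Real.sq_sqrt (by positivity), pow_succ, ← div_div, div_eq_inv_mul _ (2 : ℝ)]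
  gcongr
  norm_num

lemma sum_sqrt_div_two_pow_le {t : ℝ} (ht : 0 ≤ t) (J : ℕ) :
    ∑ j ∈ Finset.range J, (if t ≤ 2 ^ (j + 1) then √(t / 2 ^ j) else 0) ≤ 8 := by
  -- Truncating at `√2` makes the geometric sequence telescope from the first active index on.
  set h : ℕ → ℝ := fun j => min √(t / 2 ^ j) √2
  have hterm (j : ℕ) : (if t ≤ 2 ^ (j + 1) then √(t / 2 ^ j) else 0) ≤ 4 * (h j - h (j + 1)) := by
    have hratio := sqrt_div_two_pow_succ_le ht j
    split_ifs with hle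
    · have htwo : t / 2 ^ j ≤ 2 := by rwa [div_le_iff₀ (by positivity), mul_comm, ← pow_succ]
      have hj : h j = √(t / 2 ^ j) := min_eq_left (Real.sqrt_le_sqrt htwo)
      have hsucc : h (j + 1) ≤ √(t / 2 ^ (j + 1)) := min_le_left _ _
      linarith
    · have hanti : h (j + 1) ≤ h j :=
        min_le_min_right _ (by linarith [Real.sqrt_nonneg (t / 2 ^ j)])
      linarith
  calc ∑ j ∈ Finset.range J, (if t ≤ 2 ^ (j + 1) then √(t / 2 ^ j) else 0)
      ≤ ∑ j ∈ Finset.range J, 4 * (h j - h (j + 1)) := Finset.sum_le_sum fun j _ => hterm j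
    _ = 4 * (h 0 - h J) := by rw [← Finset.mul_sum, Finset.sum_range_sub']
    _ ≤ 4 * √2 := by
        have hzero : h 0 ≤ √2 := min_le_right _ _
        have hJ : 0 ≤ h J := le_min (Real.sqrt_nonneg _) (Real.sqrt_nonneg _)
        linarith
    _ ≤ 8 := by linarith [Real.sqrt_two_lt_three_halves]

/-- A ball containing both frequencies of the `j`-th dyadic piece. -/
def dyadicBall (n j : ℕ) : Set (Rn n) := {ξ | ‖ξ‖ ≤ 2 ^ (j + 1)}

/-- An annulus containing at least one frequency of the `j`-th dyadic piece; a ball for `j = 0`. -/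
def dyadicAnnulus (n j : ℕ) : Set (Rn n) := {ξ | ‖ξ‖ ≤ 2 ^ (j + 1) ∧ (j = 0 ∨ 2 ^ j ≤ 4 * ‖ξ‖)}

lemma measurableSet_dyadicBall (j : ℕ) : MeasurableSet (dyadicBall n j) :=
  measurableSet_le measurable_norm measurable_const

lemma measurableSet_dyadicAnnulus (j : ℕ) : MeasurableSet (dyadicAnnulus n j) :=
  (measurableSet_le measurable_norm measurable_const).inter
    ((MeasurableSet.const (j = 0)).union
      (measurableSet_le measurable_const (measurable_norm.const_mul 4)))

lemma indicator_dyadicAnnulus_le (ξ : Rn n) (j : ℕ) :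
    (dyadicAnnulus n j).indicator (fun _ => (1 : ℝ≥0∞)) ξ ≤ ENNReal.ofReal
      ((if j = 0 then 1 else 0) + 2 * (if ‖ξ‖ ≤ 2 ^ (j + 1) then √(‖ξ‖ / 2 ^ j) else 0)) := by
  refine Set.indicator_apply_le' (fun hξ => ?_) fun _ => zero_le
  obtain ⟨hball, rfl | hfar⟩ := hξ
  · rw [if_pos rfl, ENNReal.one_le_ofReal]
    exact le_add_of_nonneg_right (by positivity)
  · rw [if_pos hball, ENNReal.one_le_ofReal]
    have hhalf : 1 / 2 ≤ √(‖ξ‖ / 2 ^ j) := by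
      refine Real.le_sqrt_of_sq_le ?_
      rw [le_div_iff₀ (by positivity)]
      linarith
    have : (0 : ℝ) ≤ if j = 0 then 1 else 0 := by positivity
    linarith

lemma sum_indicator_dyadicAnnulus_le (ξ : Rn n) (J : ℕ) :
    ∑ j ∈ Finset.range J, (dyadicAnnulus n j).indicator (fun _ => (1 : ℝ≥0∞)) ξ ≤ 17 := by
  grw [Finset.sum_le_sum fun j _ => indicator_dyadicAnnulus_le ξ j]
  rw [← ENNReal.ofReal_sum_of_nonneg fun j _ => by positivity, Finset.sum_add_distrib,
    ← Finset.mul_sum]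
  refine ENNReal.ofReal_le_of_le_toReal ?_
  have hdyadic := sum_sqrt_div_two_pow_le (norm_nonneg ξ) J
  have hfirst : ∑ j ∈ Finset.range J, (if j = 0 then (1 : ℝ) else 0) ≤ 1 := by
    rw [Finset.sum_ite_eq']
    split_ifs <;> norm_num
  rw [ENNReal.toReal_ofNat]
  linarith

lemma scaleWeight_inv_smul_le {r N : ℝ} (hr : 0 < r) (hN : 0 < N) {ξ : Rn n}
    (hξ : ‖ξ‖ ≤ r * N * 2) :
    scaleWeight N (r⁻¹ • ξ) ≤ ENNReal.ofReal ((√N⁻¹ + √(‖ξ‖ / (r * N))) * 3 ^ (n + 1)) := by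
  have hnorm : ‖r⁻¹ • ξ‖ / N = ‖ξ‖ / (r * N) := by
    rw [norm_smul, norm_inv, Real.norm_of_nonneg hr.le, inv_mul_eq_div, div_div]
  have htwo : ‖ξ‖ / (r * N) ≤ 2 := by rwa [div_le_iff₀' (by positivity)]
  have hsqrt : √(N⁻¹ + ‖ξ‖ / (r * N)) ≤ √N⁻¹ + √(‖ξ‖ / (r * N)) := by
    refine Real.sqrt_le_iff.2 ⟨by positivity, ?_⟩
    rw [add_sq, Real.sq_sqrt (by positivity), Real.sq_sqrt (by positivity)]
    have : 0 ≤ 2 * √N⁻¹ * √(‖ξ‖ / (r * N)) := by positivity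
    linarith
  rw [scaleWeight, add_div, hnorm, one_div]
  gcongr
  linarith

lemma exists_sum_indicator_scaleWeight_le {ρ : ℝ} (hρ : ρ < 1) :
    ∃ C : ℝ≥0, ∀ (ξ : Rn n) (J : ℕ), ∑ j ∈ Finset.range J, (dyadicBall n j).indicator (fun ξ =>
      scaleWeight ((2 : ℝ) ^ (j * (1 - ρ))) (((2 : ℝ) ^ (j * ρ))⁻¹ • ξ)) ξ ≤ C := by
  set q : ℝ := (2 : ℝ) ^ (-(1 - ρ) * (1 / 2))
  have hq0 : 0 ≤ q := Real.rpow_nonneg zero_le_two _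
  have hq1 : q < 1 := Real.rpow_lt_one_of_one_lt_of_neg one_lt_two (by linarith)
  have hterm (ξ : Rn n) (j : ℕ) : (dyadicBall n j).indicator (fun ξ =>
      scaleWeight ((2 : ℝ) ^ (j * (1 - ρ))) (((2 : ℝ) ^ (j * ρ))⁻¹ • ξ)) ξ ≤ ENNReal.ofReal
        ((q ^ j + (if ‖ξ‖ ≤ 2 ^ (j + 1) then √(‖ξ‖ / 2 ^ j) else 0)) * 3 ^ (n + 1)) := by
    refine Set.indicator_apply_le' (fun hξ => ?_) fun _ => zero_le
    replace hξ : ‖ξ‖ ≤ 2 ^ (j + 1) := hξ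
    have hrN : (2 : ℝ) ^ (j * ρ) * 2 ^ (j * (1 - ρ)) = 2 ^ j := by
      rw [← Real.rpow_add two_pos, ← mul_add, add_sub_cancel, mul_one, Real.rpow_natCast]
    have hqj : √((2 : ℝ) ^ (j * (1 - ρ)))⁻¹ = q ^ j := by
      rw [Real.sqrt_eq_rpow, ← Real.rpow_neg zero_le_two, ← Real.rpow_mul zero_le_two,
        ← Real.rpow_mul_natCast zero_le_two]
      ring_nf
    have hle := scaleWeight_inv_smul_le (r := (2 : ℝ) ^ (j * ρ)) (N := (2 : ℝ) ^ (j * (1 - ρ)))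
      (by positivity) (by positivity) (ξ := ξ) (by rwa [hrN, ← pow_succ])
    rwa [hrN, hqj, ← if_pos (c := ‖ξ‖ ≤ 2 ^ (j + 1)) hξ (t := √(‖ξ‖ / 2 ^ j)) (e := 0)] at hle
  refine ⟨(((1 - q)⁻¹ + 8) * 3 ^ (n + 1)).toNNReal, fun ξ J => ?_⟩
  grw [Finset.sum_le_sum fun j _ => hterm ξ j]
  rw [← ENNReal.ofReal_sum_of_nonneg fun j _ => by positivity, ← Finset.sum_mul,
    Finset.sum_add_distrib]
  refine ENNReal.ofReal_le_ofReal ?_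
  gcongr
  · rw [← tsum_geometric_of_lt_one hq0 hq1]
    exact (summable_geometric_of_lt_one hq0 hq1).sum_le_tsum _ fun j _ => by positivity
  · exact sum_sqrt_div_two_pow_le (norm_nonneg ξ) J

lemma sum_setLIntegral_mul_le {ι α : Type*} [MeasurableSpace α] {μ : Measure α} {s : Finset ι}
    {S : ι → Set α} (hS : ∀ j, MeasurableSet (S j)) {w : ι → α → ℝ≥0∞} (hw : ∀ j, Measurable (w j))
    {C : ℝ≥0∞} (hC : ∀ ξ, ∑ j ∈ s, (S j).indicator (w j) ξ ≤ C) {h : α → ℝ≥0∞}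
    (hh : Measurable h) :
    ∑ j ∈ s, ∫⁻ ξ in S j, w j ξ * h ξ ∂μ ≤ C * ∫⁻ ξ, h ξ ∂μ := by
  have hterm (j : ι) : ∫⁻ ξ in S j, w j ξ * h ξ ∂μ = ∫⁻ ξ, (S j).indicator (w j) ξ * h ξ ∂μ := by
    rw [← lintegral_indicator (hS j)]
    simp only [← Set.indicator_mul_left]
  have hm (j : ι) : Measurable fun ξ => (S j).indicator (w j) ξ * h ξ :=
    ((hw j).indicator (hS j)).mul hh
  simp only [hterm]
  rw [← lintegral_finsetSum _ fun j _ => hm j, ← lintegral_const_mul _ hh]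
  refine lintegral_mono fun ξ => ?_
  rw [← Finset.sum_mul]
  gcongr
  exact hC ξ

lemma sum_rpow_half_mul_le {ι : Type*} (s : Finset ι) (A B : ι → ℝ≥0∞) :
    ∑ j ∈ s, (A j * B j) ^ (1 / 2 : ℝ) ≤ ((∑ j ∈ s, A j) * ∑ j ∈ s, B j) ^ (1 / 2 : ℝ) := by
  have h := ENNReal.inner_le_Lp_mul_Lq s (fun j => A j ^ (1 / 2 : ℝ)) (fun j => B j ^ (1 / 2 : ℝ))
    .two_two
  simp only [← ENNReal.rpow_mul, one_div_mul_cancel (two_ne_zero' ℝ), ENNReal.rpow_one] at h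
  simpa only [ENNReal.mul_rpow_of_nonneg _ _ one_half_pos.le] using h

end DyadicSums

section FourierHat

lemma fourierHat_eq_oscIntegral (f : Rn n → ℂ) (ξ : Rn n) :
    fourierHat f ξ = oscIntegral f (-ξ) := by
  simp only [fourierHat, oscIntegral, Circle.coe_exp, inner_neg_right, Complex.ofReal_neg, neg_mul,
    mul_comm Complex.I]

lemma fourierHat_eq_schwartzCheck (f : 𝓢(Rn n, ℂ)) (ξ : Rn n) :
    fourierHat f ξ = (2 * (Real.pi : ℂ)) ^ n * schwartzCheck f (-ξ) := by
  have hpi : (2 * (Real.pi : ℂ)) ^ n ≠ 0 := by simp [Real.pi_ne_zero]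
  rw [schwartzCheck_apply, fourierCheck, one_div, mul_inv_cancel_left₀ hpi]
  simp only [fourierHat, inner_neg_left, Complex.ofReal_neg, mul_neg, real_inner_comm]

lemma isBoundedIntegrable_fourierHat (f : 𝓢(Rn n, ℂ)) : IsBoundedIntegrable (fourierHat f) := by
  obtain ⟨M, hM⟩ := (schwartzCheck f).decay 0 0
  rw [show fourierHat f = fun ξ => (2 * (Real.pi : ℂ)) ^ n * schwartzCheck f (-ξ) from
    funext (fourierHat_eq_schwartzCheck f)]
  refine ⟨⟨Continuous.measurable (by fun_prop), ‖(2 * (Real.pi : ℂ)) ^ n‖ * M, fun ξ => ?_⟩,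
    (schwartzCheck f).integrable.comp_neg.const_mul _⟩
  grw [norm_mul, ← hM.2 (-ξ)]
  simp

lemma lintegral_enorm_fourierHat_sq (f : 𝓢(Rn n, ℂ)) :
    ∫⁻ ξ, ‖fourierHat f ξ‖ₑ ^ 2 = ENNReal.ofReal ((2 * Real.pi) ^ n) * ∫⁻ x, ‖f x‖ₑ ^ 2 := by
  simp only [fourierHat_eq_oscIntegral]
  rw [lintegral_neg_eq_self (fun ξ => ‖oscIntegral f ξ‖ₑ ^ 2),
    lintegral_enorm_oscIntegral_sq f.integrable (f.memLp 2), finrank_euclideanSpace_fin]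

end FourierHat

section DyadicPieces

/-- The part of the symbol at the dyadic frequency `2 ^ j`. -/
def dyadicSymbol (Φ : 𝓢(Rn2 n, ℂ)) (j : ℕ) (σ : Phase n → ℂ) (X : Phase n) : ℂ :=
  σ X * lpPiece Φ j (WithLp.toLp 2 (X.2.1, X.2.2))

variable {σ : Phase n → ℂ} {Φ : 𝓢(Rn2 n, ℂ)} {a b : Rn n → ℂ} {ρ m s₀ s₁ s₂ : ℝ}

lemma rescaledPiece_eq_rescaleSymbol (Φ : 𝓢(Rn2 n, ℂ)) (ρ : ℝ) (j : ℕ) (σ : Phase n → ℂ) :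
    rescaledPiece Φ ρ j σ = rescaleSymbol ((2 : ℝ) ^ (j * ρ)) (dyadicSymbol Φ j σ) := by
  ext X
  simp only [rescaledPiece, rescaleSymbol, dyadicSymbol, Real.rpow_neg zero_le_two]

lemma IsBoundedMeasurable.dyadicSymbol (hσ : IsBoundedMeasurable σ) (Φ : 𝓢(Rn2 n, ℂ)) (j : ℕ) :
    IsBoundedMeasurable (dyadicSymbol Φ j σ) := by
  obtain ⟨A, hA⟩ := hσ.exists_bound
  obtain ⟨M, hM⟩ := exists_norm_lpPiece_le Φ
  refine ⟨hσ.measurable.mul ((continuous_lpPiece Φ j).comp (by fun_prop)).measurable, A * M,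
    fun X => ?_⟩
  rw [_root_.dyadicSymbol, norm_mul]
  exact mul_le_mul (hA X) (hM j _) (norm_nonneg _) ((norm_nonneg _).trans (hA X))

lemma norm_le_norm_toLp_two (ξ η : Rn n) :
    ‖ξ‖ ≤ ‖(WithLp.toLp 2 (ξ, η) : Rn2 n)‖ ∧ ‖η‖ ≤ ‖(WithLp.toLp 2 (ξ, η) : Rn2 n)‖ ∧
      ‖(WithLp.toLp 2 (ξ, η) : Rn2 n)‖ ≤ ‖ξ‖ + ‖η‖ := by
  rw [WithLp.prod_norm_eq_of_L2, WithLp.toLp_fst, WithLp.toLp_snd]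
  refine ⟨Real.le_sqrt_of_sq_le (le_add_of_nonneg_right (sq_nonneg _)),
    Real.le_sqrt_of_sq_le (le_add_of_nonneg_left (sq_nonneg _)),
    Real.sqrt_le_iff.2 ⟨by positivity, ?_⟩⟩
  rw [add_sq]
  have : 0 ≤ 2 * ‖ξ‖ * ‖η‖ := by positivity
  linarith

lemma hasFrequencySupport_dyadicSymbol (hΦ : IsLPGenerator Φ) (j : ℕ) (σ : Phase n → ℂ) :
    HasFrequencySupport (dyadicSymbol Φ j σ) (dyadicBall n j) (dyadicAnnulus n j) := by
  intro x ξ η h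
  obtain ⟨hξ, hη, hadd⟩ := norm_le_norm_toLp_two ξ η
  have hpiece := right_ne_zero_of_mul h
  have hball := hΦ.norm_le_of_lpPiece_ne_zero hpiece
  refine ⟨hξ.trans hball, hη.trans hball, ?_⟩
  cases j with
  | zero => exact .inl ⟨hξ.trans hball, .inl rfl⟩
  | succ j =>
    have hfar := hΦ.two_pow_lt_norm_of_lpPiece_ne_zero hpiece
    rcases le_total ‖ξ‖ ‖η‖ with hle | hle
    · exact .inr ⟨hη.trans hball, .inr (by rw [pow_succ]; linarith)⟩
    · exact .inl ⟨hξ.trans hball, .inr (by rw [pow_succ]; linarith)⟩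

lemma blockNorm_rescaledPiece_le (φ : 𝓢(Rn n, ℂ)) (Φ : 𝓢(Rn2 n, ℂ)) (ρ m : ℝ)
    (hs₀ : (n : ℝ) / 2 ≤ s₀) (hs₁ : (n : ℝ) / 2 ≤ s₁) (hs₂ : (n : ℝ) / 2 ≤ s₂) (σ : Phase n → ℂ)
    (j : ℕ) : blockNorm φ (rescaledPiece Φ ρ j σ) ≤
      ENNReal.ofReal ((2 : ℝ) ^ (j * m)) * normBS φ Φ ρ m s₀ s₁ s₂ σ := by
  unfold normBS
  grw [← le_iSup _ j]
  rw [← ENNReal.tsum_mul_left]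
  refine ENNReal.tsum_le_tsum fun k => ?_
  rw [← mul_assoc, ← ENNReal.ofReal_mul (by positivity), ← Real.rpow_add two_pos,
    add_neg_cancel_left, ← ofReal_two_pow_pow, ENNReal.ofReal_rpow_of_nonneg (by positivity)
      one_half_pos.le, ← pow_mul, ← Real.rpow_natCast, ← Real.rpow_mul zero_le_two]
  gcongr
  · exact one_le_two
  · push_cast
    have h₀ := mul_le_mul_of_nonneg_left hs₀ (Nat.cast_nonneg (α := ℝ) k.1)
    have h₁ := mul_le_mul_of_nonneg_left hs₁ (Nat.cast_nonneg (α := ℝ) k.2.1)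
    have h₂ := mul_le_mul_of_nonneg_left hs₂ (Nat.cast_nonneg (α := ℝ) k.2.2)
    linarith

lemma blockNorm_rescaledPiece_mul_le (φ : 𝓢(Rn n, ℂ)) (Φ : 𝓢(Rn2 n, ℂ))
    (hm : m ≤ -((1 - ρ) * n / 2)) (hs₀ : (n : ℝ) / 2 ≤ s₀) (hs₁ : (n : ℝ) / 2 ≤ s₁)
    (hs₂ : (n : ℝ) / 2 ≤ s₂) (σ : Phase n → ℂ) (j : ℕ) :
    blockNorm φ (rescaledPiece Φ ρ j σ) *
      ENNReal.ofReal (((2 : ℝ) ^ (j * (1 - ρ))) ^ n) ^ (1 / 2 : ℝ) ≤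
        normBS φ Φ ρ m s₀ s₁ s₂ σ := by
  have hone : ENNReal.ofReal ((2 : ℝ) ^ (j * m)) *
      ENNReal.ofReal (((2 : ℝ) ^ (j * (1 - ρ))) ^ n) ^ (1 / 2 : ℝ) ≤ 1 := by
    rw [ENNReal.ofReal_rpow_of_nonneg (by positivity) one_half_pos.le,
      ← ENNReal.ofReal_mul (by positivity), ← Real.rpow_natCast, ← Real.rpow_mul zero_le_two,
      ← Real.rpow_mul zero_le_two, ← Real.rpow_add two_pos, ENNReal.ofReal_le_one]
    refine Real.rpow_le_one_of_one_le_of_nonpos one_le_two ?_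
    have := mul_le_mul_of_nonneg_left hm (Nat.cast_nonneg (α := ℝ) j)
    linarith
  grw [blockNorm_rescaledPiece_le φ Φ ρ m hs₀ hs₁ hs₂ σ j, mul_right_comm, hone, one_mul]

end DyadicPieces

section DyadicSum

/-- The weighted energy of `a` on the ball of the `j`-th dyadic piece, in the coordinates rescaled
by `2 ^ (j * ρ)`. -/
def ballEnergy (ρ : ℝ) (a : Rn n → ℂ) (j : ℕ) : ℝ≥0∞ :=
  ∫⁻ ξ in dyadicBall n j,
    scaleWeight ((2 : ℝ) ^ (j * (1 - ρ))) (((2 : ℝ) ^ (j * ρ))⁻¹ • ξ) * ‖a ξ‖ₑ ^ 2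

/-- The energy of `a` on the annulus of the `j`-th dyadic piece. -/
def annulusEnergy (a : Rn n → ℂ) (j : ℕ) : ℝ≥0∞ :=
  ∫⁻ ξ in dyadicAnnulus n j, ‖a ξ‖ₑ ^ 2

lemma exists_sum_ballEnergy_le {ρ : ℝ} (hρ : ρ < 1) :
    ∃ C : ℝ≥0, ∀ (a : Rn n → ℂ) (J : ℕ), Measurable a →
      ∑ j ∈ Finset.range J, ballEnergy ρ a j ≤ C * ∫⁻ ξ, ‖a ξ‖ₑ ^ 2 := by
  obtain ⟨C, hC⟩ := exists_sum_indicator_scaleWeight_le (n := n) hρ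
  exact ⟨C, fun a J ha => sum_setLIntegral_mul_le measurableSet_dyadicBall
    (fun j => (measurable_scaleWeight _).comp (measurable_const_smul _)) (hC · J) (by fun_prop)⟩

lemma sum_annulusEnergy_le {a : Rn n → ℂ} (ha : Measurable a) (J : ℕ) :
    ∑ j ∈ Finset.range J, annulusEnergy a j ≤ 17 * ∫⁻ ξ, ‖a ξ‖ₑ ^ 2 := by
  have h := sum_setLIntegral_mul_le (μ := volume) (h := fun ξ => ‖a ξ‖ₑ ^ 2)
    measurableSet_dyadicAnnulus (fun _ => measurable_const)
    (fun ξ => sum_indicator_dyadicAnnulus_le ξ J) (by fun_prop)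
  simpa only [one_mul, annulusEnergy] using h

lemma exists_sum_rpow_half_ballEnergy_mul_annulusEnergy_le {ρ : ℝ} (hρ : ρ < 1) :
    ∃ C : ℝ≥0, ∀ (a b : Rn n → ℂ) (J : ℕ), Measurable a → Measurable b →
      ∑ j ∈ Finset.range J, (ballEnergy ρ a j * annulusEnergy b j) ^ (1 / 2 : ℝ) ≤
        C * ((∫⁻ ξ, ‖a ξ‖ₑ ^ 2) * ∫⁻ η, ‖b η‖ₑ ^ 2) ^ (1 / 2 : ℝ) := by
  obtain ⟨C, hC⟩ := exists_sum_ballEnergy_le (n := n) hρ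
  refine ⟨(C * 17) ^ (1 / 2 : ℝ), fun a b J ha hb => ?_⟩
  grw [sum_rpow_half_mul_le, hC a J ha, sum_annulusEnergy_le hb]
  rw [mul_mul_mul_comm, ENNReal.mul_rpow_of_nonneg _ _ one_half_pos.le,
    ENNReal.coe_rpow_of_nonneg _ one_half_pos.le, ENNReal.coe_mul, ENNReal.coe_ofNat]

variable {φ : 𝓢(Rn n, ℂ)} {ρ m s₀ s₁ s₂ : ℝ}

lemma exists_lintegral_bilinearFourierOp_dyadicSymbol_le (hφ : IsLPGenerator φ) (hn : 0 < n)
    (hρ : ρ < 1) (hm : m ≤ -((1 - ρ) * n / 2)) (hs₀ : (n : ℝ) / 2 ≤ s₀) (hs₁ : (n : ℝ) / 2 ≤ s₁)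
    (hs₂ : (n : ℝ) / 2 ≤ s₂) :
    ∃ C : ℝ≥0, ∀ (Φ : 𝓢(Rn2 n, ℂ)) (σ : Phase n → ℂ) (a b : Rn n → ℂ) (j : ℕ),
      IsLPGenerator Φ → IsBoundedMeasurable σ → IsBoundedIntegrable a → IsBoundedIntegrable b →
      ∫⁻ x, ‖bilinearFourierOp (dyadicSymbol Φ j σ) a b x‖ₑ ≤ C * normBS φ Φ ρ m s₀ s₁ s₂ σ *
        ((ballEnergy ρ a j * annulusEnergy b j) ^ (1 / 2 : ℝ) +
          (annulusEnergy a j * ballEnergy ρ b j) ^ (1 / 2 : ℝ)) := by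
  obtain ⟨C, hC⟩ := exists_lintegral_bilinearFourierOp_le_of_hasFrequencySupport hφ hn
  refine ⟨C, fun Φ σ a b j hΦ hσ ha hb => ?_⟩
  have hN : (1 : ℝ) ≤ 2 ^ (j * (1 - ρ)) :=
    Real.one_le_rpow one_le_two (mul_nonneg (Nat.cast_nonneg j) (sub_nonneg.2 hρ.le))
  have hle := hC (dyadicSymbol Φ j σ) (dyadicBall n j) (dyadicAnnulus n j) a b ((2 : ℝ) ^ (j * ρ))
    ((2 : ℝ) ^ (j * (1 - ρ))) (hσ.dyadicSymbol Φ j) (measurableSet_dyadicBall j)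
    (measurableSet_dyadicAnnulus j) (hasFrequencySupport_dyadicSymbol hΦ j σ) ha hb
    (by positivity) hN
  rw [← rescaledPiece_eq_rescaleSymbol, mul_assoc (C : ℝ≥0∞)] at hle
  grw [blockNorm_rescaledPiece_mul_le φ Φ hm hs₀ hs₁ hs₂ σ j] at hle
  exact hle

lemma exists_sum_lintegral_bilinearFourierOp_dyadicSymbol_le (hφ : IsLPGenerator φ) (hn : 0 < n)
    (hρ : ρ < 1) (hm : m ≤ -((1 - ρ) * n / 2)) (hs₀ : (n : ℝ) / 2 ≤ s₀) (hs₁ : (n : ℝ) / 2 ≤ s₁)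
    (hs₂ : (n : ℝ) / 2 ≤ s₂) :
    ∃ C : ℝ≥0, ∀ (Φ : 𝓢(Rn2 n, ℂ)) (σ : Phase n → ℂ) (a b : Rn n → ℂ) (J : ℕ),
      IsLPGenerator Φ → IsBoundedMeasurable σ → IsBoundedIntegrable a → IsBoundedIntegrable b →
      ∑ j ∈ Finset.range J, ∫⁻ x, ‖bilinearFourierOp (dyadicSymbol Φ j σ) a b x‖ₑ ≤
        C * normBS φ Φ ρ m s₀ s₁ s₂ σ *
          ((∫⁻ ξ, ‖a ξ‖ₑ ^ 2) * ∫⁻ η, ‖b η‖ₑ ^ 2) ^ (1 / 2 : ℝ) := by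
  obtain ⟨C, hC⟩ :=
    exists_lintegral_bilinearFourierOp_dyadicSymbol_le hφ hn hρ hm hs₀ hs₁ hs₂
  obtain ⟨C', hC'⟩ := exists_sum_rpow_half_ballEnergy_mul_annulusEnergy_le (n := n) hρ
  refine ⟨C * (2 * C'), fun Φ σ a b J hΦ hσ ha hb => ?_⟩
  have hab := hC' a b J ha.measurable hb.measurable
  have hba := hC' b a J hb.measurable ha.measurable
  simp only [mul_comm (ballEnergy ρ b _), mul_comm (∫⁻ ξ, ‖b ξ‖ₑ ^ 2)] at hba
  grw [Finset.sum_le_sum fun j _ => hC Φ σ a b j hΦ hσ ha hb, ← Finset.mul_sum,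
    Finset.sum_add_distrib, hab, hba]
  refine le_of_eq ?_
  push_cast
  ring

end DyadicSum

section DyadicLimit

variable {σ : Phase n → ℂ} {Φ : 𝓢(Rn2 n, ℂ)} {a b : Rn n → ℂ}

lemma sum_bilinearFourierOp_dyadicSymbol (Φ : 𝓢(Rn2 n, ℂ)) (hσ : IsBoundedMeasurable σ)
    (ha : Integrable a) (hb : Integrable b) (J : ℕ) (x : Rn n) :
    ∑ j ∈ Finset.range (J + 1), bilinearFourierOp (dyadicSymbol Φ j σ) a b x =
      ∫ p : Rn n × Rn n, dyadicDilate J Φ (WithLp.toLp 2 (p.1, p.2)) *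
        (Circle.exp (inner ℝ x (p.1 + p.2)) * σ (x, p.1, p.2) * a p.1 * b p.2) := by
  unfold bilinearFourierOp
  rw [← integral_finsetSum _ fun j _ =>
    integrable_bilinearFourierOp_integrand (hσ.dyadicSymbol Φ j) ha hb x]
  congr 1 with p
  rw [dyadicDilate_apply, ← sum_lpPiece, Finset.sum_mul]
  refine Finset.sum_congr rfl fun j _ => ?_
  rw [dyadicSymbol]
  ring

lemma tendsto_sum_bilinearFourierOp_dyadicSymbol (hΦ : IsLPGenerator Φ)
    (hσ : IsBoundedMeasurable σ) (ha : Integrable a) (hb : Integrable b) (x : Rn n) :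
    Filter.Tendsto
      (fun J => ∑ j ∈ Finset.range (J + 1), bilinearFourierOp (dyadicSymbol Φ j σ) a b x)
      Filter.atTop (nhds (bilinearFourierOp σ a b x)) := by
  simp only [sum_bilinearFourierOp_dyadicSymbol Φ hσ ha hb]
  obtain ⟨M, hM⟩ := Φ.decay 0 0
  replace hM (ζ : Rn2 n) : ‖Φ ζ‖ ≤ M := by simpa using hM.2 ζ
  have hint := integrable_bilinearFourierOp_integrand hσ ha hb x
  refine tendsto_integral_of_dominated_convergence
    (fun p => M * ‖Circle.exp (inner ℝ x (p.1 + p.2)) * σ (x, p.1, p.2) * a p.1 * b p.2‖)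
    (fun J => ?_) (hint.norm.const_mul M) (fun J => .of_forall fun p => ?_)
    (.of_forall fun p => ?_)
  · exact (((dyadicDilate J Φ).continuous.comp (by fun_prop)).aestronglyMeasurable).mul
      hint.aestronglyMeasurable
  · grw [norm_mul, dyadicDilate_apply, hM]
  · obtain ⟨J₀, hJ₀⟩ :=
      pow_unbounded_of_one_lt ‖(WithLp.toLp 2 (p.1, p.2) : Rn2 n)‖ (one_lt_two (α := ℝ))
    refine tendsto_const_nhds.congr' ?_
    filter_upwards [Filter.eventually_ge_atTop J₀] with J hJ
    rw [hΦ.dyadicDilate_eq_one (hJ₀.le.trans (pow_le_pow_right₀ one_le_two hJ)), one_mul]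

lemma lintegral_enorm_le_of_tendsto {α : Type*} [MeasurableSpace α] {μ : Measure α}
    {f : ℕ → α → ℂ} {g : α → ℂ} {M : ℝ≥0∞} (hf : ∀ J, Measurable (f J))
    (hlim : ∀ x, Filter.Tendsto (f · x) Filter.atTop (nhds (g x)))
    (hM : ∀ J, ∫⁻ x, ‖f J x‖ₑ ∂μ ≤ M) : ∫⁻ x, ‖g x‖ₑ ∂μ ≤ M :=
  calc ∫⁻ x, ‖g x‖ₑ ∂μ = ∫⁻ x, Filter.liminf (fun J => ‖f J x‖ₑ) Filter.atTop ∂μ :=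
        lintegral_congr fun x => (hlim x).enorm.liminf_eq.symm
    _ ≤ Filter.liminf (fun J => ∫⁻ x, ‖f J x‖ₑ ∂μ) Filter.atTop :=
        lintegral_liminf_le fun J => (hf J).enorm
    _ ≤ M := (Filter.liminf_le_liminf (.of_forall hM)).trans_eq (Filter.liminf_const M)

lemma lintegral_enorm_bilinearFourierOp_le_of_dyadicSymbol (hΦ : IsLPGenerator Φ)
    (hσ : IsBoundedMeasurable σ) (ha : IsBoundedIntegrable a) (hb : IsBoundedIntegrable b)
    {M : ℝ≥0∞} (hM : ∀ J, ∑ j ∈ Finset.range J,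
      ∫⁻ x, ‖bilinearFourierOp (dyadicSymbol Φ j σ) a b x‖ₑ ≤ M) :
    ∫⁻ x, ‖bilinearFourierOp σ a b x‖ₑ ≤ M := by
  have hm (j : ℕ) : Measurable (bilinearFourierOp (dyadicSymbol Φ j σ) a b) :=
    (isBoundedMeasurable_bilinearFourierOp (hσ.dyadicSymbol Φ j) ha.measurable hb.measurable
      ha.integrable hb.integrable).measurable
  refine lintegral_enorm_le_of_tendsto (fun J => Finset.measurable_fun_sum _ fun j _ => hm j)
    (tendsto_sum_bilinearFourierOp_dyadicSymbol hΦ hσ ha.integrable hb.integrable) fun J => ?_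
  refine le_trans ?_ (hM (J + 1))
  rw [← lintegral_finsetSum _ fun j _ => (hm j).enorm]
  exact lintegral_mono fun x => enorm_sum_le _ _

end DyadicLimit

section AEEquality

lemma exists_isBoundedMeasurable_ae_eq {α : Type*} [MeasurableSpace α] {μ : Measure α} {σ : α → ℂ}
    (hσ : MemLp σ ∞ μ) : ∃ τ : α → ℂ, IsBoundedMeasurable τ ∧ σ =ᵐ[μ] τ := by
  have hσm := hσ.aestronglyMeasurable
  have hmk : Measurable (hσm.mk σ) := hσm.stronglyMeasurable_mk.measurable
  set A := (eLpNorm σ ∞ μ).toReal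
  have hbound : ∀ᵐ x ∂μ, ‖σ x‖ ≤ A := by
    filter_upwards [enorm_ae_le_eLpNormEssSup σ μ] with x hx
    rw [← eLpNorm_exponent_top] at hx
    exact toReal_enorm (σ x) ▸ ENNReal.toReal_mono hσ.eLpNorm_ne_top hx
  refine ⟨{x | ‖hσm.mk σ x‖ ≤ A}.indicator (hσm.mk σ),
    ⟨hmk.indicator (measurableSet_le hmk.norm measurable_const), A, fun x => ?_⟩, ?_⟩
  · by_cases hx : x ∈ {x | ‖hσm.mk σ x‖ ≤ A}
    · rwa [Set.indicator_of_mem hx]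
    · rw [Set.indicator_of_notMem hx, norm_zero]
      exact ENNReal.toReal_nonneg
  · filter_upwards [hbound, hσm.ae_eq_mk] with x hx hmkx
    rw [Set.indicator_of_mem (by rwa [Set.mem_ofPred_eq, ← hmkx]), hmkx]

lemma quasiMeasurePreserving_const_smul {c : ℝ} (hc : c ≠ 0) :
    Measure.QuasiMeasurePreserving (fun x : Rn n => c • x) := by
  refine ⟨measurable_const_smul c, ?_⟩
  rw [Measure.map_addHaar_smul _ hc]
  exact Measure.smul_absolutelyContinuous

variable {σ τ : Phase n → ℂ}

lemma rescaledPiece_congr_ae (Φ : 𝓢(Rn2 n, ℂ)) (ρ : ℝ) (j : ℕ) (h : σ =ᵐ[volume] τ) :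
    rescaledPiece Φ ρ j σ =ᵐ[volume] rescaledPiece Φ ρ j τ := by
  have hdilate (t : ℝ) :=
    quasiMeasurePreserving_const_smul (n := n) (Real.rpow_pos_of_pos two_pos t).ne'
  filter_upwards [(QuasiMeasurePreserving.prodMap (hdilate (-(j * ρ)))
    (QuasiMeasurePreserving.prodMap (hdilate (j * ρ)) (hdilate (j * ρ)))).ae h] with X hX
  exact congrArg (· * _) hX

lemma normBS_congr_ae (φ : 𝓢(Rn n, ℂ)) (Φ : 𝓢(Rn2 n, ℂ)) (ρ m s₀ s₁ s₂ : ℝ)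
    (h : σ =ᵐ[volume] τ) : normBS φ Φ ρ m s₀ s₁ s₂ σ = normBS φ Φ ρ m s₀ s₁ s₂ τ := by
  have hblock (j : ℕ) (k : ℕ × ℕ × ℕ) :
      deltaBlock φ k (rescaledPiece Φ ρ j σ) = deltaBlock φ k (rescaledPiece Φ ρ j τ) := by
    ext X
    refine integral_congr_ae ?_
    filter_upwards [(quasiMeasurePreserving_sub_left volume X).ae (rescaledPiece_congr_ae Φ ρ j h)]
      with Y hY
    rw [hY]
  simp only [normBS, hblock]

lemma bilinearFourierOp_congr_ae (h : σ =ᵐ[volume] τ) (a b : Rn n → ℂ) :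
    bilinearFourierOp σ a b =ᵐ[volume] bilinearFourierOp τ a b := by
  filter_upwards [Measure.ae_ae_of_ae_prod h] with x hx
  refine integral_congr_ae ?_
  filter_upwards [hx] with p hp
  rw [hp]

end AEEquality

lemma bilinearPDO_eq_bilinearFourierOp (σ : Phase n → ℂ) (f g : 𝓢(Rn n, ℂ)) (x : Rn n) :
    bilinearPDO σ f g x = 1 / (2 * (Real.pi : ℂ)) ^ (2 * n) *
      bilinearFourierOp σ (fourierHat f) (fourierHat g) x := by
  simp only [bilinearPDO, bilinearFourierOp, Circle.coe_exp, mul_comm Complex.I]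

lemma aestronglyMeasurable_bilinearPDO {σ : Phase n → ℂ} (hσ : MemLp σ ∞) (f g : 𝓢(Rn n, ℂ)) :
    AEStronglyMeasurable (bilinearPDO σ f g) := by
  obtain ⟨τ, hτ, hστ⟩ := exists_isBoundedMeasurable_ae_eq hσ
  have hf := isBoundedIntegrable_fourierHat f
  have hg := isBoundedIntegrable_fourierHat g
  have hop := isBoundedMeasurable_bilinearFourierOp hτ hf.measurable hg.measurable hf.integrable
    hg.integrable
  simp only [funext (bilinearPDO_eq_bilinearFourierOp σ f g)]
  exact (hop.measurable.aestronglyMeasurable.congr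
    (bilinearFourierOp_congr_ae hστ _ _).symm).const_mul _

lemma exists_lintegral_bilinearFourierOp_le_normBS {φ : 𝓢(Rn n, ℂ)} (hφ : IsLPGenerator φ)
    (hn : 0 < n) {ρ m s₀ s₁ s₂ : ℝ} (hρ : ρ < 1) (hm : m ≤ -((1 - ρ) * n / 2))
    (hs₀ : (n : ℝ) / 2 ≤ s₀) (hs₁ : (n : ℝ) / 2 ≤ s₁) (hs₂ : (n : ℝ) / 2 ≤ s₂) :
    ∃ C : ℝ≥0, ∀ (Φ : 𝓢(Rn2 n, ℂ)) (σ : Phase n → ℂ) (a b : Rn n → ℂ), IsLPGenerator Φ →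
      MemLp σ ∞ → IsBoundedIntegrable a → IsBoundedIntegrable b →
        ∫⁻ x, ‖bilinearFourierOp σ a b x‖ₑ ≤ C * normBS φ Φ ρ m s₀ s₁ s₂ σ *
          ((∫⁻ ξ, ‖a ξ‖ₑ ^ 2) * ∫⁻ η, ‖b η‖ₑ ^ 2) ^ (1 / 2 : ℝ) := by
  obtain ⟨C, hC⟩ :=
    exists_sum_lintegral_bilinearFourierOp_dyadicSymbol_le hφ hn hρ hm hs₀ hs₁ hs₂
  refine ⟨C, fun Φ σ a b hΦ hσ ha hb => ?_⟩
  obtain ⟨τ, hτ, hστ⟩ := exists_isBoundedMeasurable_ae_eq hσ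
  have hop : ∀ᵐ x, ‖bilinearFourierOp σ a b x‖ₑ = ‖bilinearFourierOp τ a b x‖ₑ :=
    (bilinearFourierOp_congr_ae hστ a b).fun_comp enorm
  rw [normBS_congr_ae φ Φ ρ m s₀ s₁ s₂ hστ, lintegral_congr_ae hop]
  exact lintegral_enorm_bilinearFourierOp_le_of_dyadicSymbol hΦ hτ ha hb fun J =>
    hC Φ τ a b J hΦ hτ ha hb

lemma exists_eLpNorm_bilinearPDO_le {φ : 𝓢(Rn n, ℂ)} (hφ : IsLPGenerator φ) (hn : 0 < n)
    {ρ m s₀ s₁ s₂ : ℝ} (hρ : ρ < 1) (hm : m ≤ -((1 - ρ) * n / 2)) (hs₀ : (n : ℝ) / 2 ≤ s₀)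
    (hs₁ : (n : ℝ) / 2 ≤ s₁) (hs₂ : (n : ℝ) / 2 ≤ s₂) :
    ∃ C : ℝ≥0, ∀ (Φ : 𝓢(Rn2 n, ℂ)) (σ : Phase n → ℂ) (f g : 𝓢(Rn n, ℂ)), IsLPGenerator Φ →
      MemLp σ ∞ → eLpNorm (bilinearPDO σ f g) 1 ≤
        C * normBS φ Φ ρ m s₀ s₁ s₂ σ * eLpNorm f 2 * eLpNorm g 2 := by
  obtain ⟨C, hC⟩ := exists_lintegral_bilinearFourierOp_le_normBS hφ hn hρ hm hs₀ hs₁ hs₂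
  set c : ℂ := 1 / (2 * (Real.pi : ℂ)) ^ (2 * n)
  set R : ℝ≥0 := Real.toNNReal ((2 * Real.pi) ^ n)
  refine ⟨‖c‖₊ * C * R, fun Φ σ f g hΦ hσ => ?_⟩
  have hop := hC Φ σ _ _ hΦ hσ (isBoundedIntegrable_fourierHat f)
    (isBoundedIntegrable_fourierHat g)
  rw [lintegral_enorm_fourierHat_sq, lintegral_enorm_fourierHat_sq, mul_mul_mul_comm, ← sq,
    ENNReal.mul_rpow_of_nonneg _ _ one_half_pos.le, sq_rpow_half,
    ENNReal.mul_rpow_of_nonneg _ _ one_half_pos.le, ← eLpNorm_two_eq_lintegral_rpow_half,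
    ← eLpNorm_two_eq_lintegral_rpow_half] at hop
  simp only [eLpNorm_one_eq_lintegral_enorm, bilinearPDO_eq_bilinearFourierOp, enorm_mul]
  rw [lintegral_const_mul' _ _ enorm_ne_top]
  grw [hop]
  exact le_of_eq (by push_cast; rw [enorm_eq_nnnorm, ENNReal.ofReal]; ring)

end

theorem mainTheorem5_general (n : ℕ) (hn : 1 ≤ n) (ρ : ℝ) (hρ : ρ < 1)
    (m : ℝ) (hm : m ≤ -((1 - ρ) * n / 2))
    (s₀ s₁ s₂ : ℝ) (hs₀ : (n : ℝ) / 2 ≤ s₀) (hs₁ : (n : ℝ) / 2 ≤ s₁) (hs₂ : (n : ℝ) / 2 ≤ s₂)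
    (φ : 𝓢(Rn n, ℂ)) (hφ : IsLPGenerator φ) (Φ : 𝓢(Rn2 n, ℂ)) (hΦ : IsLPGenerator Φ)
    (σ : Phase n → ℂ) (hσ : MemBS φ Φ ρ m s₀ s₁ s₂ σ) :
    BoundedLpLqLr (bilinearPDO σ) 2 2 1 := by
  obtain ⟨hσtop, hσfin⟩ := hσ
  obtain ⟨C, hC⟩ := exists_eLpNorm_bilinearPDO_le hφ hn hρ hm hs₀ hs₁ hs₂
  set M := (normBS φ Φ ρ m s₀ s₁ s₂ σ).toNNReal with hM
  refine ⟨C * M, fun f g => ?_⟩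
  have hbound : eLpNorm (bilinearPDO σ f g) 1 ≤ ↑(C * M) * eLpNorm f 2 * eLpNorm g 2 := by
    rw [ENNReal.coe_mul, hM, ENNReal.coe_toNNReal hσfin.ne]
    exact hC Φ σ f g hΦ hσtop
  have hL2 (h : 𝓢(Rn n, ℂ)) : eLpNorm h 2 < ∞ := (h.memLp 2 volume).eLpNorm_lt_top
  have hfin : ↑(C * M) * eLpNorm f 2 * eLpNorm g 2 < ∞ :=
    ENNReal.mul_lt_top (ENNReal.mul_lt_top ENNReal.coe_lt_top (hL2 f)) (hL2 g)
  exact ⟨⟨aestronglyMeasurable_bilinearPDO hσtop f g, hbound.trans_lt hfin⟩, hbound⟩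

theorem mainTheorem5 (n : ℕ) (hn : 1 ≤ n) (ρ : ℝ) (hρ₀ : 0 ≤ ρ) (hρ₁ : ρ < 1)
    (m : ℝ) (hm : m = -((1 - ρ) * n / 2))
    (s₀ s₁ s₂ : ℝ) (hs₀ : (n : ℝ) / 2 ≤ s₀) (hs₁ : (n : ℝ) / 2 ≤ s₁) (hs₂ : (n : ℝ) / 2 ≤ s₂)
    (φ : 𝓢(Rn n, ℂ)) (hφ : IsLPGenerator φ) (Φ : 𝓢(Rn2 n, ℂ)) (hΦ : IsLPGenerator Φ)
    (σ : Phase n → ℂ) (hσ : MemBS φ Φ ρ m s₀ s₁ s₂ σ) :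
    BoundedLpLqLr (bilinearPDO σ) 2 2 1 :=
  mainTheorem5_general n hn ρ hρ₁ m hm.le s₀ s₁ s₂ hs₀ hs₁ hs₂ φ hφ Φ hΦ σ hσ
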